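/- Let $a_n=\frac{1}{4^n}\binom{2n}{n}$ for $n\ge 0$. For positive integers $s_1,\dots,s_d$ and $N$-th roots of unity $z_1,\dots,z_d$ with $(s_1,z_1)\ne(1,1)$, the number $$\mathrm{Li}_{s_1,\dots,s_d}(z_1,\dots,z_d)=\sum_{n_1>\cdots>n_d>0}\frac{z_1^{n_1}\cdots z_d^{n_d}}{n_1^{s_1}\cdots n_d^{s_d}}=\lim_{M\to\infty}\ \sum_{M\ge n_1>\cdots>n_d>0}\frac{z_1^{n_1}\cdots z_d^{n_d}}{n_1^{s_1}\cdots n_d^{s_d}}$$ is called a colored multiple zeta value of level $N$ and weight $s_1+\cdots+s_d$; for $d=0$ it is $1$, of weight $0$. Let $\mathrm{CMZV}^N_w\subset\mathbb C$ be the $\mathbb Q$-span of those of level $N$ and weight $w$, and let $\mathrm{CMZV}^N_{\le w}=\sum_{0\le k\le w}\mathrm{CMZV}^N_k$. For a $\mathbb Q$-subspace $V\subset\mathbb C$ write $V\otimes\mathbb Q[i]$ for its $\mathbb Q[i]$-span in $\mathbb C$. Let $d\ge 1$, let $\mathbf s=(s_1,\dots,s_d)$ be positive integers with $s_1\ge 3$,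 put $|\mathbf s|=s_1+\cdots+s_d$, and let each $l_j(n)$ be one of $2n$, $2n+1$, $2n-1$. Put $n_{d+1}=0$. Let $\underset{j}{\succ}$ be "$\ge$" if $l_j(n)=2n+1$ and "$>$" otherwise. Set $\eta(l)=2$ if $l(n)=2n-1$ and $\eta(l)=0$ otherwise; $\iota(l)=2$ if $l(n)=2n$ and $\iota(l)=1$ otherwise, and read $\iota(l_2)$ as $1$ if $d=1$. All summation indices are non-negative integers. (a) If $l_j(n)\in\{2n,2n+1\}$ for all $j$, then the following series converges absolutely and $$\sum_{n_1\underset{1}{\succ}\cdots\underset{d-1}{\succ}n_d\underset{d}{\succ}0}\frac{a_{n_1}^2}{l_1(n_1)^{s_1}\cdots l_d(n_d)^{s_d}}\in\frac{i}{\pi}\,\mathrm{CMZV}^4_{|\mathbf s|+1}.$$ (b) In general, the same series converges absolutely and its sum lies in $$\frac1\pi\,\mathrm{CMZV}^4_{\le\max\{|\mathbf s|+1-\eta(l_1),\,\iota(l_2)\}}\otimes\mathbb Q[i].$$ (c) More generally, for every choice of signs $\succ_1,\dots,\succ_d\in\{>,\ge\}$ such that no $l_j(n_j)$ vanishes on the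 range of summation, the series $$\sum_{n_1\succ_1 n_2\succ_2\cdots\succ_{d-1}n_d\succ_d 0}\frac{a_{n_1}^2}{l_1(n_1)^{s_1}\cdots l_d(n_d)^{s_d}}$$ converges absolutely and its sum lies in $$\frac1\pi\,\mathrm{CMZV}^4_{\le\max\{|\mathbf s|+1-\eta(l_1),\,\iota(l_2)\}}\otimes\mathbb Q[i].$$ -/

import Mathlib

noncomputable section

namespace AperyBinomial

/-! ### Colored multiple zeta values -/

/-- The truncated colored multiple zeta sum
`∑_{N ≥ n₁ > ⋯ > n_d > 0} z₁^{n₁} ⋯ z_d^{n_d} / (n₁^{s₁} ⋯ n_d^{s_d})`.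
For `d = 0` it is the empty sum convention `1`. -/
def cmzvPartial {d : ℕ} (s : Fin d → ℕ) (z : Fin d → ℂ) (N : ℕ) : ℂ := by
  classical
  exact ∑ n ∈ (Fintype.piFinset fun _ : Fin d => Finset.Icc 1 N).filter
      (fun n : Fin d → ℕ => StrictAnti n),
    ∏ j, z j ^ n j / (n j : ℂ) ^ s j

/-- `v` is a colored multiple zeta value of level `N` and weight `w`: there are positive integers
`s₁, …, s_d` of sum `w` and `N`-th roots of unity `z₁, …, z_d` with `(s₁, z₁) ≠ (1, 1)` such that
`v = Li_s(z)`. The series converges only conditionally when `s₁ = 1`, so its value is the limit of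
the sums over `n₁ ≤ M` as `M → ∞`. In depth `0` (weight `0`) the value is `1`. -/
def IsCMZV (N w : ℕ) (v : ℂ) : Prop :=
  ∃ (d : ℕ) (s : Fin d → ℕ) (z : Fin d → ℂ),
    (∀ j, 1 ≤ s j) ∧ (∀ j, z j ^ N = 1) ∧
    (∀ h : 0 < d, ¬ (s ⟨0, h⟩ = 1 ∧ z ⟨0, h⟩ = 1)) ∧
    ∑ j, s j = w ∧
    Filter.Tendsto (cmzvPartial s z) Filter.atTop (nhds v)

/-- The `ℚ`-vector space spanned by the colored multiple zeta values of level `N`, weight `w`. -/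
def CMZV (N w : ℕ) : Submodule ℚ ℂ := Submodule.span ℚ {v | IsCMZV N w v}

/-- The `ℚ`-vector space spanned by the colored multiple zeta values of level `N` and
weight at most `w`. -/
def CMZVLe (N w : ℕ) : Submodule ℚ ℂ := ⨆ k : Fin (w + 1), CMZV N k

/-- Extension of scalars from `ℚ` to `ℚ[i]` inside `ℂ`: the `ℚ[i]`-span of `V`. -/
def extendQi (V : Submodule ℚ ℂ) :
    Submodule (Algebra.adjoin ℚ ({Complex.I} : Set ℂ)) ℂ :=
  Submodule.span (Algebra.adjoin ℚ ({Complex.I} : Set ℂ)) (V : Set ℂ)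

/-! ### Apéry-type central binomial series -/

/-- The numbers `a_n = binom(2n, n) / 4^n`. -/
def a (n : ℕ) : ℝ := (Nat.centralBinom n : ℝ) / 4 ^ n

/-- The three linear forms `2n`, `2n + 1`, `2n - 1`. -/
inductive LinForm
  | even
  | oddSucc
  | oddPred

/-- The value of a linear form at `n`. -/
def LinForm.val : LinForm → ℕ → ℤ
  | .even, n => 2 * n
  | .oddSucc, n => 2 * n + 1
  | .oddPred, n => 2 * n - 1

/-- `η(l) = 2` if `l(n) = 2n - 1` and `η(l) = 0` otherwise. -/
def LinForm.eta : LinForm → ℕ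
  | .even => 0
  | .oddSucc => 0
  | .oddPred => 2

/-- `ι(l) = 2` if `l(n) = 2n` and `ι(l) = 1` otherwise. -/
def LinForm.iota : LinForm → ℕ
  | .even => 2
  | .oddSucc => 1
  | .oddPred => 1

/-- `ι(l₂)`, with `ι(∅) = 1` when `d = 1`. -/
def iotaSecond {d : ℕ} (l : Fin d → LinForm) : ℕ :=
  if h : 1 < d then (l ⟨1, h⟩).iota else 1

/-- The inequality signs `>` and `≥`. -/
inductive Sign
  | gt
  | ge

/-- `r.Holds m n` is `m > n` or `m ≥ n` according to the sign `r`. -/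
def Sign.Holds : Sign → ℕ → ℕ → Prop
  | .gt, m, n => m > n
  | .ge, m, n => m ≥ n

/-- The sign attached to a linear form: `≥` for `2n + 1` and `>` for `2n` and `2n - 1`. -/
def LinForm.sign : LinForm → Sign
  | .even => .gt
  | .oddSucc => .ge
  | .oddPred => .gt

/-- The index `n_{j+1}`, with `n_{d+1} = 0`. -/
def next {d : ℕ} (n : Fin d → ℕ) (j : Fin d) : ℕ :=
  if h : (j : ℕ) + 1 < d then n ⟨j + 1, h⟩ else 0

/-- The set of all `(n₁, …, n_d)` with `n₁ ≻₁ n₂ ≻₂ ⋯ ≻_{d-1} n_d ≻_d 0`. -/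
def indexSet {d : ℕ} (r : Fin d → Sign) : Set (Fin d → ℕ) :=
  {n | ∀ j, (r j).Holds (n j) (next n j)}

/-- The summand `a_{n₁}² / (l₁(n₁)^{s₁} ⋯ l_d(n_d)^{s_d})`. -/
def term {d : ℕ} (hd : 0 < d) (l : Fin d → LinForm) (s : Fin d → ℕ) (n : Fin d → ℕ) : ℝ :=
  a (n ⟨0, hd⟩) ^ 2 / ∏ j, ((l j).val (n j) : ℝ) ^ s j

end AperyBinomial

end

/-!
# Apéry-type series with squared central binomial coefficients

The idea is to realize `π ∑ a_n² c_n`, for nested sums `c_n`, as an integral of forms with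
logarithmic poles at `0` and the fourth roots of unity, and to evaluate such integrals by colored
multiple zeta values of level four.

Since `a_n = (2/π) ∫₀^{π/2} cos^{2n}`, the sum `π ∑ a_n f_n` is up to a rational factor the integral
over `0 < x < 1` of `∑ f_n x ^ (2n)` against `dx / √(1 - x²)` (`pi_mul_tsum_mem`). For
`f_n = a_n T_τ(N) / N ^ (k + 1)`, with a nested sum `T_τ` whose indices have prescribed parities and
`N = 2n` or `N = 2n + 1`, the generating function satisfies, together with
`√(1 - x²) ∑ a_n T_τ(2n + 1) x ^ (2n)`, a triangular system of differential equations in the forms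
`dx / x`, `dx / √(1 - x²)`, `dx / (x √(1 - x²))` and `x dx / (1 - x²)`. The system closes up because
of the recurrence `2n a_n = (2n - 1) a_{n-1}` (`hasDerivAt_K`) and because the binomial series
`∑ a_n x ^ (2n)` is `1 / √(1 - x²)` (`K_nil`). Under `x = (1 - t²) / (1 + t²)` all four forms become
combinations of `dt / t` and `z dt / (1 - z t)` with `z⁴ = 1`; only `dx / √(1 - x²)` has
coefficients in `i ℚ`, the others have coefficients in `ℚ`, which accounts for the factor `i` in the
homogeneous evaluation `pi_mul_tsum_fR_mem`.

Iterated integrals need not be set up. The generating functions are described by how they pair with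
hyperlogarithms, which are power series in `t` (`Good`, `Dens`): integration by parts moves one form
at a time onto the hyperlogarithm as a new letter (`Good.densAt_letter`), and at the end the value
at `t = 1` of a hyperlogarithm is a colored multiple zeta value, by Abel's theorem and Dirichlet's
test (`exists_tendsto_hyperlog_one`).

If all `l_j(n)` are `2n` or `2n + 1` with the signs attached to them, the inner sums are values of
nested sums `T` at `l_1(n_1)`, up to terms of smaller depth (`stepMap_gR_mem`), and the homogeneous
evaluation applies to each of them. In general partial fractions reduce the inner sums to
combinations of `T_τ(2n) / l(n) ^ j` of bounded weight (`divMap_mem`, `sumMap_mem`). The outermost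
sums with denominators `2n - 1` are evaluated separately (`mR_mem`): for exponent `1` by integrating
`√(1 - x²) ∑ a_n T_τ(2n + 2) x ^ (2n)` against `dx` (`hasIntIn_W`), for exponent `2` by telescoping,
and for larger exponents by the shift `n ↦ n + 1`, since `a_{n-1} = a_n (1 + 1 / (2n - 1))`. This
lowers the weight by two. As `s_1 ≥ 3`, all other terms produced by partial fractions have a weight
within the resulting bound `|s| + 1 - η(l_1)` (`divMap_mem_valueSpace`).

Absolute convergence rests on `a_n² ≤ 1 / (2n + 1)` and on the fact that nested sums are
`O(n ^ (1/4))`.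
-/

noncomputable section

namespace AperyBinomial

open Filter Topology Finset

/-! ### Power series with bounded coefficients -/

/-- The power series with coefficients `c`, as a function of a real variable. -/
def PS (c : ℕ → ℂ) (y : ℝ) : ℂ := ∑' n, c n * (y : ℂ) ^ n

/-- A sequence with bounded norms. -/
def Bdd (c : ℕ → ℂ) : Prop := ∃ C : ℝ, ∀ n, ‖c n‖ ≤ C

theorem summable_norm_ps {c : ℕ → ℂ} (hc : Bdd c) {y : ℝ} (hy : |y| < 1) :
    Summable fun n => ‖c n * (y : ℂ) ^ n‖ := by
  obtain ⟨C, hC⟩ := hc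
  refine Summable.of_nonneg_of_le (fun n => norm_nonneg _) (fun n => ?_)
    ((summable_geometric_of_lt_one (abs_nonneg y) hy).mul_left C)
  rw [norm_mul, norm_pow, Complex.norm_real, Real.norm_eq_abs]
  gcongr
  exact hC n

theorem summable_ps {c : ℕ → ℂ} (hc : Bdd c) {y : ℝ} (hy : |y| < 1) :
    Summable fun n => c n * (y : ℂ) ^ n := (summable_norm_ps hc hy).of_norm

theorem summable_norm_nat_mul_ps {c : ℕ → ℂ} (hc : Bdd c) {y : ℝ} (hy : |y| < 1) :
    Summable fun n : ℕ => ‖(n : ℂ) * c n * (y : ℂ) ^ n‖ := by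
  obtain ⟨C, hC⟩ := hc
  have h := (summable_pow_mul_geometric_of_norm_lt_one (R := ℝ) 1 (r := |y|)
    (by simpa using hy)).mul_left C
  refine Summable.of_nonneg_of_le (fun n => norm_nonneg _) (fun n => ?_) h
  rw [norm_mul, norm_mul, norm_pow, Complex.norm_real, Real.norm_eq_abs, Complex.norm_natCast,
    pow_one]
  calc (n : ℝ) * ‖c n‖ * |y| ^ n ≤ n * C * |y| ^ n := by gcongr; exact hC n
    _ = _ := by ring

theorem summable_nat_mul_ps {c : ℕ → ℂ} (hc : Bdd c) {y : ℝ} (hy : |y| < 1) :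
    Summable fun n : ℕ => (n : ℂ) * c n * (y : ℂ) ^ n := (summable_norm_nat_mul_ps hc hy).of_norm

theorem ps_zero (c : ℕ → ℂ) : PS c 0 = c 0 := by
  unfold PS
  rw [tsum_eq_single 0]
  · simp
  · intro n hn
    simp [hn]

theorem ps_eq_add {c : ℕ → ℂ} {y : ℝ} (h : Summable fun n => c n * (y : ℂ) ^ n) :
    PS c y = c 0 + y * PS (fun n => c (n + 1)) y := by
  unfold PS
  rw [h.tsum_eq_zero_add, ← tsum_mul_left]
  simp only [pow_zero, mul_one, pow_succ]
  congr 1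
  exact tsum_congr fun n => by ring

/-- Termwise differentiation, on a slightly smaller interval where the derived series is dominated
by a convergent numerical series. -/
theorem hasDerivAt_ps {c : ℕ → ℂ} (hc : Bdd c) {y : ℝ} (hy : |y| < 1) :
    HasDerivAt (PS c) (PS (fun n => ((n : ℂ) + 1) * c (n + 1)) y) y := by
  obtain ⟨r, hr1, hr2⟩ := exists_between hy
  have hr0 : 0 < r := (abs_nonneg y).trans_lt hr1
  have hrr : |r| < 1 := by rwa [abs_of_pos hr0]
  have hu : Summable fun n : ℕ => ‖(n : ℂ) * c n‖ * r ^ (n - 1) := by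
    have := (summable_norm_nat_mul_ps hc hrr).mul_left r⁻¹
    refine this.congr fun n => ?_
    rcases n with _ | n
    · simp
    · rw [norm_mul _ ((r : ℂ) ^ _), norm_pow, Complex.norm_real, Real.norm_of_nonneg hr0.le,
        Nat.add_sub_cancel, pow_succ]
      field_simp
  have h := hasDerivAt_tsum_of_isPreconnected (𝕜 := ℝ) (t := Set.Ioo (-r) r) (y₀ := 0) (y := y)
    (g := fun n z => c n * (z : ℂ) ^ n)
    (g' := fun n z => c n * (n * (z : ℂ) ^ (n - 1))) hu isOpen_Ioo isPreconnected_Ioo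
    (fun n z _ => by
      have h1 : HasDerivAt (fun z : ℝ => (z : ℂ) ^ n) (n * (z : ℂ) ^ (n - 1)) z := by
        simpa using (hasDerivAt_pow n (z : ℂ)).comp_ofReal
      exact h1.const_mul _)
    (fun n z hz => by
      have hz' : |z| ≤ r := abs_le.2 ⟨hz.1.le, hz.2.le⟩
      rw [show c n * ((n : ℂ) * (z : ℂ) ^ (n - 1)) = (n : ℂ) * c n * (z : ℂ) ^ (n - 1) by ring,
        norm_mul _ ((z : ℂ) ^ _), norm_pow, Complex.norm_real, Real.norm_eq_abs]
      gcongr)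
    ⟨by linarith, hr0⟩ (summable_ps hc (by simp)) (abs_lt.1 hr1)
  have hs : Summable fun n : ℕ => c n * ((n : ℂ) * (y : ℂ) ^ (n - 1)) := by
    refine Summable.of_norm_bounded hu fun n => ?_
    rw [show c n * ((n : ℂ) * (y : ℂ) ^ (n - 1)) = (n : ℂ) * c n * (y : ℂ) ^ (n - 1) by ring,
      norm_mul _ ((y : ℂ) ^ _), norm_pow, Complex.norm_real, Real.norm_eq_abs]
    gcongr
  have e : PS (fun n => ((n : ℂ) + 1) * c (n + 1)) y
      = ∑' n : ℕ, c n * ((n : ℂ) * (y : ℂ) ^ (n - 1)) := by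
    rw [hs.tsum_eq_zero_add]
    unfold PS
    simp only [CharP.cast_eq_zero, zero_mul, mul_zero, zero_add, Nat.add_sub_cancel]
    exact tsum_congr fun n => by push_cast; ring
  rw [e]
  exact h

/-- The Euler operator `y d/dy` multiplies the `n`-th coefficient by `n`. -/
theorem exists_hasDerivAt_ps {c : ℕ → ℂ} (hc : Bdd c) {y : ℝ} (hy : |y| < 1) :
    ∃ D : ℂ, HasDerivAt (PS c) D y ∧ (y : ℂ) * D = PS (fun n => n * c n) y := by
  refine ⟨_, hasDerivAt_ps hc hy, ?_⟩
  rw [ps_eq_add (c := fun n => (n : ℂ) * c n) (summable_nat_mul_ps hc hy)]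
  simp [PS]

theorem continuousAt_ps {c : ℕ → ℂ} (hc : Bdd c) {y : ℝ} (hy : |y| < 1) :
    ContinuousAt (PS c) y := (hasDerivAt_ps hc hy).continuousAt

/-- Abel's limit theorem. -/
theorem tendsto_ps_one {c : ℕ → ℂ} {v : ℂ}
    (h : Tendsto (fun N => ∑ n ∈ range N, c n) atTop (𝓝 v)) :
    Tendsto (PS c) (𝓝[<] 1) (𝓝 v) := by
  have := Complex.tendsto_tsum_powerSeries_nhdsWithin_lt h
  rwa [tendsto_map'_iff] at this

theorem Bdd.of_tendsto {c : ℕ → ℂ} {v : ℂ} (h : Tendsto c atTop (𝓝 v)) : Bdd c := by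
  obtain ⟨C, hC⟩ := (Metric.isBounded_range_of_tendsto c h).exists_norm_le
  exact ⟨C, fun n => hC _ ⟨n, rfl⟩⟩

theorem eventually_abs_lt_one : ∀ᶠ y : ℝ in 𝓝[<] 1, |y| < 1 := by
  filter_upwards [Ioo_mem_nhdsLT (show (0 : ℝ) < 1 by norm_num)] with y hy
  rw [abs_of_pos hy.1]
  exact hy.2

/-- If the coefficients tend to zero, the power series is `o(1/(1-y))`: multiplying by `1 - y`
replaces the coefficients by their successive differences, to which Abel's limit theorem
applies. -/
theorem tendsto_one_sub_mul_ps {c : ℕ → ℂ} (h : Tendsto c atTop (𝓝 0)) :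
    Tendsto (fun y : ℝ => (1 - (y : ℂ)) * PS c y) (𝓝[<] 1) (𝓝 0) := by
  have hb := Bdd.of_tendsto h
  set d : ℕ → ℂ := fun n => c n - (if n = 0 then 0 else c (n - 1)) with hd
  have hsum : ∀ N, ∑ n ∈ range (N + 1), d n = c N := by
    intro N
    induction N with
    | zero => simp [hd]
    | succ N ih => rw [sum_range_succ, ih]; simp [hd]
  have h1 : Tendsto (fun N => ∑ n ∈ range N, d n) atTop (𝓝 0) := by
    rw [← tendsto_add_atTop_iff_nat 1]
    simpa only [hsum] using h
  refine (tendsto_ps_one h1).congr' ?_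
  filter_upwards [eventually_abs_lt_one] with y hy
  have hs := summable_ps hb hy
  have hs1 : Summable fun n => (if n = 0 then 0 else c (n - 1)) * (y : ℂ) ^ n := by
    rw [← summable_nat_add_iff 1]
    refine (hs.mul_left (y : ℂ)).congr fun n => ?_
    simp [pow_succ]
    ring
  have h2 : PS d y = PS c y - PS (fun n => if n = 0 then 0 else c (n - 1)) y := by
    unfold PS
    rw [← hs.tsum_sub hs1]
    exact tsum_congr fun n => by simp only [hd]; ring
  rw [h2, ps_eq_add hs1]
  simp only [↓reduceIte, Nat.add_eq_zero_iff, one_ne_zero, and_false, Nat.add_sub_cancel]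
  ring

/-! ### The growth scale `n ^ (1/4)` -/

/-- The scale `n ^ (1/4)`. Partial sums of `∑ n ^ (1/4) / n` are again `O(n ^ (1/4))`, so bounds in
this scale pass through every nested sum. -/
def q (n : ℕ) : ℝ := √(√(n : ℝ))

theorem q_nonneg (n : ℕ) : 0 ≤ q n := Real.sqrt_nonneg _

theorem q_pow_four (n : ℕ) : q n ^ 4 = n := by
  rw [q, show (4 : ℕ) = 2 * 2 from rfl, pow_mul, Real.sq_sqrt (Real.sqrt_nonneg _),
    Real.sq_sqrt (Nat.cast_nonneg n)]

theorem q_mono {m n : ℕ} (h : m ≤ n) : q m ≤ q n :=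
  Real.sqrt_le_sqrt (Real.sqrt_le_sqrt (Nat.cast_le.2 h))

theorem one_le_q {n : ℕ} (h : 1 ≤ n) : 1 ≤ q n := by
  have := q_mono h
  simpa [q] using this

theorem q_zero : q 0 = 0 := by simp [q]

theorem sum_q_div_le (n : ℕ) : ∑ m ∈ range (n + 1), q m / m ≤ 4 * q n := by
  induction n with
  | zero => simp [q_zero]
  | succ n ih =>
    rw [sum_range_succ]
    have h1 := one_le_q (n := n + 1) (by omega)
    have h2 := q_mono (m := n) (n := n + 1) (by omega)
    have h0 := q_nonneg n
    have h3 := q_pow_four n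
    have h4 := q_pow_four (n + 1)
    push_cast at h4
    set y := q (n + 1)
    set z := q n
    have : y / ((n + 1 : ℕ) : ℝ) ≤ 4 * (y - z) := by
      push_cast
      rw [← h4, div_le_iff₀ (by positivity)]
      have h5 : y ^ 4 - z ^ 4 = 1 := by rw [h3, h4]; ring
      have h6 : y ^ 4 - z ^ 4 ≤ (y - z) * (4 * y ^ 3) := by
        have : y ^ 4 - z ^ 4 = (y - z) * (y ^ 3 + y ^ 2 * z + y * z ^ 2 + z ^ 3) := by ring
        rw [this]
        apply mul_le_mul_of_nonneg_left _ (by linarith)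
        have a1 : y ^ 2 * z ≤ y ^ 2 * y := by gcongr
        have a2 : y * z ^ 2 ≤ y * y ^ 2 := by gcongr
        have a3 : z ^ 3 ≤ y ^ 3 := by gcongr
        nlinarith
      nlinarith
    linarith

theorem q_eq_rpow (n : ℕ) : q n = (n : ℝ) ^ (1 / 4 : ℝ) := by
  rw [q, Real.sqrt_eq_rpow, Real.sqrt_eq_rpow, ← Real.rpow_mul (Nat.cast_nonneg n)]
  norm_num

theorem summable_q_div_sq : Summable fun n : ℕ => q n / (n : ℝ) ^ 2 := by
  have h : Summable fun n : ℕ => 1 / (n : ℝ) ^ (7 / 4 : ℝ) :=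
    Real.summable_one_div_nat_rpow.2 (by norm_num)
  refine h.congr fun n => ?_
  rcases Nat.eq_zero_or_pos n with rfl | hn
  · simp [q_zero]
  · have hn' : (0 : ℝ) < n := by exact_mod_cast hn
    rw [q_eq_rpow, ← Real.rpow_natCast, ← Real.rpow_sub hn', one_div, ← Real.rpow_neg hn'.le]
    norm_num

theorem tendsto_q_div : Tendsto (fun n : ℕ => q n / n) atTop (𝓝 0) := by
  have h : Tendsto (fun n : ℕ => (n : ℝ) ^ (-(3 / 4 : ℝ))) atTop (𝓝 0) :=
    (tendsto_rpow_neg_atTop (by norm_num)).comp tendsto_natCast_atTop_atTop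
  refine h.congr' ?_
  filter_upwards [eventually_gt_atTop 0] with n hn
  have hn' : (0 : ℝ) < n := by exact_mod_cast hn
  rw [q_eq_rpow]
  nth_rewrite 3 [← Real.rpow_one (n : ℝ)]
  rw [← Real.rpow_sub hn']
  norm_num

/-- Sequences that are `O(n ^ (1/4) / n)` and vanish at `0`. -/
def Tame (c : ℕ → ℂ) : Prop := ∃ C : ℝ, ∀ n, ‖c n‖ ≤ C * (q n / n)

theorem Tame.exists_nonneg {c : ℕ → ℂ} (h : Tame c) :
    ∃ C : ℝ, 0 ≤ C ∧ ∀ n, ‖c n‖ ≤ C * (q n / n) := by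
  obtain ⟨C, hC⟩ := h
  refine ⟨|C|, abs_nonneg C, fun n => (hC n).trans ?_⟩
  have : 0 ≤ q n / n := div_nonneg (q_nonneg n) (Nat.cast_nonneg n)
  exact mul_le_mul_of_nonneg_right (le_abs_self C) this

theorem Tame.tendsto {c : ℕ → ℂ} (h : Tame c) : Tendsto c atTop (𝓝 0) := by
  obtain ⟨C, hC⟩ := h
  exact squeeze_zero_norm hC (by simpa using tendsto_q_div.const_mul C)

theorem Tame.bdd {c : ℕ → ℂ} (h : Tame c) : Bdd c := Bdd.of_tendsto h.tendsto

theorem Tame.map_zero {c : ℕ → ℂ} (h : Tame c) : c 0 = 0 := by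
  obtain ⟨C, hC⟩ := h
  simpa using hC 0

theorem Tame.summable_div {c : ℕ → ℂ} (h : Tame c) : Summable fun n => c n / n := by
  obtain ⟨C, hC⟩ := h
  refine Summable.of_norm_bounded (summable_q_div_sq.mul_left C) fun n => ?_
  rw [norm_div, Complex.norm_natCast, pow_two, ← div_div, mul_div_assoc']
  gcongr
  exact hC n

/-- Partial sums of a sequence that is `O(n ^ (1/4) / n)` are `O(n ^ (1/4))`. -/
theorem norm_sum_le_q {E : Type*} [SeminormedAddCommGroup E] {C : ℝ} (h0 : 0 ≤ C) {n : ℕ}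
    {f : ℕ → E} (hf : ∀ m < n, ‖f m‖ ≤ C * (q m / m)) : ‖∑ m ∈ range n, f m‖ ≤ 4 * C * q n := by
  rcases n with _ | n
  · simp [q_zero]
  · calc ‖∑ m ∈ range (n + 1), f m‖ ≤ ∑ m ∈ range (n + 1), C * (q m / m) :=
        norm_sum_le_of_le _ fun m hm => hf m (mem_range.1 hm)
      _ = C * ∑ m ∈ range (n + 1), q m / m := by rw [mul_sum]
      _ ≤ C * (4 * q n) := by gcongr; exact sum_q_div_le n
      _ ≤ 4 * C * q (n + 1) := by
        have := q_mono (m := n) (n := n + 1) (by omega)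
        nlinarith

/-- Dirichlet's test: `∑ zⁿ b_n` converges when `z ≠ 1` lies on the unit circle and `b` is a null
sequence of bounded variation. -/
theorem exists_tendsto_sum_pow_mul {z : ℂ} (hz : ‖z‖ = 1) (hz1 : z ≠ 1) {b : ℕ → ℂ}
    (hb0 : Tendsto b atTop (𝓝 0)) (hb : Summable fun n => ‖b (n + 1) - b n‖) :
    ∃ v, Tendsto (fun N => ∑ n ∈ range N, z ^ n * b n) atTop (𝓝 v) := by
  set G : ℕ → ℂ := fun n => (z ^ n - 1) / (z - 1) with hG
  have hz1' : z - 1 ≠ 0 := sub_ne_zero.2 hz1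
  have hGb : ∀ n, ‖G n‖ ≤ 2 / ‖z - 1‖ := by
    intro n
    rw [hG, norm_div]
    gcongr
    calc ‖z ^ n - 1‖ ≤ ‖z ^ n‖ + ‖(1 : ℂ)‖ := norm_sub_le _ _
      _ = 2 := by rw [norm_pow, hz]; norm_num
  have hGs : ∀ n, G (n + 1) - G n = z ^ n := by
    intro n
    simp only [hG]
    field_simp
    ring
  have hsum : ∀ N, ∑ n ∈ range N, z ^ n * b n
      = G N * b N - ∑ n ∈ range N, G (n + 1) * (b (n + 1) - b n) := by
    intro N
    induction N with
    | zero => simp [hG]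
    | succ N ih => rw [sum_range_succ, ih, sum_range_succ, ← hGs]; ring
  have hs : Summable fun n => G (n + 1) * (b (n + 1) - b n) := by
    refine Summable.of_norm_bounded (hb.mul_left (2 / ‖z - 1‖)) fun n => ?_
    rw [norm_mul]
    gcongr
    exact hGb _
  have h0 : Tendsto (fun N => G N * b N) atTop (𝓝 0) := by
    refine squeeze_zero_norm (a := fun N => 2 / ‖z - 1‖ * ‖b N‖) (fun N => ?_) ?_
    · rw [norm_mul]
      gcongr
      exact hGb N
    · simpa using hb0.norm.const_mul (2 / ‖z - 1‖)
  simp only [hsum]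
  exact ⟨_, h0.sub hs.hasSum.tendsto_sum_nat⟩

/-! ### Hyperlogarithms with singularities at `0` and the fourth roots of unity -/

/-- The alphabet of differential forms: `none` stands for `dt / t` and `some z`, with `z ^ 4 = 1`,
for `z dt / (1 - z t)`. -/
abbrev Letter : Type := Option {z : ℂ // z ^ 4 = 1}

/-- The density of the differential form attached to a letter. -/
def letterFun : Letter → ℝ → ℂ
  | none, t => 1 / t
  | some z, t => z.1 / (1 - z.1 * t)

/-- The Taylor coefficients at `0` of the hyperlogarithm of a word: the iterated integral
from `0`, the first letter being the outermost form. Words ending in `dt / t`, for which the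
integral diverges at `0`, get zero coefficients. -/
def coef : List Letter → ℕ → ℂ
  | [], n => if n = 0 then 1 else 0
  | none :: u, n => coef u n / n
  | some z :: u, n => (∑ m ∈ range n, z.1 ^ (n - m) * coef u m) / n

/-- The hyperlogarithm of a word. -/
def hyperlog (u : List Letter) : ℝ → ℂ := PS (coef u)

theorem norm_eq_one_of_pow_four {z : ℂ} (h : z ^ 4 = 1) : ‖z‖ = 1 :=
  Complex.norm_eq_one_of_pow_eq_one h (by norm_num)

theorem ne_zero_of_pow_four {z : ℂ} (h : z ^ 4 = 1) : z ≠ 0 := by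
  rintro rfl
  norm_num at h

theorem coef_singleton (z : {z : ℂ // z ^ 4 = 1}) (n : ℕ) :
    coef [some z] n = z.1 ^ n / n := by
  rcases n with _ | n
  · simp [coef]
  · simp only [coef]
    rw [sum_eq_single 0]
    · simp
    · intro m _ hm
      simp [hm]
    · simp

/-- The coefficients of a nonempty word are `O(n ^ (1/4) / n)`: the division by `n` in each letter
compensates for the summation. -/
theorem tame_coef {u : List Letter} (hu : u ≠ []) : Tame (coef u) := by
  induction u with
  | nil => exact absurd rfl hu
  | cons a u ih =>
    by_cases hu' : u = []
    · subst hu'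
      refine ⟨1, fun n => ?_⟩
      have hq : 0 ≤ q n / n := div_nonneg (q_nonneg n) (Nat.cast_nonneg n)
      rcases Nat.eq_zero_or_pos n with rfl | hn
      · rcases a with _ | z <;> simp [coef]
      rcases a with _ | z
      · simpa [coef, hn.ne'] using hq
      · rw [coef_singleton, norm_div, norm_pow, norm_eq_one_of_pow_four z.2, one_pow,
          Complex.norm_natCast, one_mul]
        gcongr
        exact one_le_q hn
    · obtain ⟨C, hC0, hC⟩ := (ih hu').exists_nonneg
      rcases a with _ | z
      · refine ⟨C, fun n => ?_⟩
        simp only [coef, norm_div, Complex.norm_natCast]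
        refine (div_le_self_of_nat (norm_nonneg _) n).trans (hC n)
      · refine ⟨4 * C, fun n => ?_⟩
        simp only [coef, norm_div, Complex.norm_natCast]
        rw [← mul_div_assoc]
        gcongr
        refine norm_sum_le_q hC0 fun m _ => ?_
        rw [norm_mul, norm_pow, norm_eq_one_of_pow_four z.2, one_pow, one_mul]
        exact hC m
where
  div_le_self_of_nat {x : ℝ} (hx : 0 ≤ x) (n : ℕ) : x / n ≤ x := by
    rcases n with _ | n
    · simpa using hx
    · exact div_le_self hx (by push_cast; linarith [(Nat.cast_nonneg n : (0 : ℝ) ≤ n)])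

theorem bdd_coef (u : List Letter) : Bdd (coef u) := by
  by_cases hu : u = []
  · subst hu
    refine ⟨1, fun n => ?_⟩
    by_cases hn : n = 0 <;> simp [coef, hn]
  · exact (tame_coef hu).bdd

theorem hyperlog_nil (t : ℝ) : hyperlog [] t = 1 := by
  unfold hyperlog PS
  rw [tsum_eq_single 0]
  · simp [coef]
  · intro n hn
    simp [coef, hn]

theorem one_sub_mul_ne_zero {z : ℂ} (hz : z ^ 4 = 1) {t : ℝ} (ht : |t| < 1) :
    1 - z * t ≠ 0 := by
  intro h
  have h1 : z * t = 1 := (sub_eq_zero.1 h).symm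
  have h2 : ‖z * t‖ = 1 := by rw [h1]; simp
  rw [norm_mul, norm_eq_one_of_pow_four hz, Complex.norm_real, Real.norm_eq_abs] at h2
  linarith

theorem abs_lt_one_of_mem {t : ℝ} (ht : t ∈ Set.Ioo (0 : ℝ) 1) : |t| < 1 := by
  rw [abs_of_pos ht.1]
  exact ht.2

/-- The differential equation of hyperlogarithms. The excluded word `dt / t` would require a
logarithm. -/
theorem hasDerivAt_hyperlog (a : Letter) (u : List Letter) (h : u ≠ [] ∨ a ≠ none) {t : ℝ}
    (ht : t ∈ Set.Ioo (0 : ℝ) 1) :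
    HasDerivAt (hyperlog (a :: u)) (letterFun a t * hyperlog u t) t := by
  have ht' := abs_lt_one_of_mem ht
  have ht0 : (t : ℂ) ≠ 0 := by exact_mod_cast ht.1.ne'
  have hd := hasDerivAt_ps (bdd_coef (a :: u)) ht'
  suffices PS (fun n => ((n : ℂ) + 1) * coef (a :: u) (n + 1)) t
      = letterFun a t * hyperlog u t by
    rw [← this]
    exact hd
  rcases a with _ | z
  · have hu : u ≠ [] := by simpa using h
    have h1 := ps_eq_add (summable_ps (bdd_coef u) ht')
    rw [(tame_coef hu).map_zero, zero_add] at h1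
    have h2 : (fun n : ℕ => ((n : ℂ) + 1) * coef (none :: u) (n + 1))
        = fun n => coef u (n + 1) := by
      funext n
      have : (n : ℂ) + 1 ≠ 0 := by exact_mod_cast n.succ_ne_zero
      simp only [coef]
      push_cast
      field_simp
    rw [h2, hyperlog, h1]
    simp only [letterFun]
    field_simp
  · have h2 : (fun n : ℕ => ((n : ℂ) + 1) * coef (some z :: u) (n + 1))
        = fun n => ∑ m ∈ range (n + 1), z.1 ^ (n + 1 - m) * coef u m := by
      funext n
      have : (n : ℂ) + 1 ≠ 0 := by exact_mod_cast n.succ_ne_zero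
      simp only [coef]
      push_cast
      field_simp
    have hz : ‖z.1 * (t : ℂ)‖ < 1 := by
      rw [norm_mul, norm_eq_one_of_pow_four z.2, Complex.norm_real, Real.norm_eq_abs, one_mul]
      exact ht'
    have hg : Summable fun n : ℕ => ‖(z.1 * (t : ℂ)) ^ n‖ := by
      simp only [norm_pow]
      exact summable_geometric_of_lt_one (norm_nonneg _) hz
    have h3 := tsum_mul_tsum_eq_tsum_sum_range_of_summable_norm
      (summable_norm_ps (bdd_coef u) ht') hg
    rw [tsum_geometric_of_norm_lt_one hz] at h3
    rw [h2, letterFun, div_eq_mul_inv, mul_assoc, mul_comm _ (hyperlog u t)]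
    unfold hyperlog
    unfold PS
    rw [h3, ← tsum_mul_left]
    refine tsum_congr fun n => ?_
    rw [sum_mul, mul_sum]
    refine sum_congr rfl fun m hm => ?_
    obtain ⟨k, rfl⟩ := Nat.exists_eq_add_of_le (Nat.lt_succ_iff.1 (mem_range.1 hm))
    rw [show m + k + 1 - m = k + 1 by omega, show m + k - m = k by omega, mul_pow, pow_add, pow_add]
    ring

theorem tendsto_hyperlog_zero {u : List Letter} (hu : u ≠ []) :
    Tendsto (hyperlog u) (𝓝[>] 0) (𝓝 0) := by
  have h := (continuousAt_ps (bdd_coef u) (y := 0) (by simp)).tendsto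
  rw [ps_zero, (tame_coef hu).map_zero] at h
  exact h.mono_left nhdsWithin_le_nhds

theorem tendsto_div_self_ps {c : ℕ → ℂ} (hc : Bdd c) (h0 : c 0 = 0) :
    Tendsto (fun t : ℝ => PS c t / t) (𝓝[>] 0) (𝓝 (c 1)) := by
  have hb : Bdd fun n => c (n + 1) := by
    obtain ⟨C, hC⟩ := hc
    exact ⟨C, fun n => hC _⟩
  have h := (continuousAt_ps hb (y := 0) (by simp)).tendsto
  rw [ps_zero] at h
  refine (h.mono_left nhdsWithin_le_nhds).congr' ?_
  filter_upwards [Ioo_mem_nhdsGT (show (0 : ℝ) < 1 by norm_num)] with t ht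
  have ht0 : (t : ℂ) ≠ 0 := by exact_mod_cast ht.1.ne'
  rw [ps_eq_add (summable_ps hc (abs_lt_one_of_mem ht)), h0]
  field_simp
  ring

/-- Hyperlogarithms of nonempty words are `O(t)` at `0`. -/
theorem tendsto_hyperlog_mul_zero {u : List Letter} (hu : u ≠ []) {R : ℝ → ℂ}
    (hR : Tendsto (fun t : ℝ => (t : ℂ) * R t) (𝓝[>] 0) (𝓝 0)) :
    Tendsto (fun t => hyperlog u t * R t) (𝓝[>] 0) (𝓝 0) := by
  have h := (tendsto_div_self_ps (bdd_coef u) (tame_coef hu).map_zero).mul hR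
  rw [mul_zero] at h
  refine h.congr' ?_
  filter_upwards [Ioo_mem_nhdsGT (show (0 : ℝ) < 1 by norm_num)] with t ht
  have ht0 : (t : ℂ) ≠ 0 := by exact_mod_cast ht.1.ne'
  unfold hyperlog
  field_simp

/-- Hyperlogarithms of nonempty words are `o(1 / (1 - t))` at `1`. -/
theorem tendsto_hyperlog_mul_one {u : List Letter} (hu : u ≠ []) {R : ℝ → ℂ} {r : ℂ}
    (hR : Tendsto (fun t : ℝ => R t / (1 - (t : ℂ))) (𝓝[<] 1) (𝓝 r)) :
    Tendsto (fun t => hyperlog u t * R t) (𝓝[<] 1) (𝓝 0) := by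
  have h := (tendsto_one_sub_mul_ps (tame_coef hu).tendsto).mul hR
  rw [zero_mul] at h
  refine h.congr' ?_
  filter_upwards [Ioo_mem_nhdsLT (show (0 : ℝ) < 1 by norm_num)] with t ht
  have ht0 : 1 - (t : ℂ) ≠ 0 := by
    rw [sub_ne_zero]
    exact_mod_cast ht.2.ne'
  unfold hyperlog
  field_simp

/-! ### Values of hyperlogarithms at `1` are colored multiple zeta values -/

/-- The truncated colored multiple zeta sum, with the indices given as a list. -/
def cpart : List (ℕ × ℂ) → ℕ → ℂ
  | [], _ => 1
  | p :: l, N => ∑ n ∈ Icc 1 N, p.2 ^ n / (n : ℂ) ^ p.1 * cpart l (n - 1)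

theorem cmzvPartial_zero (s : Fin 0 → ℕ) (z : Fin 0 → ℂ) (N : ℕ) : cmzvPartial s z N = 1 := by
  unfold cmzvPartial
  simp only [univ_eq_empty, prod_empty, sum_const, nsmul_eq_mul, mul_one]
  rw [filter_true_of_mem (p := fun n : Fin 0 → ℕ => StrictAnti n) (fun n _ i => i.elim0)]
  simp

/-- Splitting off the largest index. -/
theorem cmzvPartial_succ {d : ℕ} (s : Fin (d + 1) → ℕ) (z : Fin (d + 1) → ℂ) (N : ℕ) :
    cmzvPartial s z N = ∑ n ∈ Icc 1 N, z 0 ^ n / (n : ℂ) ^ s 0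
      * cmzvPartial (fun i => s i.succ) (fun i => z i.succ) (n - 1) := by
  classical
  unfold cmzvPartial
  simp_rw [mul_sum]
  rw [sum_sigma']
  refine sum_bij' (fun n _ => ⟨n 0, fun i => n i.succ⟩) (fun p _ => Fin.cons p.1 p.2) ?_ ?_ ?_ ?_ ?_
  · intro n hn
    simp only [mem_filter, Fintype.mem_piFinset, mem_Icc, mem_sigma] at hn ⊢
    refine ⟨hn.1 0, fun i => ⟨(hn.1 _).1, ?_⟩, fun i j hij => hn.2 (Fin.succ_lt_succ_iff.2 hij)⟩
    have := hn.2 (Fin.succ_pos i)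
    omega
  · rintro ⟨m, n⟩ hp
    simp only [mem_filter, Fintype.mem_piFinset, mem_Icc, mem_sigma] at hp ⊢
    obtain ⟨hm, hn, ha⟩ := hp
    refine ⟨fun i => ?_, fun i j hij => ?_⟩
    · refine Fin.cases ?_ (fun i => ?_) i
      · simpa using hm
      · have := hn i
        simp only [Fin.cons_succ]
        omega
    · induction j using Fin.cases with
      | zero => exact absurd hij (Fin.not_lt_zero i)
      | succ j =>
        induction i using Fin.cases with
        | zero =>
          have := hn j
          simp only [Fin.cons_succ, Fin.cons_zero]
          omega
        | succ i =>
          simp only [Fin.cons_succ]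
          exact ha (Fin.succ_lt_succ_iff.1 hij)
  · intro n _
    exact Fin.cons_self_tail n
  · intro p _
    simp
  · intro n _
    rw [Fin.prod_univ_succ]

theorem cmzvPartial_get (l : List (ℕ × ℂ)) (N : ℕ) :
    cmzvPartial (fun i : Fin l.length => (l.get i).1) (fun i => (l.get i).2) N = cpart l N := by
  induction l generalizing N with
  | nil => exact cmzvPartial_zero _ _ _
  | cons p l ih =>
    rw [cpart]
    refine (cmzvPartial_succ (d := l.length) _ _ N).trans (sum_congr rfl fun n _ => ?_)
    exact congrArg _ (ih (n - 1))

theorem isCMZV_of_list {l : List (ℕ × ℂ)} {v : ℂ} (h1 : ∀ p ∈ l, 1 ≤ p.1)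
    (h2 : ∀ p ∈ l, p.2 ^ 4 = 1) (h3 : ∀ p ∈ l.head?, ¬ (p.1 = 1 ∧ p.2 = 1))
    (h : Tendsto (cpart l) atTop (𝓝 v)) : IsCMZV 4 (l.map Prod.fst).sum v := by
  refine ⟨l.length, fun i => (l.get i).1, fun i => (l.get i).2, fun i => h1 _ (l.get_mem i),
    fun i => h2 _ (l.get_mem i), fun hl => ?_, ?_, ?_⟩
  · rcases l with _ | ⟨p, l⟩
    · simp at hl
    · exact h3 p (by simp)
  · rw [← List.sum_ofFn]
    congr 1
    conv_rhs => rw [← List.ofFn_get l]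
    rw [List.map_ofFn]
    rfl
  · refine h.congr fun N => (cmzvPartial_get l N).symm

/-- A word either gives the zero hyperlogarithm or corresponds to the indices of a colored multiple
zeta value. -/
theorem coef_eq_zero_or_exists_list (a : Letter) (u : List Letter) :
    (∀ n, coef (a :: u) n = 0) ∨ ∃ (p : ℕ × ℂ) (l : List (ℕ × ℂ)),
      (∀ p' ∈ p :: l, 1 ≤ p'.1) ∧ (∀ p' ∈ p :: l, p'.2 ^ 4 = 1) ∧
      ((p :: l).map Prod.fst).sum = (a :: u).length ∧
      (a = none → 2 ≤ p.1) ∧ (∀ z, a = some z → p.2 = z.1) ∧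
      ∀ n, 1 ≤ n → coef (a :: u) n = p.2 ^ n / (n : ℂ) ^ p.1 * cpart l (n - 1) := by
  induction u generalizing a with
  | nil =>
    rcases a with _ | z
    · left
      intro n
      by_cases hn : n = 0 <;> simp [coef, hn]
    · right
      refine ⟨(1, z.1), [], by simp, by simpa using z.2, by simp, by simp, by simp, fun n _ => ?_⟩
      rw [coef_singleton]
      simp [cpart]
  | cons b u ih =>
    rcases ih b with h0 | ⟨p, l, h1, h2, h3, -, -, h5⟩
    · left
      intro n
      rcases a with _ | z <;> rw [coef] <;> simp [h0]
    · right
      rcases a with _ | z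
      · refine ⟨(p.1 + 1, p.2), l, ?_, ?_, ?_, ?_, by simp, fun n hn => ?_⟩
        · intro p' hp'
          rcases List.mem_cons.1 hp' with rfl | hp'
          · simp
          · exact h1 _ (List.mem_cons_of_mem _ hp')
        · intro p' hp'
          rcases List.mem_cons.1 hp' with rfl | hp'
          · exact h2 p (List.mem_cons_self ..)
          · exact h2 _ (List.mem_cons_of_mem _ hp')
        · simp only [List.map_cons, List.sum_cons, List.length_cons] at h3 ⊢
          omega
        · intro _
          have := h1 p (List.mem_cons_self ..)
          simpa using this
        · have hn' : (n : ℂ) ≠ 0 := by exact_mod_cast (by omega : n ≠ 0)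
          rw [coef, h5 n hn, pow_succ]
          field_simp
      · -- the weights `z ^ (n - m)` make the next argument `p.2 / z` rather than `p.2`
        have hz := ne_zero_of_pow_four z.2
        refine ⟨(1, z.1), (p.1, p.2 / z.1) :: l, ?_, ?_, ?_, by simp, by simp, fun n hn => ?_⟩
        · intro p' hp'
          rcases List.mem_cons.1 hp' with rfl | hp'
          · simp
          rcases List.mem_cons.1 hp' with rfl | hp'
          · exact h1 p (List.mem_cons_self ..)
          · exact h1 _ (List.mem_cons_of_mem _ hp')
        · intro p' hp'
          rcases List.mem_cons.1 hp' with rfl | hp'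
          · exact z.2
          rcases List.mem_cons.1 hp' with rfl | hp'
          · simp only [div_pow, z.2, h2 p (List.mem_cons_self ..), div_one]
          · exact h2 _ (List.mem_cons_of_mem _ hp')
        · simp only [List.map_cons, List.sum_cons, List.length_cons] at h3 ⊢
          omega
        · have hn' : (n : ℂ) ≠ 0 := by exact_mod_cast (by omega : n ≠ 0)
          have hr : range n = insert 0 (Icc 1 (n - 1)) := by
            ext m
            simp only [mem_range, mem_insert, mem_Icc]
            omega
          rw [coef, hr, sum_insert (by simp), (tame_coef (List.cons_ne_nil b u)).map_zero, cpart,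
            mul_sum, mul_zero, zero_add, pow_one, sum_div]
          refine sum_congr rfl fun m hm => ?_
          rw [mem_Icc] at hm
          rw [h5 m hm.1, div_pow]
          have : z.1 ^ n = z.1 ^ (n - m) * z.1 ^ m := by
            rw [← pow_add]
            congr 1
            omega
          rw [this]
          have := pow_ne_zero m hz
          field_simp

theorem coef_cons_some (z : {z : ℂ // z ^ 4 = 1}) (u : List Letter) (n : ℕ) :
    coef (some z :: u) n
      = z.1 ^ n * ((∑ m ∈ range n, (z.1 ^ m)⁻¹ * coef u m) / n) := by
  rw [coef, ← mul_div_assoc, mul_sum]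
  congr 1
  refine sum_congr rfl fun m hm => ?_
  have h1 : z.1 ^ n = z.1 ^ (n - m) * z.1 ^ m := by
    rw [← pow_add]
    congr 1
    have := mem_range.1 hm
    omega
  have h2 := pow_ne_zero m (ne_zero_of_pow_four z.2)
  rw [h1, mul_assoc, mul_inv_cancel_left₀ h2]

/-- If the averages `H n / n` of a sequence `f` are tame, so that `H n = O(n ^ (1/4))`, then their
successive differences are absolutely summable. -/
theorem summable_norm_sub_of_tame {f : ℕ → ℂ} {C C' : ℝ} (hC0 : 0 ≤ C) (hC0' : 0 ≤ C')
    (hC : ∀ n : ℕ, ‖(∑ m ∈ range n, f m) / (n : ℂ)‖ ≤ C * (q n / n))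
    (hC' : ∀ n, 1 ≤ n → ‖f n‖ ≤ C' * (q n / n)) :
    Summable fun n : ℕ => ‖(∑ m ∈ range (n + 1), f m) / ((n + 1 : ℕ) : ℂ)
      - (∑ m ∈ range n, f m) / (n : ℂ)‖ := by
  rw [← summable_nat_add_iff 1]
  have hs := ((summable_nat_add_iff 1).2 summable_q_div_sq).mul_left (C + C')
  refine Summable.of_nonneg_of_le (fun _ => norm_nonneg _) (fun n => ?_) hs
  generalize hk : n + 1 = k
  have hk0 : (k : ℂ) ≠ 0 := by exact_mod_cast (by omega : k ≠ 0)
  have hkr : (0 : ℝ) < k := by exact_mod_cast (by omega : 0 < k)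
  have hk1 : ((k + 1 : ℕ) : ℂ) ≠ 0 := by exact_mod_cast (by omega : k + 1 ≠ 0)
  have hkk : (k : ℝ) ≤ ((k + 1 : ℕ) : ℝ) := by push_cast; linarith
  have e : (∑ m ∈ range (k + 1), f m) / ((k + 1 : ℕ) : ℂ) - (∑ m ∈ range k, f m) / (k : ℂ)
      = f k / ((k + 1 : ℕ) : ℂ) - (∑ m ∈ range k, f m) / (k : ℂ) / ((k + 1 : ℕ) : ℂ) := by
    rw [sum_range_succ]
    field_simp
    push_cast
    ring
  have hC1 := hC k
  rw [e]
  calc _ ≤ ‖f k / ((k + 1 : ℕ) : ℂ)‖ + ‖(∑ m ∈ range k, f m) / (k : ℂ) / ((k + 1 : ℕ) : ℂ)‖ :=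
        norm_sub_le _ _
    _ = ‖f k‖ / ((k + 1 : ℕ) : ℝ) + ‖(∑ m ∈ range k, f m) / (k : ℂ)‖ / ((k + 1 : ℕ) : ℝ) := by
        rw [norm_div, Complex.norm_natCast, norm_div _ ((k + 1 : ℕ) : ℂ), Complex.norm_natCast]
    _ ≤ C' * (q k / k) / k + C * (q k / k) / k := by
        gcongr
        · exact mul_nonneg hC0' (div_nonneg (q_nonneg _) hkr.le)
        · exact hC' k (by omega)
        · exact mul_nonneg hC0 (div_nonneg (q_nonneg _) hkr.le)
    _ = (C + C') * (q k / (k : ℝ) ^ 2) := by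
        field_simp
        ring

/-- At `t = 1` the series converges absolutely if the outermost form is `dt / t`, and by Dirichlet's
test if it is `z dt / (1 - z t)` with `z ≠ 1`. -/
theorem exists_tendsto_sum_coef (a : Letter) (u : List Letter)
    (ha : ∀ z, a = some z → z.1 ≠ 1) :
    ∃ v, Tendsto (fun N => ∑ n ∈ range N, coef (a :: u) n) atTop (𝓝 v) := by
  rcases a with _ | z
  · by_cases hu : u = []
    · subst hu
      refine ⟨0, tendsto_const_nhds.congr fun N => (sum_eq_zero fun n _ => ?_).symm⟩
      by_cases hn : n = 0 <;> simp [coef, hn]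
    · exact ⟨_, (tame_coef hu).summable_div.hasSum.tendsto_sum_nat⟩
  · have hz1 := norm_eq_one_of_pow_four z.2
    have hcn : ∀ n, ‖coef (some z :: u) n‖
        = ‖(∑ m ∈ range n, (z.1 ^ m)⁻¹ * coef u m) / (n : ℂ)‖ := by
      intro n
      rw [coef_cons_some, norm_mul, norm_pow, hz1, one_pow, one_mul]
    have ht := tame_coef (List.cons_ne_nil (some z) u)
    have hb0 : Tendsto (fun n : ℕ => (∑ m ∈ range n, (z.1 ^ m)⁻¹ * coef u m) / (n : ℂ))
        atTop (𝓝 0) := by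
      refine tendsto_zero_iff_norm_tendsto_zero.2 ?_
      simpa only [← hcn] using tendsto_zero_iff_norm_tendsto_zero.1 ht.tendsto
    obtain ⟨C, hC0, hC⟩ := ht.exists_nonneg
    obtain ⟨C', hC0', hC'⟩ : ∃ C' : ℝ, 0 ≤ C' ∧ ∀ n, 1 ≤ n → ‖coef u n‖ ≤ C' * (q n / n) := by
      by_cases hu : u = []
      · subst hu
        exact ⟨0, le_rfl, fun n hn => by simp [coef, Nat.one_le_iff_ne_zero.1 hn]⟩
      · obtain ⟨C', h0, h⟩ := (tame_coef hu).exists_nonneg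
        exact ⟨C', h0, fun n _ => h n⟩
    have hb := summable_norm_sub_of_tame (f := fun m => (z.1 ^ m)⁻¹ * coef u m) hC0 hC0'
      (fun n => by rw [← hcn]; exact hC n)
      (fun n hn => by
        rw [norm_mul, norm_inv, norm_pow, hz1, one_pow, inv_one, one_mul]
        exact hC' n hn)
    obtain ⟨v, hv⟩ := exists_tendsto_sum_pow_mul hz1 (ha z rfl) hb0 hb
    exact ⟨v, by simpa only [coef_cons_some] using hv⟩

/-- The hyperlogarithm of a word that does not begin with `dt / (1 - t)` has a limit at `1`, by
Abel's theorem the sum of its coefficients, which is either `0` or a colored multiple zeta value. -/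
theorem exists_tendsto_hyperlog_one (a : Letter) (u : List Letter)
    (ha : ∀ z, a = some z → z.1 ≠ 1) :
    ∃ v ∈ CMZV 4 (a :: u).length, Tendsto (hyperlog (a :: u)) (𝓝[<] 1) (𝓝 v) := by
  obtain ⟨v, hv⟩ := exists_tendsto_sum_coef a u ha
  refine ⟨v, ?_, tendsto_ps_one hv⟩
  rcases coef_eq_zero_or_exists_list a u with h0 | ⟨p, l, h1, h2, h3, h4, h5, h6⟩
  · simp only [h0, sum_const_zero] at hv
    rw [tendsto_nhds_unique hv tendsto_const_nhds]
    exact zero_mem _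
  · refine Submodule.subset_span ?_
    rw [Set.mem_ofPred_eq, ← h3]
    refine isCMZV_of_list h1 h2 ?_ ?_
    · intro p' hp'
      obtain rfl : p = p' := by simpa using hp'
      rintro ⟨e1, e2⟩
      rcases a with _ | z
      · have := h4 rfl
        omega
      · exact ha z rfl ((h5 z rfl).symm.trans e2)
    · have := (tendsto_add_atTop_iff_nat 1).2 hv
      refine this.congr fun N => ?_
      have hr : range (N + 1) = insert 0 (Icc 1 N) := by
        ext m
        simp only [mem_range, mem_insert, mem_Icc]
        omega
      rw [hr, sum_insert (by simp), (tame_coef (List.cons_ne_nil a u)).map_zero, zero_add, cpart]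
      exact sum_congr rfl fun n hn => h6 n (mem_Icc.1 hn).1

/-! ### Integrals over the unit interval, expressed through primitives -/

/-- The improper integral of `f` over `(0, 1)` exists, in the sense that `f` has a primitive on
`(0, 1)` with limits at both ends, and its value lies in `V`. -/
def HasIntIn (V : Submodule ℚ ℂ) (f : ℝ → ℂ) : Prop :=
  ∃ (P : ℝ → ℂ) (p₀ p₁ : ℂ), (∀ t ∈ Set.Ioo (0 : ℝ) 1, HasDerivAt P (f t) t) ∧
    Tendsto P (𝓝[>] 0) (𝓝 p₀) ∧ Tendsto P (𝓝[<] 1) (𝓝 p₁) ∧ p₁ - p₀ ∈ V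

namespace HasIntIn

variable {V V' : Submodule ℚ ℂ} {f g : ℝ → ℂ}

theorem congr (hf : HasIntIn V f) (h : ∀ t ∈ Set.Ioo (0 : ℝ) 1, g t = f t) : HasIntIn V g := by
  obtain ⟨P, p₀, p₁, h1, h2, h3, h4⟩ := hf
  exact ⟨P, p₀, p₁, fun t ht => by rw [h t ht]; exact h1 t ht, h2, h3, h4⟩

theorem mono (hf : HasIntIn V f) (h : V ≤ V') : HasIntIn V' f := by
  obtain ⟨P, p₀, p₁, h1, h2, h3, h4⟩ := hf
  exact ⟨P, p₀, p₁, h1, h2, h3, h h4⟩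

theorem add (hf : HasIntIn V f) (hg : HasIntIn V g) : HasIntIn V fun t => f t + g t := by
  obtain ⟨P, p₀, p₁, h1, h2, h3, h4⟩ := hf
  obtain ⟨Q, q₀, q₁, h1', h2', h3', h4'⟩ := hg
  refine ⟨fun t => P t + Q t, p₀ + q₀, p₁ + q₁, fun t ht => (h1 t ht).add (h1' t ht),
    h2.add h2', h3.add h3', ?_⟩
  rw [add_sub_add_comm]
  exact V.add_mem h4 h4'

theorem const_mul (c : ℂ) (hc : ∀ v ∈ V, c * v ∈ V') (hf : HasIntIn V f) :
    HasIntIn V' fun t => c * f t := by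
  obtain ⟨P, p₀, p₁, h1, h2, h3, h4⟩ := hf
  refine ⟨fun t => c * P t, c * p₀, c * p₁, fun t ht => (h1 t ht).const_mul c,
    h2.const_mul c, h3.const_mul c, ?_⟩
  rw [← mul_sub]
  exact hc _ h4

theorem neg (hf : HasIntIn V f) : HasIntIn V fun t => -f t := by
  refine (hf.const_mul (V' := V) (-1) fun v hv => ?_).congr fun t _ => by ring
  rw [neg_one_mul]
  exact V.neg_mem hv

theorem sub (hf : HasIntIn V f) (hg : HasIntIn V g) : HasIntIn V fun t => f t - g t :=
  (hf.add hg.neg).congr fun t _ => by ring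

/-- Integration by parts when the boundary terms vanish. -/
theorem of_boundary {B : ℝ → ℂ} (hg : HasIntIn V g)
    (hB : ∀ t ∈ Set.Ioo (0 : ℝ) 1, HasDerivAt B (f t + g t) t)
    (h0 : Tendsto B (𝓝[>] 0) (𝓝 0)) (h1 : Tendsto B (𝓝[<] 1) (𝓝 0)) : HasIntIn V f := by
  obtain ⟨P, p₀, p₁, h2, h3, h4, h5⟩ := hg
  refine ⟨fun t => B t - P t, 0 - p₀, 0 - p₁, fun t ht => ?_, h0.sub h3, h1.sub h4, ?_⟩
  · have := (hB t ht).sub (h2 t ht)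
    rwa [add_sub_cancel_right] at this
  · have := V.neg_mem h5
    rwa [show 0 - p₁ - (0 - p₀) = -(p₁ - p₀) by ring]

end HasIntIn

/-- The space `i ^ p · CMZV⁴_w`. It depends only on the parity of `p`. -/
def twist (p w : ℕ) : Submodule ℚ ℂ :=
  (CMZV 4 w).map (LinearMap.mulLeft ℚ (Complex.I ^ p))

theorem mem_twist {p w : ℕ} {v : ℂ} : v ∈ twist p w ↔ ∃ c ∈ CMZV 4 w, Complex.I ^ p * c = v := by
  simp [twist, Submodule.mem_map]

theorem I_mul_mem_twist {p w : ℕ} {v : ℂ} (h : v ∈ twist p w) :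
    Complex.I * v ∈ twist (p + 1) w := by
  obtain ⟨c, hc, rfl⟩ := mem_twist.1 h
  exact mem_twist.2 ⟨c, hc, by rw [pow_succ]; ring⟩

theorem twist_add_two (p w : ℕ) : twist (p + 2) w = twist p w := by
  ext v
  rw [mem_twist, mem_twist]
  constructor
  · rintro ⟨c, hc, rfl⟩
    exact ⟨-c, (CMZV 4 w).neg_mem hc, by rw [pow_add, Complex.I_sq]; ring⟩
  · rintro ⟨c, hc, rfl⟩
    exact ⟨-c, (CMZV 4 w).neg_mem hc, by rw [pow_add, Complex.I_sq]; ring⟩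

/-! ### Pairing functions with hyperlogarithms -/

/-- The integral of `φ dt` against the hyperlogarithm of the word `u` lies in
`i ^ p · CMZV⁴_{|u| + w}`. -/
def DensAt (u : List Letter) (p w : ℕ) (φ : ℝ → ℂ) : Prop :=
  HasIntIn (twist p (u.length + w)) fun t => hyperlog u t * φ t

/-- The form `φ dt` behaves like an iterated integral of weight `w - 1` (in the upper limit of
integration) times a form: paired with any hyperlogarithm it gives a value in
`i ^ p · CMZV⁴` of the right weight. -/
def Dens (p w : ℕ) (φ : ℝ → ℂ) : Prop := ∀ u ≠ [], DensAt u p w φ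

namespace DensAt

variable {u : List Letter} {p w : ℕ} {φ ψ : ℝ → ℂ}

theorem congr (h : DensAt u p w φ) (he : ∀ t ∈ Set.Ioo (0 : ℝ) 1, ψ t = φ t) :
    DensAt u p w ψ := HasIntIn.congr h fun t ht => by rw [he t ht]

theorem add (h : DensAt u p w φ) (h' : DensAt u p w ψ) : DensAt u p w fun t => φ t + ψ t :=
  (HasIntIn.add h h').congr fun t _ => by ring

theorem neg (h : DensAt u p w φ) : DensAt u p w fun t => -φ t :=
  (HasIntIn.neg h).congr fun t _ => by ring

theorem sub (h : DensAt u p w φ) (h' : DensAt u p w ψ) : DensAt u p w fun t => φ t - ψ t :=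
  (HasIntIn.sub h h').congr fun t _ => by ring

theorem I_mul (h : DensAt u p w φ) : DensAt u (p + 1) w fun t => Complex.I * φ t :=
  (HasIntIn.const_mul Complex.I (fun _ hv => I_mul_mem_twist hv) h).congr fun t _ => by ring

theorem add_two (h : DensAt u (p + 2) w φ) : DensAt u p w φ := by
  unfold DensAt at h ⊢
  rwa [twist_add_two] at h

end DensAt

/-- A function `R` on `(0, 1)` behaving like an iterated integral of weight `w` from `t` to `1`,
with coefficients in `i ^ p · ℚ`: its derivative pairs well with hyperlogarithms, it vanishes to
first order at `1`, and it is `o(1/t)` at `0`. -/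
def Good (p w : ℕ) (R : ℝ → ℂ) : Prop :=
  ∃ φ : ℝ → ℂ, (∀ t ∈ Set.Ioo (0 : ℝ) 1, HasDerivAt R (φ t) t) ∧
    Tendsto (fun t : ℝ => (t : ℂ) * R t) (𝓝[>] 0) (𝓝 0) ∧
    (∃ r, Tendsto (fun t : ℝ => R t / (1 - (t : ℂ))) (𝓝[<] 1) (𝓝 r)) ∧ Dens p w φ

/-- Integration by parts moves a form `ω` from the side of `R` to the side of the
hyperlogarithm, as a new outermost letter. -/
theorem Good.densAt_letter {p w : ℕ} {R : ℝ → ℂ} (h : Good p w R) (a : Letter) (u : List Letter)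
    (hau : u ≠ [] ∨ a ≠ none) : DensAt u p (w + 1) fun t => letterFun a t * R t := by
  obtain ⟨φ, h1, h2, ⟨r, h3⟩, h4⟩ := h
  have h5 := h4 (a :: u) (List.cons_ne_nil a u)
  unfold DensAt at h5 ⊢
  rw [List.length_cons, add_right_comm] at h5
  rw [← add_assoc]
  refine h5.of_boundary (B := fun t => hyperlog (a :: u) t * R t) (fun t ht => ?_)
    (tendsto_hyperlog_mul_zero (List.cons_ne_nil a u) h2)
    (tendsto_hyperlog_mul_one (List.cons_ne_nil a u) h3)
  refine ((hasDerivAt_hyperlog a u hau ht).mul (h1 t ht)).congr_deriv ?_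
  ring

/-- The constant function `1` in place of `R`. The letter `1` is excluded, as it would give a
divergent integral. -/
theorem densAt_letter_one (a : Letter) (u : List Letter) (hau : u ≠ [] ∨ a ≠ none)
    (ha : ∀ z, a = some z → z.1 ≠ 1) : DensAt u 0 1 (letterFun a) := by
  obtain ⟨v, hv, hv'⟩ := exists_tendsto_hyperlog_one a u ha
  refine ⟨hyperlog (a :: u), 0, v, fun t ht => ?_,
    tendsto_hyperlog_zero (List.cons_ne_nil a u), hv', ?_⟩
  · refine (hasDerivAt_hyperlog a u hau ht).congr_deriv ?_
    ring
  · rw [sub_zero]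
    exact mem_twist.2 ⟨v, hv, by simp⟩

/-! ### The differential forms in the variable `x = (1 - t²) / (1 + t²)` -/

/-- The rational parametrization `x = (1 - t²) / (1 + t²)`. -/
def xt (t : ℝ) : ℝ := (1 - t ^ 2) / (1 + t ^ 2)

/-- The function `√(1 - x²) = 2 t / (1 + t²)`. -/
def st (t : ℝ) : ℝ := 2 * t / (1 + t ^ 2)

/-- The form `dx / x` in the variable `t`. -/
def fA (t : ℝ) : ℂ := -4 * t / ((1 - (t : ℂ) ^ 2) * (1 + (t : ℂ) ^ 2))

/-- The form `dx / √(1 - x²)` in the variable `t`. -/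
def fB (t : ℝ) : ℂ := -2 / (1 + (t : ℂ) ^ 2)

/-- The form `dx / (x √(1 - x²))` in the variable `t`. -/
def fG (t : ℝ) : ℂ := -2 / (1 - (t : ℂ) ^ 2)

/-- The form `x dx / (1 - x²)` in the variable `t`. -/
def fD (t : ℝ) : ℂ := -(1 - (t : ℂ) ^ 2) / (t * (1 + (t : ℂ) ^ 2))

/-- The letter `1`. -/
def z1 : {z : ℂ // z ^ 4 = 1} := ⟨1, by simp⟩
/-- The letter `-1`. -/
def zm1 : {z : ℂ // z ^ 4 = 1} := ⟨-1, by norm_num⟩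
/-- The letter `i`. -/
def zI : {z : ℂ // z ^ 4 = 1} := ⟨Complex.I, by simp⟩
/-- The letter `-i`. -/
def zmI : {z : ℂ // z ^ 4 = 1} := ⟨-Complex.I, by rw [neg_pow]; simp; norm_num⟩

theorem tC_ne_zero {t : ℝ} (ht : t ∈ Set.Ioo (0 : ℝ) 1) : (t : ℂ) ≠ 0 := by exact_mod_cast ht.1.ne'

theorem one_sub_t_ne_zero {t : ℝ} (ht : t ∈ Set.Ioo (0 : ℝ) 1) : 1 - (t : ℂ) ≠ 0 := by
  rw [sub_ne_zero]
  exact_mod_cast ht.2.ne'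

theorem one_add_t_ne_zero {t : ℝ} (ht : t ∈ Set.Ioo (0 : ℝ) 1) : 1 + (t : ℂ) ≠ 0 := by
  have := ht.1
  exact_mod_cast (by positivity : 1 + t ≠ 0)

theorem one_add_sq_ne_zero (t : ℝ) : 1 + (t : ℂ) ^ 2 ≠ 0 := by
  exact_mod_cast (by positivity : 1 + t ^ 2 ≠ 0)

theorem one_sub_sq_ne_zero {t : ℝ} (ht : t ∈ Set.Ioo (0 : ℝ) 1) : 1 - (t : ℂ) ^ 2 ≠ 0 := by
  rw [show 1 - (t : ℂ) ^ 2 = (1 - t) * (1 + t) by ring]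
  exact mul_ne_zero (one_sub_t_ne_zero ht) (one_add_t_ne_zero ht)

theorem letterFun_I {t : ℝ} (ht : t ∈ Set.Ioo (0 : ℝ) 1) :
    letterFun (some zI) t = (Complex.I - t) / (1 + (t : ℂ) ^ 2) := by
  have h := one_sub_mul_ne_zero zI.2 (abs_lt_one_of_mem ht)
  have h2 := one_add_sq_ne_zero t
  simp only [letterFun]
  rw [div_eq_div_iff h h2]
  simp only [zI]
  linear_combination (t : ℂ) * Complex.I_sq

theorem letterFun_mI {t : ℝ} (ht : t ∈ Set.Ioo (0 : ℝ) 1) :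
    letterFun (some zmI) t = (-Complex.I - t) / (1 + (t : ℂ) ^ 2) := by
  have h := one_sub_mul_ne_zero zmI.2 (abs_lt_one_of_mem ht)
  have h2 := one_add_sq_ne_zero t
  simp only [letterFun]
  rw [div_eq_div_iff h h2]
  simp only [zmI]
  linear_combination (t : ℂ) * Complex.I_sq

theorem letterFun_one (t : ℝ) : letterFun (some z1) t = 1 / (1 - t) := by
  simp [letterFun, z1]

theorem letterFun_m1 (t : ℝ) : letterFun (some zm1) t = -1 / (1 + t) := by
  simp [letterFun, zm1]

theorem letterFun_none (t : ℝ) : letterFun none t = 1 / t := rfl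

theorem fA_eq {t : ℝ} (ht : t ∈ Set.Ioo (0 : ℝ) 1) :
    fA t = letterFun (some zI) t + letterFun (some zmI) t
    - (letterFun (some z1) t + letterFun (some zm1) t) := by
  rw [letterFun_I ht, letterFun_mI ht, letterFun_one t, letterFun_m1 t, fA,
    show 1 - (t : ℂ) ^ 2 = (1 - t) * (1 + t) by ring]
  have h1 := one_sub_t_ne_zero ht
  have h2 := one_add_t_ne_zero ht
  have h3 := one_add_sq_ne_zero t
  field_simp
  ring

theorem fB_eq {t : ℝ} (ht : t ∈ Set.Ioo (0 : ℝ) 1) :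
    fB t = Complex.I * letterFun (some zI) t - Complex.I * letterFun (some zmI) t := by
  rw [letterFun_I ht, letterFun_mI ht, fB]
  have h3 := one_add_sq_ne_zero t
  field_simp
  linear_combination (-2 : ℂ) * Complex.I_sq

theorem fG_eq {t : ℝ} (ht : t ∈ Set.Ioo (0 : ℝ) 1) :
    fG t = letterFun (some zm1) t - letterFun (some z1) t := by
  rw [letterFun_one t, letterFun_m1 t, fG, show 1 - (t : ℂ) ^ 2 = (1 - t) * (1 + t) by ring]
  have h1 := one_sub_t_ne_zero ht
  have h2 := one_add_t_ne_zero ht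
  field_simp
  ring

theorem fD_eq {t : ℝ} (ht : t ∈ Set.Ioo (0 : ℝ) 1) :
    fD t = -(letterFun none t + letterFun (some zI) t + letterFun (some zmI) t) := by
  rw [letterFun_I ht, letterFun_mI ht, letterFun_none t, fD]
  have h1 := tC_ne_zero ht
  have h3 := one_add_sq_ne_zero t
  field_simp
  ring

theorem xt_pos {t : ℝ} (ht : t ∈ Set.Ioo (0 : ℝ) 1) : 0 < xt t := by
  have : t ^ 2 < 1 := by nlinarith [ht.1, ht.2]
  unfold xt
  have : 0 < 1 - t ^ 2 := by linarith
  positivity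

theorem st_pos {t : ℝ} (ht : t ∈ Set.Ioo (0 : ℝ) 1) : 0 < st t := by
  have := ht.1
  unfold st
  positivity

theorem xt_sq_lt_one {t : ℝ} (ht : t ∈ Set.Ioo (0 : ℝ) 1) : |xt t ^ 2| < 1 := by
  have h : xt t ^ 2 = 1 - st t ^ 2 := by
    unfold xt st
    field_simp
    ring
  rw [abs_of_nonneg (sq_nonneg _), h]
  nlinarith [sq_pos_of_pos (st_pos ht)]

theorem hasDerivAt_xt (t : ℝ) : HasDerivAt xt (-(st t) * (2 / (1 + t ^ 2))) t := by
  have h : HasDerivAt (fun t : ℝ => t ^ 2) (2 * t) t := by simpa using hasDerivAt_pow 2 t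
  have h0 : 1 + t ^ 2 ≠ 0 := by positivity
  refine ((h.const_sub 1).div (h.const_add 1) h0).congr_deriv ?_
  unfold st
  field_simp
  ring

theorem hasDerivAt_st (t : ℝ) : HasDerivAt st (xt t * (2 / (1 + t ^ 2))) t := by
  have h : HasDerivAt (fun t : ℝ => t ^ 2) (2 * t) t := by simpa using hasDerivAt_pow 2 t
  have h0 : 1 + t ^ 2 ≠ 0 := by positivity
  refine (((hasDerivAt_id t).const_mul 2).div (h.const_add 1) h0).congr_deriv ?_
  unfold xt
  simp only [id]
  field_simp
  ring

theorem xt_sq_add_st_sq (t : ℝ) : xt t ^ 2 + st t ^ 2 = 1 := by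
  unfold xt st
  field_simp
  ring

theorem Good.densAt_A {p w : ℕ} {R : ℝ → ℂ} (h : Good p w R) (u : List Letter) :
    DensAt u p (w + 1) fun t => fA t * R t :=
  (((h.densAt_letter (some zI) u (by simp)).add (h.densAt_letter (some zmI) u (by simp))).sub
    ((h.densAt_letter (some z1) u (by simp)).add (h.densAt_letter (some zm1) u (by simp)))).congr
    fun t ht => by rw [fA_eq ht]; ring

theorem Good.densAt_B {p w : ℕ} {R : ℝ → ℂ} (h : Good p w R) (u : List Letter) :
    DensAt u (p + 1) (w + 1) fun t => fB t * R t :=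
  ((h.densAt_letter (some zI) u (by simp)).I_mul.sub
    (h.densAt_letter (some zmI) u (by simp)).I_mul).congr
    fun t ht => by rw [fB_eq ht]; ring

theorem Good.densAt_G {p w : ℕ} {R : ℝ → ℂ} (h : Good p w R) (u : List Letter) :
    DensAt u p (w + 1) fun t => fG t * R t :=
  ((h.densAt_letter (some zm1) u (by simp)).sub (h.densAt_letter (some z1) u (by simp))).congr
    fun t ht => by rw [fG_eq ht]; ring

theorem Good.densAt_D {p w : ℕ} {R : ℝ → ℂ} (h : Good p w R) {u : List Letter} (hu : u ≠ []) :
    DensAt u p (w + 1) fun t => fD t * R t :=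
  (((h.densAt_letter none u (.inl hu)).add (h.densAt_letter (some zI) u (by simp))).add
    (h.densAt_letter (some zmI) u (by simp))).neg.congr
    fun t ht => by rw [fD_eq ht]; ring

theorem densAt_base_I (u : List Letter) : DensAt u 0 1 (letterFun (some zI)) :=
  densAt_letter_one _ u (by simp) fun z hz => by
    obtain rfl : zI = z := by simpa using hz
    intro h
    simpa [zI] using congrArg Complex.re h

theorem densAt_base_mI (u : List Letter) : DensAt u 0 1 (letterFun (some zmI)) :=
  densAt_letter_one _ u (by simp) fun z hz => by
    obtain rfl : zmI = z := by simpa using hz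
    intro h
    simpa [zmI] using congrArg Complex.re h

theorem densAt_base_m1 (u : List Letter) : DensAt u 0 1 (letterFun (some zm1)) :=
  densAt_letter_one _ u (by simp) fun z hz => by
    obtain rfl : zm1 = z := by simpa using hz
    simp only [zm1]
    norm_num

theorem densAt_base_none {u : List Letter} (hu : u ≠ []) : DensAt u 0 1 (letterFun none) :=
  densAt_letter_one _ u (.inl hu) fun z hz => by simp at hz

theorem densAt_base_B (u : List Letter) : DensAt u 1 1 fB :=
  ((densAt_base_I u).I_mul.sub (densAt_base_mI u).I_mul).congr fun t ht => by rw [fB_eq ht]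

/-- The forms `dx / x` and `dx / (x √(1 - x²))` have the same residue at `x = 0`. -/
theorem densAt_base_G_sub_A (u : List Letter) : DensAt u 0 1 fun t => fG t - fA t :=
  (((densAt_base_m1 u).add (densAt_base_m1 u)).sub
    ((densAt_base_I u).add (densAt_base_mI u))).congr
    fun t ht => by rw [fG_eq ht, fA_eq ht]; ring

theorem densAt_base_D {u : List Letter} (hu : u ≠ []) : DensAt u 0 1 fD :=
  (((densAt_base_none hu).add (densAt_base_I u)).add (densAt_base_mI u)).neg.congr
    fun t ht => by rw [fD_eq ht]

/-! ### Central binomial coefficients and nested sums with parity conditions -/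

theorem a_zero : a 0 = 1 := by simp [a]

theorem a_pos (n : ℕ) : 0 < a n := by
  have := Nat.centralBinom_pos n
  unfold a
  positivity

theorem a_succ (n : ℕ) : (2 * n + 2) * a (n + 1) = (2 * n + 1) * a n := by
  have h : ((n : ℝ) + 1) * Nat.centralBinom (n + 1) = 2 * (2 * n + 1) * Nat.centralBinom n := by
    exact_mod_cast Nat.succ_mul_centralBinom_succ n
  unfold a
  rw [pow_succ]
  field_simp
  linear_combination 2 * h

theorem a_sq_le (n : ℕ) : a n ^ 2 * (2 * n + 1) ≤ 1 := by
  induction n with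
  | zero => simp [a_zero]
  | succ n ih =>
    have h := a_succ n
    have h1 : a (n + 1) = (2 * n + 1) / (2 * n + 2) * a n := by
      field_simp
      linear_combination h
    rw [h1]
    push_cast
    have h2 : ((2 * (n : ℝ) + 1) / (2 * n + 2) * a n) ^ 2 * (2 * (n + 1) + 1)
        = (a n ^ 2 * (2 * n + 1)) * ((2 * n + 1) * (2 * n + 3) / (2 * n + 2) ^ 2) := by
      field_simp
      ring
    rw [h2]
    have h3 : (2 * (n : ℝ) + 1) * (2 * n + 3) / (2 * n + 2) ^ 2 ≤ 1 := by
      rw [div_le_one (by positivity)]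
      nlinarith
    exact mul_le_one₀ ih (by positivity) h3

theorem a_le_one (n : ℕ) : a n ≤ 1 := by
  have h := a_sq_le n
  have h1 := a_pos n
  by_contra hc
  push Not at hc
  have : (0 : ℝ) ≤ n := Nat.cast_nonneg n
  nlinarith

theorem a_mul_q_sq_le (n : ℕ) : a n * q (2 * n + 1) ^ 2 ≤ 1 := by
  have h := a_sq_le n
  have h1 := q_pow_four (2 * n + 1)
  push_cast at h1
  rw [← h1] at h
  have h2 : 0 ≤ a n * q (2 * n + 1) ^ 2 := mul_nonneg (a_pos n).le (sq_nonneg _)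
  have h3 : (a n * q (2 * n + 1) ^ 2) ^ 2 ≤ 1 := by
    calc _ = a n ^ 2 * q (2 * n + 1) ^ 4 := by ring
      _ ≤ 1 := h
  exact (sq_le_one_iff₀ h2).1 h3

/-- Nested sums over integers with parity conditions: for `τ = [(b₁, k₁), …, (b_d, k_d)]`,
`T τ N = ∑_{N > M₁ > ⋯ > M_d > 0} ∏ 1 / M_j ^ (k_j + 1)`, where `M_j` is odd if `b_j` is `true`
and even otherwise. -/
def T : List (Bool × ℕ) → ℕ → ℝ
  | [], _ => 1
  | p :: τ, N => ∑ M ∈ range N, if M.bodd = p.1 then T τ M / (M : ℝ) ^ (p.2 + 1) else 0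

/-- The weight of the nested sum `T τ`. -/
def wt (τ : List (Bool × ℕ)) : ℕ := (τ.map fun p => p.2 + 1).sum

theorem wt_nil : wt [] = 0 := rfl

theorem wt_cons (b : Bool) (k : ℕ) (τ : List (Bool × ℕ)) : wt ((b, k) :: τ) = k + 1 + wt τ := by
  simp [wt]

theorem T_cons_succ (b : Bool) (k : ℕ) (τ : List (Bool × ℕ)) (N : ℕ) :
    T ((b, k) :: τ) (N + 1) = T ((b, k) :: τ) N
      + if N.bodd = b then T τ N / (N : ℝ) ^ (k + 1) else 0 := by
  simp only [T, sum_range_succ]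

theorem T_cons_zero (p : Bool × ℕ) (τ : List (Bool × ℕ)) : T (p :: τ) 0 = 0 := by simp [T]

theorem T_cons_one (p : Bool × ℕ) (τ : List (Bool × ℕ)) : T (p :: τ) 1 = 0 := by simp [T]

theorem bodd_two_mul (n : ℕ) : (2 * n).bodd = false := by simp

theorem bodd_two_mul_add_one (n : ℕ) : (2 * n + 1).bodd = true := by simp

theorem T_even_odd (k : ℕ) (τ : List (Bool × ℕ)) (n : ℕ) :
    T ((false, k) :: τ) (2 * n + 1) = T ((false, k) :: τ) (2 * n)
      + T τ (2 * n) / ((2 * n : ℕ) : ℝ) ^ (k + 1) := by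
  rw [T_cons_succ, bodd_two_mul, if_pos rfl]

theorem T_odd_odd (k : ℕ) (τ : List (Bool × ℕ)) (n : ℕ) :
    T ((true, k) :: τ) (2 * n + 1) = T ((true, k) :: τ) (2 * n) := by
  rw [T_cons_succ, bodd_two_mul]
  simp

theorem T_even_even (k : ℕ) (τ : List (Bool × ℕ)) (n : ℕ) :
    T ((false, k) :: τ) (2 * n + 2) = T ((false, k) :: τ) (2 * n + 1) := by
  rw [T_cons_succ, bodd_two_mul_add_one]
  simp

theorem T_odd_even (k : ℕ) (τ : List (Bool × ℕ)) (n : ℕ) :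
    T ((true, k) :: τ) (2 * n + 2) = T ((true, k) :: τ) (2 * n + 1)
      + T τ (2 * n + 1) / ((2 * n + 1 : ℕ) : ℝ) ^ (k + 1) := by
  rw [T_cons_succ, bodd_two_mul_add_one, if_pos rfl]

/-- Nested sums are `O(N ^ (1/4))`. -/
theorem exists_T_le (τ : List (Bool × ℕ)) : ∃ C : ℝ, 0 ≤ C ∧ ∀ N, 1 ≤ N → |T τ N| ≤ C * q N := by
  induction τ with
  | nil => exact ⟨1, zero_le_one, fun N hN => by simpa [T] using one_le_q hN⟩
  | cons p τ ih =>
    obtain ⟨C, h0, hC⟩ := ih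
    refine ⟨4 * C, by positivity, fun N _ => ?_⟩
    rw [← Real.norm_eq_abs]
    refine norm_sum_le_q h0 fun m _ => ?_
    have hq : 0 ≤ q m / m := div_nonneg (q_nonneg m) (Nat.cast_nonneg m)
    split_ifs
    · rcases Nat.eq_zero_or_pos m with rfl | hm
      · simp
      · rw [norm_div, Real.norm_eq_abs, norm_pow, Real.norm_natCast, mul_div_assoc']
        have h1 : (1 : ℝ) ≤ m := by exact_mod_cast hm
        gcongr
        · exact mul_nonneg h0 (q_nonneg m)
        · exact hC m hm
        · exact le_self_pow₀ h1 (by omega)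
    · simpa using mul_nonneg h0 hq

/-- The coefficients `a_n T_τ(N) / N ^ (k + 1)` with `N = 2n + 1` if `b` is `true` and `N = 2n`
otherwise. -/
def fR (b : Bool) (k : ℕ) (τ : List (Bool × ℕ)) (n : ℕ) : ℝ :=
  a n * (T τ (2 * n + b.toNat) / ((2 * n + b.toNat : ℕ) : ℝ) ^ (k + 1))

/-- The coefficients `a_n T_τ(2n + 1)`. -/
def hR (τ : List (Bool × ℕ)) (n : ℕ) : ℝ := a n * T τ (2 * n + 1)

theorem summable_one_div_q_pow_five : Summable fun n : ℕ => 1 / q n ^ 5 := by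
  have h : Summable fun n : ℕ => 1 / (n : ℝ) ^ (5 / 4 : ℝ) :=
    Real.summable_one_div_nat_rpow.2 (by norm_num)
  refine h.congr fun n => ?_
  rw [q_eq_rpow, ← Real.rpow_natCast, ← Real.rpow_mul (Nat.cast_nonneg n)]
  norm_num

theorem summable_abs_fR (b : Bool) (k : ℕ) (τ : List (Bool × ℕ)) :
    Summable fun n => |fR b k τ n| := by
  obtain ⟨C, h0, hC⟩ := exists_T_le τ
  rw [← summable_nat_add_iff 1]
  have hs := ((summable_nat_add_iff 1).2 summable_one_div_q_pow_five).mul_left C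
  refine Summable.of_nonneg_of_le (fun n => abs_nonneg _) (fun n => ?_) hs
  generalize hm : n + 1 = m
  have hm1 : 1 ≤ m := by omega
  have hN : m ≤ 2 * m + b.toNat := by omega
  have hN' : 2 * m + b.toNat ≤ 2 * m + 1 := by have := Bool.toNat_le b; omega
  unfold fR
  generalize 2 * m + b.toNat = N at hN hN'
  have hN1 : (1 : ℝ) ≤ N := by exact_mod_cast hm1.trans hN
  have q1 := one_le_q hm1
  have q2 := q_mono hN
  have q3 := q_mono hN'
  have h4 := a_mul_q_sq_le m
  have ha := a_pos m
  rw [abs_mul, abs_of_pos ha, abs_div, abs_of_nonneg (by positivity : (0 : ℝ) ≤ (N : ℝ) ^ (k + 1))]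
  have e1 : a m ≤ 1 / q m ^ 2 := by
    rw [le_div_iff₀ (by positivity)]
    refine le_trans ?_ h4
    gcongr
    linarith
  have e2 : |T τ N| / (N : ℝ) ^ (k + 1) ≤ C / q m ^ 3 := by
    calc |T τ N| / (N : ℝ) ^ (k + 1) ≤ C * q N / N := by
          gcongr
          · exact mul_nonneg h0 (q_nonneg _)
          · exact hC N (hm1.trans hN)
          · exact le_self_pow₀ hN1 (by omega)
      _ = C / q N ^ 3 := by
          rw [← q_pow_four N]
          have : q N ≠ 0 := by linarith
          field_simp
      _ ≤ C / q m ^ 3 := by gcongr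
  calc _ ≤ 1 / q m ^ 2 * (C / q m ^ 3) := by gcongr
    _ = C * (1 / q m ^ 5) := by
      field_simp

theorem tendsto_hR (τ : List (Bool × ℕ)) : Tendsto (hR τ) atTop (𝓝 0) := by
  obtain ⟨C, h0, hC⟩ := exists_T_le τ
  have hq : Tendsto q atTop atTop := by
    have : q = fun n : ℕ => (n : ℝ) ^ (1 / 4 : ℝ) := funext q_eq_rpow
    rw [this]
    exact (tendsto_rpow_atTop (by norm_num)).comp tendsto_natCast_atTop_atTop
  have h2 : Tendsto (fun n : ℕ => 2 * n + 1) atTop atTop :=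
    tendsto_atTop_mono (fun n => by simp only [id]; omega) tendsto_id
  have h3 : Tendsto (fun n : ℕ => C * (q (2 * n + 1))⁻¹) atTop (𝓝 0) := by
    simpa using ((tendsto_inv_atTop_zero.comp hq).comp h2).const_mul C
  refine squeeze_zero_norm (fun n => ?_) h3
  have q1 := one_le_q (n := 2 * n + 1) (by omega)
  have h4 := a_mul_q_sq_le n
  have h5 := hC (2 * n + 1) (by omega)
  have h6 := a_pos n
  rw [hR, Real.norm_eq_abs, abs_mul, abs_of_pos h6]
  calc a n * |T τ (2 * n + 1)| ≤ a n * (C * q (2 * n + 1)) := by gcongr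
    _ = C * (a n * q (2 * n + 1) ^ 2) * (q (2 * n + 1))⁻¹ := by
        field_simp
    _ ≤ C * 1 * (q (2 * n + 1))⁻¹ := by gcongr
    _ = _ := by ring

/-- The coefficient sequence `a_n T_τ(2n)` with the term at `n = 0` removed. -/
def uR (τ : List (Bool × ℕ)) (n : ℕ) : ℝ := if n = 0 then 0 else a n * T τ (2 * n)

/-! ### The generating functions and their differential equations -/

/-- The generating function `∑ a_n T_τ(N) / N ^ (k + 1) · x ^ N`, over `N` of parity `b`. -/
def F (b : Bool) (k : ℕ) (τ : List (Bool × ℕ)) (t : ℝ) : ℂ :=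
  (xt t : ℂ) ^ b.toNat * PS (fun n => fR b k τ n) (xt t ^ 2)

/-- The function `√(1 - x²) · ∑ a_n T_τ(2n + 1) x ^ (2n)`. -/
def K (τ : List (Bool × ℕ)) (t : ℝ) : ℂ := st t * PS (fun n => hR τ n) (xt t ^ 2)

/-- The function `∑_{n ≥ 1} a_n T_τ(2n) x ^ (2n)`. -/
def U (τ : List (Bool × ℕ)) (t : ℝ) : ℂ := PS (fun n => uR τ n) (xt t ^ 2)

theorem summable_fR (b : Bool) (k : ℕ) (τ : List (Bool × ℕ)) :
    Summable fun n => (fR b k τ n : ℂ) :=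
  Complex.ofRealCLM.summable (summable_abs_fR b k τ).of_abs

theorem bdd_fR (b : Bool) (k : ℕ) (τ : List (Bool × ℕ)) : Bdd fun n => (fR b k τ n : ℂ) :=
  Bdd.of_tendsto (summable_fR b k τ).tendsto_atTop_zero

theorem tendsto_hR_complex (τ : List (Bool × ℕ)) :
    Tendsto (fun n => (hR τ n : ℂ)) atTop (𝓝 0) := by
  exact (Complex.continuous_ofReal.tendsto 0).comp (tendsto_hR τ)

theorem bdd_hR (τ : List (Bool × ℕ)) : Bdd fun n => (hR τ n : ℂ) :=
  Bdd.of_tendsto (tendsto_hR_complex τ)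

theorem xtC_ne_zero {t : ℝ} (ht : t ∈ Set.Ioo (0 : ℝ) 1) : (xt t : ℂ) ≠ 0 := by
  exact_mod_cast (xt_pos ht).ne'

theorem stC_ne_zero {t : ℝ} (ht : t ∈ Set.Ioo (0 : ℝ) 1) : (st t : ℂ) ≠ 0 := by
  exact_mod_cast (st_pos ht).ne'

theorem xtC (t : ℝ) : (xt t : ℂ) = (1 - (t : ℂ) ^ 2) / (1 + (t : ℂ) ^ 2) := by
  unfold xt
  push_cast
  rfl

theorem stC (t : ℝ) : (st t : ℂ) = 2 * (t : ℂ) / (1 + (t : ℂ) ^ 2) := by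
  unfold st
  push_cast
  rfl

theorem fB_eq_G {t : ℝ} (ht : t ∈ Set.Ioo (0 : ℝ) 1) : fB t = fG t * xt t := by
  rw [fB, fG, xtC]
  have h1 := one_sub_sq_ne_zero ht
  have h2 := one_add_sq_ne_zero t
  field_simp

theorem fA_eq_G {t : ℝ} (ht : t ∈ Set.Ioo (0 : ℝ) 1) : fA t = fG t * st t := by
  rw [fA, fG, stC]
  have h1 := one_sub_sq_ne_zero ht
  have h2 := one_add_sq_ne_zero t
  field_simp
  ring

theorem fG_eq_AD {t : ℝ} (ht : t ∈ Set.Ioo (0 : ℝ) 1) : fG t = (fA t + fD t) * st t := by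
  rw [fA, fG, fD, stC]
  have h1 := one_sub_sq_ne_zero ht
  have h2 := one_add_sq_ne_zero t
  have h3 := tC_ne_zero ht
  field_simp
  ring

theorem fD_mul_st {t : ℝ} (ht : t ∈ Set.Ioo (0 : ℝ) 1) :
    fD t * st t = fG t * (xt t : ℂ) ^ 2 := by
  rw [fG, fD, stC, xtC]
  have h1 := one_sub_sq_ne_zero ht
  have h2 := one_add_sq_ne_zero t
  have h3 := tC_ne_zero ht
  field_simp

theorem hasDerivAt_xtC {t : ℝ} (ht : t ∈ Set.Ioo (0 : ℝ) 1) :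
    HasDerivAt (fun t => (xt t : ℂ)) (xt t * fA t) t := by
  refine (hasDerivAt_xt t).ofReal_comp.congr_deriv ?_
  push_cast
  rw [fA, stC, xtC]
  have h1 := one_sub_sq_ne_zero ht
  have h2 := one_add_sq_ne_zero t
  field_simp
  ring

theorem hasDerivAt_stC (t : ℝ) : HasDerivAt (fun t => (st t : ℂ)) (-(xt t * fB t)) t := by
  refine (hasDerivAt_st t).ofReal_comp.congr_deriv ?_
  push_cast
  rw [fB]
  ring

theorem hasDerivAt_ps_xt {c : ℕ → ℂ} (hc : Bdd c) {t : ℝ} (ht : t ∈ Set.Ioo (0 : ℝ) 1) :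
    HasDerivAt (fun t => PS c (xt t ^ 2)) (fA t * PS (fun n => 2 * n * c n) (xt t ^ 2)) t := by
  obtain ⟨D, hD, hD'⟩ := exists_hasDerivAt_ps hc (xt_sq_lt_one ht)
  have h1 : HasDerivAt (fun t => xt t ^ 2) (2 * xt t * (-(st t) * (2 / (1 + t ^ 2)))) t := by
    exact ((hasDerivAt_xt t).pow 2).congr_deriv (by simp)
  refine (hD.scomp t h1).congr_deriv ?_
  have h2 : PS (fun n => 2 * n * c n) (xt t ^ 2) = 2 * PS (fun n => n * c n) (xt t ^ 2) := by
    unfold PS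
    rw [← tsum_mul_left]
    exact tsum_congr fun n => by ring
  have h3 : (xt t : ℂ) * fA t = -(st t) * (2 / (1 + (t : ℂ) ^ 2)) := by
    rw [fA, stC, xtC]
    have h1 := one_sub_sq_ne_zero ht
    have h2 := one_add_sq_ne_zero t
    field_simp
    ring
  rw [h2, ← hD', Complex.real_smul]
  push_cast
  linear_combination (-2 * (xt t : ℂ) * D) * h3

theorem hasDerivAt_F (b : Bool) (k : ℕ) (τ : List (Bool × ℕ)) {t : ℝ}
    (ht : t ∈ Set.Ioo (0 : ℝ) 1) :
    HasDerivAt (F b k τ) (fA t * ((xt t : ℂ) ^ b.toNat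
      * PS (fun n => ((2 * n + b.toNat : ℕ) * fR b k τ n : ℝ)) (xt t ^ 2))) t := by
  have hb := bdd_fR b k τ
  have hP := hasDerivAt_ps_xt hb ht
  have hy := xt_sq_lt_one ht
  have e : PS (fun n => ((2 * n + b.toNat : ℕ) * fR b k τ n : ℝ)) (xt t ^ 2)
      = PS (fun n => 2 * n * (fR b k τ n : ℂ)) (xt t ^ 2)
        + b.toNat * PS (fun n => (fR b k τ n : ℂ)) (xt t ^ 2) := by
    unfold PS
    have s1 := (summable_nat_mul_ps hb hy).mul_left 2
    have s2 := (summable_ps hb hy).mul_left (b.toNat : ℂ)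
    rw [← tsum_mul_left, ← Summable.tsum_add (by simpa only [mul_assoc] using s1) s2]
    exact tsum_congr fun n => by push_cast; ring
  rw [e]
  unfold F
  cases b
  · refine (hP.const_mul 1).congr_deriv ?_ |>.congr_of_eventuallyEq ?_
    · simp
    · exact Filter.Eventually.of_forall fun t => by simp
  · refine ((hasDerivAt_xtC ht).mul hP).congr_deriv ?_ |>.congr_of_eventuallyEq ?_
    · simp
      ring
    · exact Filter.Eventually.of_forall fun t => by simp

theorem natCast_mul_div_pow_succ (N k : ℕ) (x y : ℝ) :
    (N : ℝ) * (x * (y / (N : ℝ) ^ (k + 1 + 1))) = x * (y / (N : ℝ) ^ (k + 1)) := by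
  rcases Nat.eq_zero_or_pos N with rfl | hN
  · simp
  · have : (N : ℝ) ≠ 0 := by exact_mod_cast hN.ne'
    field_simp
    ring

/-- `dF_{k+1} = F_k dx / x`. -/
theorem hasDerivAt_F_succ (b : Bool) (k : ℕ) (τ : List (Bool × ℕ)) {t : ℝ}
    (ht : t ∈ Set.Ioo (0 : ℝ) 1) :
    HasDerivAt (F b (k + 1) τ) (fA t * F b k τ t) t := by
  refine (hasDerivAt_F b (k + 1) τ ht).congr_deriv ?_
  unfold F
  have : ∀ n, ((2 * n + b.toNat : ℕ) : ℝ) * fR b (k + 1) τ n = fR b k τ n := fun n =>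
    natCast_mul_div_pow_succ _ _ _ _
  simp only [this]

theorem hasDerivAt_F_true_zero (τ : List (Bool × ℕ)) {t : ℝ} (ht : t ∈ Set.Ioo (0 : ℝ) 1) :
    HasDerivAt (F true 0 τ) (fB t * K τ t) t := by
  refine (hasDerivAt_F true 0 τ ht).congr_deriv ?_
  have : ∀ n, ((2 * n + true.toNat : ℕ) : ℝ) * fR true 0 τ n = hR τ n := by
    intro n
    have : ((2 * n + 1 : ℕ) : ℝ) ≠ 0 := by exact_mod_cast (2 * n).succ_ne_zero
    simp only [fR, hR, Bool.toNat_true]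
    rw [zero_add, pow_one]
    field_simp
  simp only [this]
  rw [K, fB_eq_G ht, fA_eq_G ht, Bool.toNat_true]
  ring

theorem hasDerivAt_F_false_zero (τ : List (Bool × ℕ)) {t : ℝ} (ht : t ∈ Set.Ioo (0 : ℝ) 1) :
    HasDerivAt (F false 0 τ) (fA t * U τ t) t := by
  refine (hasDerivAt_F false 0 τ ht).congr_deriv ?_
  have : ∀ n, ((2 * n + false.toNat : ℕ) : ℝ) * fR false 0 τ n = uR τ n := by
    intro n
    rcases Nat.eq_zero_or_pos n with rfl | hn
    · simp [uR]
    · have : ((2 * n : ℕ) : ℝ) ≠ 0 := by exact_mod_cast (by omega : 2 * n ≠ 0)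
      simp only [fR, uR, Bool.toNat_false, add_zero, if_neg hn.ne']
      rw [zero_add, pow_one]
      field_simp
  simp only [this]
  rw [U, Bool.toNat_false, pow_zero, one_mul]

/-- The coefficients `2n a_n (T_τ(2n + 1) - T_τ(2n - 1))` of `x √(1 - x²) dK/dx`. At `n = 0` the
truncated difference `n - 1` produces a spurious `hR τ 0`, which the last summand cancels. -/
def eR (τ : List (Bool × ℕ)) (n : ℕ) : ℝ := 2 * n * hR τ n - (2 * n - 1) * hR τ (n - 1) +
  if n = 0 then -hR τ 0 else 0

theorem eR_zero (τ : List (Bool × ℕ)) : eR τ 0 = 0 := by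
  simp [eR]

theorem eR_succ (τ : List (Bool × ℕ)) (n : ℕ) :
    eR τ (n + 1) = (2 * n + 1) * a n * (T τ (2 * n + 3) - T τ (2 * n + 1)) := by
  have h := a_succ n
  simp only [eR, hR, Nat.add_sub_cancel, Nat.succ_ne_zero, if_false]
  rw [show 2 * (n + 1) + 1 = 2 * n + 3 by ring]
  push_cast
  linear_combination T τ (2 * n + 3) * h

/-- The recurrence `2n a_n = (2n - 1) a_{n-1}` makes the derivative of `K` involve only the
increments of `T_τ`, hence only the tail of `τ`. -/
theorem hasDerivAt_K (τ : List (Bool × ℕ)) {t : ℝ} (ht : t ∈ Set.Ioo (0 : ℝ) 1) :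
    HasDerivAt (K τ) (fG t * PS (fun n => eR τ n) (xt t ^ 2)) t := by
  have hb := bdd_hR τ
  have hP := hasDerivAt_ps_xt hb ht
  have hy := xt_sq_lt_one ht
  refine ((hasDerivAt_stC t).mul hP).congr_deriv ?_
  rw [fB_eq_G ht, fA_eq_G ht]
  have hs : (st t : ℂ) ^ 2 = 1 - (xt t : ℂ) ^ 2 := by
    have := xt_sq_add_st_sq t
    rw [eq_sub_iff_add_eq']
    exact_mod_cast this
  -- the power series identity behind the differential equation
  set y : ℝ := xt t ^ 2 with hy'
  have s1 := summable_ps hb hy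
  have s2 : Summable fun n : ℕ => 2 * (n : ℂ) * (hR τ n : ℂ) * (y : ℂ) ^ n := by
    simpa only [mul_assoc] using (summable_nat_mul_ps hb hy).mul_left 2
  have key : PS (fun n => (eR τ n : ℂ)) y = PS (fun n => 2 * n * (hR τ n : ℂ)) y
      - y * (PS (fun n => 2 * n * (hR τ n : ℂ)) y + PS (fun n => (hR τ n : ℂ)) y) := by
    have s3 : Summable fun n : ℕ => (y : ℂ) * ((2 * n + 1) * (hR τ n : ℂ) * (y : ℂ) ^ n) := by
      refine ((s2.add s1).mul_left (y : ℂ)).congr fun n => ?_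
      ring
    have e1 : PS (fun n => 2 * n * (hR τ n : ℂ)) y + PS (fun n => (hR τ n : ℂ)) y
        = PS (fun n => (2 * n + 1) * (hR τ n : ℂ)) y := by
      unfold PS
      rw [← s2.tsum_add s1]
      exact tsum_congr fun n => by ring
    have s4 : Summable fun n : ℕ => 2 * ((n + 1 : ℕ) : ℂ) * (hR τ (n + 1) : ℂ)
        * (y : ℂ) ^ (n + 1) := (summable_nat_add_iff (f := fun n : ℕ =>
          2 * (n : ℂ) * (hR τ n : ℂ) * (y : ℂ) ^ n) 1).2 s2
    have e2 : ∀ n : ℕ, (eR τ (n + 1) : ℂ) * (y : ℂ) ^ (n + 1)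
        = 2 * ((n + 1 : ℕ) : ℂ) * (hR τ (n + 1) : ℂ) * (y : ℂ) ^ (n + 1)
          - (y : ℂ) * ((2 * n + 1) * (hR τ n : ℂ) * (y : ℂ) ^ n) := by
      intro n
      simp only [eR, Nat.add_sub_cancel, Nat.succ_ne_zero, if_false]
      push_cast
      ring
    have s5 : Summable fun n : ℕ => (eR τ n : ℂ) * (y : ℂ) ^ n := by
      rw [← summable_nat_add_iff 1]
      simp only [e2]
      exact s4.sub s3
    rw [e1]
    unfold PS
    rw [s5.tsum_eq_zero_add, s2.tsum_eq_zero_add, eR_zero, ← tsum_mul_left]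
    simp only [e2]
    rw [s4.tsum_sub s3]
    simp
  rw [key, hy']
  push_cast
  linear_combination (fG t * PS (fun n => 2 * n * (hR τ n : ℂ)) (xt t ^ 2)) * hs

theorem hasDerivAt_K_of {τ : List (Bool × ℕ)} {φ : ℂ} {t : ℝ} (ht : t ∈ Set.Ioo (0 : ℝ) 1)
    (h : PS (fun n => eR τ n) (xt t ^ 2) = φ) : HasDerivAt (K τ) (fG t * φ) t := by
  rw [← h]
  exact hasDerivAt_K τ ht

theorem eR_false (k : ℕ) (τ : List (Bool × ℕ)) (n : ℕ) :
    eR ((false, k) :: τ) (n + 1)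
      = (2 * n + 2 : ℕ) * (a (n + 1) * (T τ (2 * n + 2) / ((2 * n + 2 : ℕ) : ℝ) ^ (k + 1))) := by
  have h := a_succ n
  have h1 := T_even_odd k τ (n + 1)
  have h2 := T_even_even k τ n
  rw [show 2 * (n + 1) = 2 * n + 2 by ring] at h1
  rw [eR_succ, h1, h2]
  push_cast at h ⊢
  linear_combination (-T τ (2 * n + 2) / (2 * (n : ℝ) + 2) ^ (k + 1)) * h

theorem eR_true (k : ℕ) (τ : List (Bool × ℕ)) (n : ℕ) :
    eR ((true, k) :: τ) (n + 1)
      = (2 * n + 1 : ℕ) * (a n * (T τ (2 * n + 1) / ((2 * n + 1 : ℕ) : ℝ) ^ (k + 1))) := by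
  have h1 := T_odd_odd k τ (n + 1)
  have h2 := T_odd_even k τ n
  rw [show 2 * (n + 1) = 2 * n + 2 by ring] at h1
  rw [eR_succ, h1, h2]
  push_cast
  ring

theorem fR_false_zero (k : ℕ) (τ : List (Bool × ℕ)) : fR false k τ 0 = 0 := by simp [fR]

theorem hasDerivAt_K_false_succ (k : ℕ) (τ : List (Bool × ℕ)) {t : ℝ}
    (ht : t ∈ Set.Ioo (0 : ℝ) 1) :
    HasDerivAt (K ((false, k + 1) :: τ)) (fG t * F false k τ t) t := by
  refine hasDerivAt_K_of ht ?_
  rw [F, Bool.toNat_false, pow_zero, one_mul]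
  congr 1
  funext n
  rcases n with _ | n
  · rw [eR_zero, fR_false_zero]
  · rw [eR_false, natCast_mul_div_pow_succ]
    rfl

theorem hasDerivAt_K_false_zero (τ : List (Bool × ℕ)) {t : ℝ} (ht : t ∈ Set.Ioo (0 : ℝ) 1) :
    HasDerivAt (K ((false, 0) :: τ)) (fG t * U τ t) t := by
  refine hasDerivAt_K_of ht ?_
  rw [U]
  congr 1
  funext n
  rcases n with _ | n
  · rw [eR_zero, uR, if_pos rfl]
  · have : ((2 * n + 2 : ℕ) : ℝ) ≠ 0 := by exact_mod_cast (by omega : 2 * n + 2 ≠ 0)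
    rw [eR_false, uR, if_neg n.succ_ne_zero, show 2 * (n + 1) = 2 * n + 2 by ring, zero_add,
      pow_one]
    congr 1
    field_simp

/-- A power series whose coefficients are those of `c` shifted by one. -/
theorem ps_shift {c d : ℕ → ℂ} (hd : Bdd d) {y : ℝ} (hy : |y| < 1) (h0 : c 0 = 0)
    (h : ∀ n, c (n + 1) = d n) : PS c y = y * PS d y := by
  have hs : Summable fun n => c n * (y : ℂ) ^ n := by
    rw [← summable_nat_add_iff 1]
    refine ((summable_ps hd hy).mul_left (y : ℂ)).congr fun n => ?_
    rw [h, pow_succ]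
    ring
  rw [ps_eq_add hs, h0, zero_add]
  congr 2
  exact funext h

theorem hasDerivAt_K_true_succ (k : ℕ) (τ : List (Bool × ℕ)) {t : ℝ}
    (ht : t ∈ Set.Ioo (0 : ℝ) 1) :
    HasDerivAt (K ((true, k + 1) :: τ)) (fB t * F true k τ t) t := by
  refine (hasDerivAt_K_of ht (ps_shift (bdd_fR true k τ) (xt_sq_lt_one ht) ?_
    fun n => ?_)).congr_deriv ?_
  · rw [eR_zero, Complex.ofReal_zero]
  · rw [eR_true, natCast_mul_div_pow_succ]
    rfl
  · rw [F, Bool.toNat_true, fB_eq_G ht]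
    push_cast
    ring

theorem hasDerivAt_K_true_zero (τ : List (Bool × ℕ)) {t : ℝ} (ht : t ∈ Set.Ioo (0 : ℝ) 1) :
    HasDerivAt (K ((true, 0) :: τ)) (fD t * K τ t) t := by
  refine (hasDerivAt_K_of ht (ps_shift (bdd_hR τ) (xt_sq_lt_one ht) ?_
    fun n => ?_)).congr_deriv ?_
  · rw [eR_zero, Complex.ofReal_zero]
  · have : ((2 * n + 1 : ℕ) : ℝ) ≠ 0 := by exact_mod_cast (2 * n).succ_ne_zero
    rw [eR_true, hR, zero_add, pow_one]
    congr 1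
    field_simp
  · rw [K, ← mul_assoc (fD t), fD_mul_st ht]
    push_cast
    ring

/-! ### Behaviour at the ends of the interval -/

theorem tendsto_xt_sq_zero : Tendsto (fun t => xt t ^ 2) (𝓝[>] 0) (𝓝[<] 1) := by
  refine tendsto_nhdsWithin_iff.2 ⟨?_, ?_⟩
  · have h : ContinuousAt (fun t => xt t ^ 2) 0 := by
      unfold xt
      refine ((by fun_prop : ContinuousAt (fun t : ℝ => 1 - t ^ 2) 0).div (by fun_prop) ?_).pow 2
      norm_num
    have := h.tendsto
    simp only [xt] at this ⊢
    norm_num at this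
    exact this.mono_left nhdsWithin_le_nhds
  · filter_upwards [Ioo_mem_nhdsGT (show (0 : ℝ) < 1 by norm_num)] with t ht
    exact (abs_lt.1 (xt_sq_lt_one ht)).2

theorem tendsto_xt_sq_one : Tendsto (fun t => xt t ^ 2) (𝓝[<] 1) (𝓝 0) := by
  have h : ContinuousAt (fun t => xt t ^ 2) 1 := by
    unfold xt
    refine ((by fun_prop : ContinuousAt (fun t : ℝ => 1 - t ^ 2) 1).div (by fun_prop) ?_).pow 2
    norm_num
  have := h.tendsto
  simp only [xt] at this ⊢
  norm_num at this
  exact this.mono_left nhdsWithin_le_nhds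

theorem tendsto_ps_xt_one {c : ℕ → ℂ} (hc : Bdd c) :
    Tendsto (fun t => PS c (xt t ^ 2)) (𝓝[<] 1) (𝓝 (c 0)) := by
  have h := (continuousAt_ps hc (y := 0) (by simp)).tendsto
  rw [ps_zero] at h
  exact h.comp tendsto_xt_sq_one

theorem tendsto_ofReal_left (x : ℝ) : Tendsto (fun t : ℝ => (t : ℂ)) (𝓝[<] x) (𝓝 x) :=
  (Complex.continuous_ofReal.tendsto x).mono_left nhdsWithin_le_nhds

theorem tendsto_ofReal_right (x : ℝ) : Tendsto (fun t : ℝ => (t : ℂ)) (𝓝[>] x) (𝓝 x) :=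
  (Complex.continuous_ofReal.tendsto x).mono_left nhdsWithin_le_nhds

/-- `x` vanishes to first order at `t = 1`. -/
theorem tendsto_xt_div_one_sub :
    Tendsto (fun t : ℝ => (xt t : ℂ) / (1 - (t : ℂ))) (𝓝[<] 1) (𝓝 1) := by
  have h : Tendsto (fun t : ℝ => (1 + (t : ℂ)) / (1 + (t : ℂ) ^ 2)) (𝓝[<] 1) (𝓝 1) := by
    have h1 := tendsto_ofReal_left 1
    have := (h1.const_add 1).div ((h1.pow 2).const_add 1) (by norm_num)
    norm_num at this
    exact this
  refine h.congr' ?_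
  filter_upwards [Ioo_mem_nhdsLT (show (0 : ℝ) < 1 by norm_num)] with t ht
  rw [xtC, show 1 - (t : ℂ) ^ 2 = (1 - t) * (1 + t) by ring]
  have h1 := one_sub_t_ne_zero ht
  have h2 := one_add_sq_ne_zero t
  field_simp

theorem tendsto_ps_xt_div {c : ℕ → ℂ} (hc : Bdd c) (h0 : c 0 = 0) :
    Tendsto (fun t : ℝ => PS c (xt t ^ 2) / (1 - (t : ℂ))) (𝓝[<] 1) (𝓝 0) := by
  have hb : Bdd fun n => c (n + 1) := by
    obtain ⟨C, hC⟩ := hc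
    exact ⟨C, fun n => hC _⟩
  have h1 := tendsto_xt_div_one_sub
  have h2 : Tendsto (fun t : ℝ => (xt t : ℂ)) (𝓝[<] 1) (𝓝 0) := by
    have h3 := h1.mul ((tendsto_ofReal_left 1).const_sub 1)
    norm_num at h3
    refine h3.congr' ?_
    filter_upwards [Ioo_mem_nhdsLT (show (0 : ℝ) < 1 by norm_num)] with t ht
    exact div_mul_cancel₀ _ (one_sub_t_ne_zero ht)
  have h4 := (h1.mul h2).mul (tendsto_ps_xt_one hb)
  simp only [mul_zero, zero_mul] at h4
  refine h4.congr' ?_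
  filter_upwards [Ioo_mem_nhdsLT (show (0 : ℝ) < 1 by norm_num)] with t ht
  rw [ps_eq_add (summable_ps hc (xt_sq_lt_one ht)), h0]
  push_cast
  ring

theorem tendsto_mul_F (b : Bool) (k : ℕ) (τ : List (Bool × ℕ)) :
    Tendsto (fun t : ℝ => (t : ℂ) * F b k τ t) (𝓝[>] 0) (𝓝 0) := by
  have h1 := (tendsto_ps_one (summable_fR b k τ).hasSum.tendsto_sum_nat).comp tendsto_xt_sq_zero
  have h2 : Tendsto (fun t : ℝ => (xt t : ℂ)) (𝓝[>] 0) (𝓝 1) := by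
    have h := tendsto_ofReal_right 0
    have := ((h.pow 2).const_sub 1).div ((h.pow 2).const_add 1) (by norm_num)
    norm_num at this
    exact this.congr fun t => (xtC t).symm
  have h3 := (tendsto_ofReal_right 0).mul ((h2.pow b.toNat).mul h1)
  rw [Complex.ofReal_zero, zero_mul] at h3
  exact h3

theorem tendsto_F_div (b : Bool) (k : ℕ) (τ : List (Bool × ℕ)) :
    ∃ r, Tendsto (fun t : ℝ => F b k τ t / (1 - (t : ℂ))) (𝓝[<] 1) (𝓝 r) := by
  cases b
  · refine ⟨0, ?_⟩
    have := tendsto_ps_xt_div (bdd_fR false k τ) (by rw [fR_false_zero, Complex.ofReal_zero])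
    simpa [F] using this
  · have := tendsto_xt_div_one_sub.mul (tendsto_ps_xt_one (bdd_fR true k τ))
    refine ⟨_, this.congr fun t => ?_⟩
    simp only [F, Bool.toNat_true]
    ring

/-- `K` is `o(1/t)` at `t = 0`: up to a bounded factor, `t K` is `1 - x²` times a power series in
`x²` whose coefficients tend to zero. -/
theorem tendsto_mul_K (τ : List (Bool × ℕ)) :
    Tendsto (fun t : ℝ => (t : ℂ) * K τ t) (𝓝[>] 0) (𝓝 0) := by
  have h1 := (tendsto_one_sub_mul_ps (tendsto_hR_complex τ)).comp tendsto_xt_sq_zero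
  have h2 : Tendsto (fun t : ℝ => (1 + (t : ℂ) ^ 2) / 2) (𝓝[>] 0) (𝓝 (1 / 2)) := by
    have := (((tendsto_ofReal_right 0).pow 2).const_add 1).div_const 2
    norm_num at this ⊢
    exact this
  have h3 := h2.mul h1
  rw [mul_zero] at h3
  refine h3.congr' ?_
  filter_upwards [Ioo_mem_nhdsGT (show (0 : ℝ) < 1 by norm_num)] with t ht
  have hs : 1 - ((xt t ^ 2 : ℝ) : ℂ) = (st t : ℂ) ^ 2 := by
    rw [sub_eq_iff_eq_add']
    exact_mod_cast (xt_sq_add_st_sq t).symm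
  simp only [Function.comp_apply]
  rw [hs, K, stC]
  have h2 := one_add_sq_ne_zero t
  field_simp

theorem tendsto_st_one : Tendsto (fun t : ℝ => (st t : ℂ)) (𝓝[<] 1) (𝓝 1) := by
  have h := tendsto_ofReal_left 1
  have := (h.const_mul 2).div ((h.pow 2).const_add 1) (by norm_num)
  norm_num at this
  exact this.congr fun t => (stC t).symm

theorem tendsto_K_div (p : Bool × ℕ) (τ : List (Bool × ℕ)) :
    ∃ r, Tendsto (fun t : ℝ => K (p :: τ) t / (1 - (t : ℂ))) (𝓝[<] 1) (𝓝 r) := by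
  have := tendsto_st_one.mul (tendsto_ps_xt_div (bdd_hR (p :: τ)) (by simp [hR, T_cons_one]))
  exact ⟨_, this.congr fun t => by rw [K, mul_div_assoc]⟩

/-- The binomial series `∑ a_n x ^ (2n) = 1 / √(1 - x²)`. -/
theorem K_nil {t : ℝ} (ht : t ∈ Set.Ioo (0 : ℝ) 1) : K [] t = 1 := by
  have hd : ∀ t ∈ Set.Ioo (0 : ℝ) 1, HasDerivAt (K []) 0 t := by
    intro t ht
    refine (hasDerivAt_K_of (φ := 0) ht ?_).congr_deriv (mul_zero _)
    have : ∀ n, eR [] n = 0 := by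
      intro n
      rcases n with _ | n
      · exact eR_zero _
      · rw [eR_succ]
        simp [T]
    simp [this, PS]
  obtain ⟨c, hc⟩ := isOpen_Ioo.exists_is_const_of_deriv_eq_zero (f := K [])
    (isPreconnected_Ioo (a := (0 : ℝ)) (b := 1))
    (fun t ht => (hd t ht).differentiableAt.differentiableWithinAt) fun t ht => (hd t ht).deriv
  have h1 : Tendsto (K []) (𝓝[<] 1) (𝓝 1) := by
    have := tendsto_st_one.mul (tendsto_ps_xt_one (bdd_hR []))
    simp only [hR, T, a_zero, mul_one, Complex.ofReal_one] at this
    exact this.congr fun t => by simp [K, hR, T]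
  have h2 : Tendsto (K []) (𝓝[<] 1) (𝓝 c) := by
    refine tendsto_const_nhds.congr' ?_
    filter_upwards [Ioo_mem_nhdsLT (show (0 : ℝ) < 1 by norm_num)] with t ht
    exact (hc t ht).symm
  rw [hc t ht, tendsto_nhds_unique h2 h1]

theorem U_nil {t : ℝ} (ht : t ∈ Set.Ioo (0 : ℝ) 1) : U [] t = 1 / st t - 1 := by
  have hs := stC_ne_zero ht
  have hsum := summable_ps (bdd_hR []) (xt_sq_lt_one ht)
  have h1 : K [] t = st t * (1 + U [] t) := by
    rw [K]
    congr 1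
    rw [U, ps_eq_add hsum, ps_eq_add (c := fun n => (uR [] n : ℂ))]
    · simp [uR, hR, T, a_zero]
    · rw [← summable_nat_add_iff 1] at hsum ⊢
      simpa [uR, hR, T] using hsum
  rw [K_nil ht] at h1
  field_simp
  linear_combination -h1

theorem U_true (k : ℕ) (τ : List (Bool × ℕ)) {t : ℝ} (ht : t ∈ Set.Ioo (0 : ℝ) 1) :
    U ((true, k) :: τ) t = K ((true, k) :: τ) t / st t := by
  have hs := stC_ne_zero ht
  rw [K, mul_div_cancel_left₀ _ hs, U]
  congr 1
  funext n
  rcases n with _ | n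
  · simp [uR, hR, T_cons_one]
  · rw [uR, if_neg n.succ_ne_zero, hR, T_odd_odd]

theorem U_false (k : ℕ) (τ : List (Bool × ℕ)) {t : ℝ} (ht : t ∈ Set.Ioo (0 : ℝ) 1) :
    U ((false, k) :: τ) t = K ((false, k) :: τ) t / st t - F false k τ t := by
  have hs := stC_ne_zero ht
  have s1 := summable_ps (bdd_hR ((false, k) :: τ)) (xt_sq_lt_one ht)
  have s2 := summable_ps (bdd_fR false k τ) (xt_sq_lt_one ht)
  rw [K, mul_div_cancel_left₀ _ hs, U, F, Bool.toNat_false, pow_zero, one_mul]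
  unfold PS
  rw [← s1.tsum_sub s2]
  refine tsum_congr fun n => ?_
  rcases n with _ | n
  · simp [uR, hR, T_cons_one, fR_false_zero]
  · simp only [uR, if_neg n.succ_ne_zero, hR, T_even_odd, fR, Bool.toNat_false, add_zero]
    push_cast
    ring

/-! ### The generating functions are iterated integrals of the expected weight -/

theorem fA_mul_U_nil {t : ℝ} (ht : t ∈ Set.Ioo (0 : ℝ) 1) : fA t * U [] t = fG t - fA t := by
  have hs := stC_ne_zero ht
  rw [U_nil ht, fA_eq_G ht]
  field_simp

theorem fA_mul_U_true (k : ℕ) (τ : List (Bool × ℕ)) {t : ℝ} (ht : t ∈ Set.Ioo (0 : ℝ) 1) :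
    fA t * U ((true, k) :: τ) t = fG t * K ((true, k) :: τ) t := by
  have hs := stC_ne_zero ht
  rw [U_true k τ ht, fA_eq_G ht]
  field_simp

theorem fA_mul_U_false (k : ℕ) (τ : List (Bool × ℕ)) {t : ℝ} (ht : t ∈ Set.Ioo (0 : ℝ) 1) :
    fA t * U ((false, k) :: τ) t = fG t * K ((false, k) :: τ) t - fA t * F false k τ t := by
  have hs := stC_ne_zero ht
  rw [U_false k τ ht, fA_eq_G ht]
  field_simp

theorem fG_mul_U_nil {t : ℝ} (ht : t ∈ Set.Ioo (0 : ℝ) 1) :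
    fG t * U [] t = fD t - (fG t - fA t) := by
  have hs := stC_ne_zero ht
  have h := fG_eq_AD ht
  rw [U_nil ht]
  field_simp
  linear_combination h

theorem fG_mul_U_true (k : ℕ) (τ : List (Bool × ℕ)) {t : ℝ} (ht : t ∈ Set.Ioo (0 : ℝ) 1) :
    fG t * U ((true, k) :: τ) t
      = fA t * K ((true, k) :: τ) t + fD t * K ((true, k) :: τ) t := by
  have hs := stC_ne_zero ht
  rw [U_true k τ ht, fG_eq_AD ht]
  field_simp

theorem fG_mul_U_false (k : ℕ) (τ : List (Bool × ℕ)) {t : ℝ} (ht : t ∈ Set.Ioo (0 : ℝ) 1) :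
    fG t * U ((false, k) :: τ) t
      = fA t * K ((false, k) :: τ) t + fD t * K ((false, k) :: τ) t - fG t * F false k τ t := by
  have hs := stC_ne_zero ht
  rw [U_false k τ ht]
  nth_rewrite 1 [fG_eq_AD ht]
  rw [fG_eq_AD ht]
  field_simp

/-- The generating functions attached to `τ` are good, of weight `wt τ`. The parity of the number
of forms `dx / √(1 - x²)`, which determines the power of `i`, is the parity in `x`. -/
def GoodWord (τ : List (Bool × ℕ)) : Prop :=
  ∀ b k τ', τ = (b, k) :: τ' → Good b.toNat (wt τ) (F b k τ') ∧ Good 0 (wt τ) (K τ)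

theorem GoodWord.densAt_A_U {τ : List (Bool × ℕ)} (h : GoodWord τ) (u : List Letter) :
    DensAt u 0 (wt τ + 1) fun t => fA t * U τ t := by
  rcases τ with _ | ⟨⟨b, k⟩, τ⟩
  · exact (densAt_base_G_sub_A u).congr fun t ht => fA_mul_U_nil ht
  · obtain ⟨hF, hK⟩ := h b k τ rfl
    cases b
    · exact ((hK.densAt_G u).sub (hF.densAt_A u)).congr fun t ht => fA_mul_U_false k τ ht
    · exact (hK.densAt_G u).congr fun t ht => fA_mul_U_true k τ ht

theorem GoodWord.densAt_G_U {τ : List (Bool × ℕ)} (h : GoodWord τ) {u : List Letter}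
    (hu : u ≠ []) : DensAt u 0 (wt τ + 1) fun t => fG t * U τ t := by
  rcases τ with _ | ⟨⟨b, k⟩, τ⟩
  · exact ((densAt_base_D hu).sub (densAt_base_G_sub_A u)).congr fun t ht => fG_mul_U_nil ht
  · obtain ⟨hF, hK⟩ := h b k τ rfl
    cases b
    · exact (((hK.densAt_A u).add (hK.densAt_D hu)).sub (hF.densAt_G u)).congr
        fun t ht => fG_mul_U_false k τ ht
    · exact ((hK.densAt_A u).add (hK.densAt_D hu)).congr fun t ht => fG_mul_U_true k τ ht

theorem GoodWord.densAt_B_K {τ : List (Bool × ℕ)} (h : GoodWord τ) (u : List Letter) :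
    DensAt u 1 (wt τ + 1) fun t => fB t * K τ t := by
  rcases τ with _ | ⟨⟨b, k⟩, τ⟩
  · exact (densAt_base_B u).congr fun t ht => by rw [K_nil ht, mul_one]
  · exact (h b k τ rfl).2.densAt_B u

theorem GoodWord.densAt_D_K {τ : List (Bool × ℕ)} (h : GoodWord τ) {u : List Letter}
    (hu : u ≠ []) : DensAt u 0 (wt τ + 1) fun t => fD t * K τ t := by
  rcases τ with _ | ⟨⟨b, k⟩, τ⟩
  · exact (densAt_base_D hu).congr fun t ht => by rw [K_nil ht, mul_one]
  · exact (h b k τ rfl).2.densAt_D hu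

theorem good_F {b : Bool} {k : ℕ} {τ : List (Bool × ℕ)} {p w : ℕ} {φ : ℝ → ℂ}
    (h : ∀ t ∈ Set.Ioo (0 : ℝ) 1, HasDerivAt (F b k τ) (φ t) t) (hφ : Dens p w φ) :
    Good p w (F b k τ) := ⟨φ, h, tendsto_mul_F b k τ, tendsto_F_div b k τ, hφ⟩

theorem good_K {c : Bool × ℕ} {τ : List (Bool × ℕ)} {p w : ℕ} {φ : ℝ → ℂ}
    (h : ∀ t ∈ Set.Ioo (0 : ℝ) 1, HasDerivAt (K (c :: τ)) (φ t) t) (hφ : Dens p w φ) :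
    Good p w (K (c :: τ)) := ⟨φ, h, tendsto_mul_K (c :: τ), tendsto_K_div c τ, hφ⟩

/-- The derivatives of `F` and `K` are forms in the letters times generating functions of weight
one less: of the same word with the first exponent lowered or, when that exponent is `1`, of the
tail of the word. -/
theorem goodWord_cons {τ : List (Bool × ℕ)} (h : GoodWord τ) (b : Bool) (k : ℕ) :
    Good b.toNat (wt ((b, k) :: τ)) (F b k τ) ∧ Good 0 (wt ((b, k) :: τ)) (K ((b, k) :: τ)) := by
  induction k with
  | zero =>
    rw [wt_cons, zero_add, add_comm]
    cases b
    · exact ⟨good_F (fun t ht => hasDerivAt_F_false_zero τ ht) fun u _ => h.densAt_A_U u,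
        good_K (fun t ht => hasDerivAt_K_false_zero τ ht) fun u hu => h.densAt_G_U hu⟩
    · exact ⟨good_F (fun t ht => hasDerivAt_F_true_zero τ ht) fun u _ => h.densAt_B_K u,
        good_K (fun t ht => hasDerivAt_K_true_zero τ ht) fun u hu => h.densAt_D_K hu⟩
  | succ k ih =>
    have hw : wt ((b, k + 1) :: τ) = wt ((b, k) :: τ) + 1 := by
      rw [wt_cons, wt_cons]
      ring
    rw [hw]
    refine ⟨good_F (fun t ht => hasDerivAt_F_succ b k τ ht) fun u _ => ih.1.densAt_A u, ?_⟩
    cases b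
    · exact good_K (fun t ht => hasDerivAt_K_false_succ k τ ht) fun u _ => ih.1.densAt_G u
    · exact good_K (fun t ht => hasDerivAt_K_true_succ k τ ht) fun u _ =>
        (ih.1.densAt_B u).add_two

theorem goodWord (τ : List (Bool × ℕ)) : GoodWord τ := by
  induction τ with
  | nil =>
    intro b k τ' h
    simp at h
  | cons p τ ih =>
    intro b k τ' h
    obtain ⟨rfl, rfl⟩ := List.cons.inj h
    exact goodWord_cons ih b k

theorem good_F_word (b : Bool) (k : ℕ) (τ : List (Bool × ℕ)) :
    Good b.toNat (wt ((b, k) :: τ)) (F b k τ) := (goodWord _ b k τ rfl).1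

theorem good_K_word (b : Bool) (k : ℕ) (τ : List (Bool × ℕ)) :
    Good 0 (wt ((b, k) :: τ)) (K ((b, k) :: τ)) := (goodWord _ b k τ rfl).2

/-! ### From integrals to series -/

/-- The hyperlogarithm of the empty word is `1`. -/
theorem DensAt.hasIntIn {p w : ℕ} {φ : ℝ → ℂ} (h : DensAt [] p w φ) :
    HasIntIn (twist p w) φ := by
  have h' : HasIntIn (twist p (0 + w)) fun t => hyperlog [] t * φ t := h
  rw [zero_add] at h'
  exact h'.congr fun t _ => by rw [hyperlog_nil, one_mul]

theorem a_eq_prod (n : ℕ) : a n = ∏ i ∈ range n, (2 * (i : ℝ) + 1) / (2 * i + 2) := by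
  induction n with
  | zero => simp [a_zero]
  | succ n ih =>
    rw [prod_range_succ, ← ih]
    have := a_succ n
    field_simp
    linear_combination this

theorem integral_cos_pow_even (n : ℕ) :
    ∫ θ in (0 : ℝ)..Real.pi / 2, Real.cos θ ^ (2 * n) = Real.pi / 2 * a n := by
  rw [EulerSine.integral_cos_pow_eq, integral_sin_pow_even, a_eq_prod]
  ring

theorem xt_tan_half {θ : ℝ} (h : Real.cos (θ / 2) ≠ 0) : xt (Real.tan (θ / 2)) = Real.cos θ := by
  have h1 : Real.cos θ = 2 * Real.cos (θ / 2) ^ 2 - 1 := by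
    rw [← Real.cos_two_mul]
    congr 1
    ring
  have h2 := Real.sin_sq_add_cos_sq (θ / 2)
  have h3 : 1 + Real.tan (θ / 2) ^ 2 ≠ 0 := by positivity
  rw [xt, div_eq_iff h3, h1, Real.tan_eq_sin_div_cos]
  field_simp
  linear_combination (-2 * Real.cos (θ / 2) ^ 2) * h2

/-- Since `a_n = (2/π) ∫₀^{π/2} cos^{2n}`, integrating a power series in `x²` against
`dx / √(1 - x²)` multiplies the `n`-th coefficient by `(π/2) a_n`. -/
theorem pi_mul_tsum_mem {V : Submodule ℚ ℂ} {f : ℕ → ℂ} (hf : Summable fun n => ‖f n‖)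
    (h : HasIntIn V fun t => fB t * PS f (xt t ^ 2)) :
    (Real.pi : ℂ) * ∑' n, (a n : ℂ) * f n ∈ V := by
  obtain ⟨P, p₀, p₁, h1, h2, h3, h4⟩ := h
  have hpi := Real.pi_pos
  have hcont : ∀ n : ℕ, Continuous fun θ : ℝ => f n * ((Real.cos θ : ℝ) : ℂ) ^ (2 * n) :=
    fun n => continuous_const.mul ((Complex.continuous_ofReal.comp Real.continuous_cos).pow _)
  have hbound : ∀ (n : ℕ) (θ : ℝ), ‖f n * ((Real.cos θ : ℝ) : ℂ) ^ (2 * n)‖ ≤ ‖f n‖ := by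
    intro n θ
    rw [norm_mul, norm_pow, Complex.norm_real, Real.norm_eq_abs]
    exact mul_le_of_le_one_right (norm_nonneg _)
      (pow_le_one₀ (abs_nonneg _) (Real.abs_cos_le_one θ))
  have hPS : ∀ θ : ℝ, PS f (Real.cos θ ^ 2) = ∑' n, f n * ((Real.cos θ : ℝ) : ℂ) ^ (2 * n) := by
    intro θ
    unfold PS
    exact tsum_congr fun n => by push_cast; rw [pow_mul]
  have hcs : Continuous fun θ : ℝ => PS f (Real.cos θ ^ 2) := by
    simp only [hPS]
    exact continuous_tsum hcont hf hbound
  have hint : ∫ θ in (0 : ℝ)..Real.pi / 2, PS f (Real.cos θ ^ 2)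
      = Real.pi / 2 * ∑' n, (a n : ℂ) * f n := by
    have hs := intervalIntegral.hasSum_integral_of_dominated_convergence (μ := MeasureTheory.volume)
      (a := (0 : ℝ)) (b := Real.pi / 2)
      (F := fun n θ => f n * ((Real.cos θ : ℝ) : ℂ) ^ (2 * n))
      (f := fun θ => PS f (Real.cos θ ^ 2)) (fun n _ => ‖f n‖)
      (fun n => (hcont n).aestronglyMeasurable)
      (fun n => Eventually.of_forall fun θ _ => hbound n θ)
      (Eventually.of_forall fun _ _ => hf)
      intervalIntegrable_const
      (Eventually.of_forall fun θ _ => by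
        rw [hPS]
        exact (Summable.of_norm_bounded hf fun n => hbound n θ).hasSum)
    rw [← hs.tsum_eq, ← tsum_mul_left]
    refine tsum_congr fun n => ?_
    rw [intervalIntegral.integral_const_mul]
    have : ∫ θ in (0 : ℝ)..Real.pi / 2, ((Real.cos θ : ℝ) : ℂ) ^ (2 * n)
        = ((Real.pi / 2 * a n : ℝ) : ℂ) := by
      rw [← integral_cos_pow_even, ← intervalIntegral.integral_ofReal]
      simp only [Complex.ofReal_pow]
    rw [this]
    push_cast
    ring
  have hcos : ∀ θ ∈ Set.Ioo 0 (Real.pi / 2), 0 < Real.cos (θ / 2) := fun θ hθ =>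
    Real.cos_pos_of_mem_Ioo ⟨by linarith [hθ.1], by linarith [hθ.2]⟩
  have htan : ∀ θ ∈ Set.Ioo 0 (Real.pi / 2), Real.tan (θ / 2) ∈ Set.Ioo (0 : ℝ) 1 := by
    intro θ hθ
    refine ⟨Real.tan_pos_of_pos_of_lt_pi_div_two (by linarith [hθ.1]) (by linarith [hθ.2]), ?_⟩
    rw [← Real.tan_pi_div_four]
    exact Real.tan_lt_tan_of_nonneg_of_lt_pi_div_two (by linarith [hθ.1]) (by linarith)
      (by linarith [hθ.2])
  have htd : ∀ θ : ℝ, 0 < Real.cos (θ / 2) →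
      HasDerivAt (fun θ => Real.tan (θ / 2)) ((1 + Real.tan (θ / 2) ^ 2) / 2) θ := by
    intro θ hθ
    have := (Real.hasDerivAt_tan hθ.ne').comp θ ((hasDerivAt_id θ).div_const 2)
    refine this.congr_deriv ?_
    rw [← Real.inv_one_add_tan_sq hθ.ne']
    field_simp
  -- the substitution `t = tan (θ / 2)`, for which `x = cos θ`
  have hFTC := intervalIntegral.integral_eq_sub_of_hasDerivAt_of_tendsto
    (f := fun θ => P (Real.tan (θ / 2))) (f' := fun θ => -PS f (Real.cos θ ^ 2))
    (a := 0) (b := Real.pi / 2) (fa := p₀) (fb := p₁) (by positivity)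
    (fun θ hθ => by
      have ht := htan θ hθ
      refine ((h1 _ ht).scomp θ (htd θ (hcos θ hθ))).congr_deriv ?_
      beta_reduce
      rw [xt_tan_half (hcos θ hθ).ne', Complex.real_smul, fB]
      have := one_add_sq_ne_zero (Real.tan (θ / 2))
      push_cast at this ⊢
      field_simp)
    (hcs.neg.intervalIntegrable _ _)
    (by
      refine h2.comp (tendsto_nhdsWithin_iff.2 ⟨?_, ?_⟩)
      · have := (htd 0 (by simp)).continuousAt.tendsto
        simp only [zero_div, Real.tan_zero] at this
        exact this.mono_left nhdsWithin_le_nhds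
      · filter_upwards [Ioo_mem_nhdsGT (show (0 : ℝ) < Real.pi / 2 by positivity)] with θ hθ
        exact (htan θ hθ).1)
    (by
      refine h3.comp (tendsto_nhdsWithin_iff.2 ⟨?_, ?_⟩)
      · have := (htd (Real.pi / 2) (Real.cos_pos_of_mem_Ioo
          ⟨by linarith, by linarith⟩)).continuousAt.tendsto
        rw [show Real.pi / 2 / 2 = Real.pi / 4 by ring, Real.tan_pi_div_four] at this
        exact this.mono_left nhdsWithin_le_nhds
      · filter_upwards [Ioo_mem_nhdsLT (show (0 : ℝ) < Real.pi / 2 by positivity)] with θ hθ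
        exact (htan θ hθ).2)
  rw [intervalIntegral.integral_neg, hint] at hFTC
  have : (Real.pi : ℂ) * ∑' n, (a n : ℂ) * f n = (-2 : ℚ) • (p₁ - p₀) := by
    rw [← hFTC, Rat.smul_def]
    push_cast
    ring
  rw [this]
  exact V.smul_mem _ h4

/-- The sum `π ∑ a_n² T_τ(N) / N ^ (k + 1)`, over `N` of parity `b`, lies in `i · CMZV⁴` of weight
one more than that of the nested sum. -/
theorem pi_mul_tsum_fR_mem (b : Bool) (k : ℕ) (τ : List (Bool × ℕ)) :
    (Real.pi : ℂ) * ∑' n, (a n : ℂ) * (fR b k τ n : ℂ) ∈ twist 1 (wt ((b, k) :: τ) + 1) := by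
  refine pi_mul_tsum_mem (summable_fR b k τ).norm ?_
  have h := good_F_word b k τ
  cases b
  · exact (h.densAt_B []).hasIntIn.congr fun t _ => by simp [F]
  · refine (h.densAt_G []).hasIntIn.congr fun t ht => ?_
    rw [fB_eq_G ht, F, Bool.toNat_true]
    ring

/-! ### The inhomogeneous target space -/

/-- The space `CMZV⁴_{≤ w} ⊗ ℚ[i]`, as a rational vector space. -/
def VQi (w : ℕ) : Submodule ℚ ℂ := (extendQi (CMZVLe 4 w)).restrictScalars ℚ

theorem mem_VQi {w : ℕ} {v : ℂ} : v ∈ VQi w ↔ v ∈ extendQi (CMZVLe 4 w) := Iff.rfl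

theorem CMZV_le {w w' : ℕ} (h : w ≤ w') : CMZV 4 w ≤ CMZVLe 4 w' :=
  le_iSup (fun k : Fin (w' + 1) => CMZV 4 k) ⟨w, by omega⟩

theorem VQi_mono {w w' : ℕ} (h : w ≤ w') : VQi w ≤ VQi w' := by
  intro v hv
  rw [mem_VQi] at hv ⊢
  refine Submodule.span_mono ?_ hv
  exact SetLike.coe_subset_coe.2 (iSup_le fun k => CMZV_le (by omega))

theorem I_mul_mem_VQi {w : ℕ} {v : ℂ} (h : v ∈ VQi w) : Complex.I * v ∈ VQi w :=
  (extendQi (CMZVLe 4 w)).smul_mem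
    (⟨Complex.I, Algebra.subset_adjoin rfl⟩ : Algebra.adjoin ℚ ({Complex.I} : Set ℂ)) h

theorem twist_le_VQi {p w w' : ℕ} (h : w ≤ w') : twist p w ≤ VQi w' := by
  intro v hv
  obtain ⟨c, hc, rfl⟩ := mem_twist.1 hv
  have hc' : c ∈ VQi w' := mem_VQi.2 (Submodule.subset_span (CMZV_le h hc))
  clear hv
  induction p with
  | zero => simpa using hc'
  | succ p ih =>
    rw [pow_succ', mul_assoc]
    exact I_mul_mem_VQi ih

theorem DensAt.hasIntIn_VQi {p w w' : ℕ} {φ : ℝ → ℂ} (h : DensAt [] p w φ) (hw : w ≤ w') :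
    HasIntIn (VQi w') φ := h.hasIntIn.mono (twist_le_VQi hw)

/-- `π` itself is an integral of `dx / √(1 - x²)`. -/
theorem pi_mem_VQi : (Real.pi : ℂ) ∈ VQi 1 := by
  have h := pi_mul_tsum_mem (V := VQi 1) (f := fun n => if n = 0 then 1 else 0)
    (summable_of_ne_finset_zero (s := {0}) fun n hn => by simpa using hn)
    (((densAt_base_B []).hasIntIn_VQi le_rfl).congr fun t _ => by
      have : PS (fun n => if n = 0 then 1 else 0) (xt t ^ 2) = 1 := hyperlog_nil _
      rw [this, mul_one])
  rw [tsum_eq_single 0 fun n hn => by simp [hn]] at h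
  simpa [a_zero] using h

theorem one_mem_VQi (w : ℕ) : (1 : ℂ) ∈ VQi w := by
  have h0 : (1 : ℂ) ∈ twist 0 0 := by
    refine mem_twist.2 ⟨1, Submodule.subset_span ?_, by simp⟩
    exact ⟨0, Fin.elim0, Fin.elim0, fun j => j.elim0, fun j => j.elim0, fun h => absurd h (by simp),
      by simp, tendsto_const_nhds.congr fun N => (cmzvPartial_zero _ _ N).symm⟩
  exact twist_le_VQi (Nat.zero_le w) h0

/-! ### The series with denominators `2n - 1`: an integral with a double pole -/

/-- The form `(1 - x) dx / (x √(1 - x²))` stays regular at `t = 0` after division by `√(1 - x²)`. -/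
theorem fG_sub_fB_eq {t : ℝ} (ht : t ∈ Set.Ioo (0 : ℝ) 1) :
    fG t - fB t = -(letterFun (some z1) t + letterFun (some zm1) t) * st t := by
  rw [letterFun_one, letterFun_m1, fG, fB, stC,
    show 1 - (t : ℂ) ^ 2 = (1 - t) * (1 + t) by ring]
  have h1 := one_sub_t_ne_zero ht
  have h2 := one_add_t_ne_zero ht
  have h3 := one_add_sq_ne_zero t
  field_simp
  ring

theorem fG_sub_fB_mul_xt {t : ℝ} (ht : t ∈ Set.Ioo (0 : ℝ) 1) :
    (fG t - fB t) * xt t = (letterFun (some zI) t + letterFun (some zmI) t) * st t := by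
  rw [letterFun_I ht, letterFun_mI ht, fG, fB, stC, xtC]
  have h1 := one_sub_sq_ne_zero ht
  have h3 := one_add_sq_ne_zero t
  field_simp
  ring

theorem Good.hasIntIn_sub {p w : ℕ} {R : ℝ → ℂ} (h : Good p w R) :
    HasIntIn (VQi (w + 1)) fun t => (fG t - fB t) * R t :=
  (((h.densAt_G []).hasIntIn_VQi le_rfl).sub ((h.densAt_B []).hasIntIn_VQi le_rfl)).congr
    fun t _ => by ring

theorem hasIntIn_sub_div_K (b : Bool) (k : ℕ) (τ : List (Bool × ℕ)) :
    HasIntIn (VQi (wt ((b, k) :: τ) + 1))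
      fun t => (fG t - fB t) * (K ((b, k) :: τ) t / st t) := by
  have h := good_K_word b k τ
  refine (((h.densAt_letter (some z1) [] (by simp)).add
    (h.densAt_letter (some zm1) [] (by simp))).neg.hasIntIn_VQi le_rfl).congr fun t ht => ?_
  rw [fG_sub_fB_eq ht]
  have hs := stC_ne_zero ht
  field_simp

theorem hasIntIn_sub_U (τ : List (Bool × ℕ)) :
    HasIntIn (VQi (wt τ + 1)) fun t => (fG t - fB t) * U τ t := by
  rcases τ with _ | ⟨⟨b, k⟩, τ⟩
  · refine (((densAt_base_B []).hasIntIn_VQi le_rfl).sub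
      (((densAt_base_m1 []).add (densAt_base_m1 [])).hasIntIn_VQi le_rfl)).congr fun t ht => ?_
    have hs := stC_ne_zero ht
    have h1 := fG_sub_fB_eq ht
    have h2 := fG_eq ht
    rw [U_nil ht]
    field_simp
    linear_combination h1 - (st t : ℂ) * h2
  · cases b
    · exact ((hasIntIn_sub_div_K false k τ).sub (good_F_word false k τ).hasIntIn_sub).congr
        fun t ht => by rw [U_false k τ ht]; ring
    · exact (hasIntIn_sub_div_K true k τ).congr fun t ht => by rw [U_true k τ ht]

theorem hasIntIn_sub_xt_K (τ : List (Bool × ℕ)) :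
    HasIntIn (VQi (wt τ + 1)) fun t => (fG t - fB t) * (xt t * K τ t / st t) := by
  have e : ∀ t ∈ Set.Ioo (0 : ℝ) 1, (fG t - fB t) * (xt t * K τ t / st t)
      = (letterFun (some zI) t + letterFun (some zmI) t) * K τ t := by
    intro t ht
    have h := fG_sub_fB_mul_xt ht
    have hs := stC_ne_zero ht
    field_simp
    linear_combination K τ t * h
  rcases τ with _ | ⟨⟨b, k⟩, τ⟩
  · exact (((densAt_base_I []).add (densAt_base_mI [])).hasIntIn_VQi le_rfl).congr
      fun t ht => by rw [e t ht, K_nil ht, mul_one]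
  · have h := good_K_word b k τ
    exact (((h.densAt_letter (some zI) [] (by simp)).add
      (h.densAt_letter (some zmI) [] (by simp))).hasIntIn_VQi le_rfl).congr
      fun t ht => by rw [e t ht]; ring

/-- The derivative of `K` is `dx / (x √(1 - x²))` times a function `E` of weight one less, for which
`∫ (1 - x) E dx / (x √(1 - x²))` has a known value. -/
theorem exists_deriv_K_false (k : ℕ) (τ : List (Bool × ℕ)) :
    ∃ E : ℝ → ℂ, (∀ t ∈ Set.Ioo (0 : ℝ) 1,
        HasDerivAt (K ((false, k) :: τ)) (fG t * E t) t) ∧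
      HasIntIn (VQi (wt ((false, k) :: τ))) fun t => (fG t - fB t) * E t := by
  rcases k with _ | k
  · refine ⟨U τ, fun t ht => hasDerivAt_K_false_zero τ ht, ?_⟩
    rw [wt_cons, zero_add, add_comm]
    exact hasIntIn_sub_U τ
  · refine ⟨F false k τ, fun t ht => hasDerivAt_K_false_succ k τ ht, ?_⟩
    have hw : wt ((false, k + 1) :: τ) = wt ((false, k) :: τ) + 1 := by
      rw [wt_cons, wt_cons]
      ring
    rw [hw]
    exact (good_F_word false k τ).hasIntIn_sub

/-- Here one function `E` serves the derivatives of both `K` and `F`. -/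
theorem exists_deriv_K_true (k : ℕ) (τ : List (Bool × ℕ)) :
    ∃ E : ℝ → ℂ, (∀ t ∈ Set.Ioo (0 : ℝ) 1,
        HasDerivAt (K ((true, k) :: τ)) (fB t * E t) t ∧
        HasDerivAt (F true k τ) (fA t * E t) t) ∧
      HasIntIn (VQi (wt ((true, k) :: τ))) fun t => (fG t - fB t) * E t := by
  rcases k with _ | k
  · refine ⟨fun t => xt t * K τ t / st t, fun t ht => ⟨?_, ?_⟩, ?_⟩
    · refine (hasDerivAt_K_true_zero τ ht).congr_deriv ?_
      have hs := stC_ne_zero ht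
      have h := fD_mul_st ht
      rw [fB_eq_G ht]
      field_simp
      linear_combination K τ t * h
    · refine (hasDerivAt_F_true_zero τ ht).congr_deriv ?_
      have hs := stC_ne_zero ht
      rw [fB_eq_G ht, fA_eq_G ht]
      field_simp
    · rw [wt_cons, zero_add, add_comm]
      exact hasIntIn_sub_xt_K τ
  · refine ⟨F true k τ, fun t ht => ⟨hasDerivAt_K_true_succ k τ ht,
      hasDerivAt_F_succ true k τ ht⟩, ?_⟩
    have hw : wt ((true, k + 1) :: τ) = wt ((true, k) :: τ) + 1 := by
      rw [wt_cons, wt_cons]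
      ring
    rw [hw]
    exact (good_F_word true k τ).hasIntIn_sub

theorem tendsto_zero_of_div {R : ℝ → ℂ} {r : ℂ}
    (h : Tendsto (fun t : ℝ => R t / (1 - (t : ℂ))) (𝓝[<] 1) (𝓝 r)) :
    Tendsto R (𝓝[<] 1) (𝓝 0) := by
  have h3 := h.mul ((tendsto_ofReal_left 1).const_sub 1)
  norm_num at h3
  refine h3.congr' ?_
  filter_upwards [Ioo_mem_nhdsLT (show (0 : ℝ) < 1 by norm_num)] with t ht
  exact div_mul_cancel₀ _ (one_sub_t_ne_zero ht)

theorem tendsto_sub_one_mul_K_zero (τ : List (Bool × ℕ)) :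
    Tendsto (fun t : ℝ => ((xt t : ℂ) - 1) * K τ t) (𝓝[>] 0) (𝓝 0) := by
  have h := tendsto_ofReal_right 0
  have h1 : Tendsto (fun t : ℝ => -2 * (t : ℂ) / (1 + (t : ℂ) ^ 2)) (𝓝[>] 0) (𝓝 0) := by
    have := (h.const_mul (-2)).div ((h.pow 2).const_add 1) (by norm_num)
    norm_num at this ⊢
    exact this
  have h2 := h1.mul (tendsto_mul_K τ)
  rw [mul_zero] at h2
  refine h2.congr fun t => ?_
  rw [xtC]
  have := one_add_sq_ne_zero t
  field_simp
  ring

theorem tendsto_sub_one_mul_K_one (p : Bool × ℕ) (τ : List (Bool × ℕ)) :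
    Tendsto (fun t : ℝ => ((xt t : ℂ) - 1) * K (p :: τ) t) (𝓝[<] 1) (𝓝 0) := by
  obtain ⟨r, hr⟩ := tendsto_K_div p τ
  have h1 := tendsto_zero_of_div tendsto_xt_div_one_sub
  simpa using (h1.sub_const 1).mul (tendsto_zero_of_div hr)

/-- The generating function `√(1 - x²) · ∑ a_n T_τ(2n + 2) x ^ (2n)`. -/
def W (τ : List (Bool × ℕ)) (t : ℝ) : ℂ :=
  st t * PS (fun n => (a n * T τ (2 * n + 2) : ℝ)) (xt t ^ 2)

theorem W_nil {t : ℝ} (ht : t ∈ Set.Ioo (0 : ℝ) 1) : W [] t = 1 := K_nil ht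

theorem W_false (k : ℕ) (τ : List (Bool × ℕ)) (t : ℝ) :
    W ((false, k) :: τ) t = K ((false, k) :: τ) t := by
  simp only [W, K, hR, T_even_even]

theorem tendsto_W_coeff (τ : List (Bool × ℕ)) :
    Tendsto (fun n => a n * T τ (2 * n + 2)) atTop (𝓝 0) := by
  rcases τ with _ | ⟨⟨b, k⟩, τ⟩
  · exact tendsto_hR []
  · cases b
    · simp only [T_even_even]
      exact tendsto_hR _
    · have h := (tendsto_hR ((true, k) :: τ)).add
        (summable_abs_fR true k τ).of_abs.tendsto_atTop_zero
      rw [add_zero] at h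
      refine h.congr fun n => ?_
      rw [T_odd_even, mul_add]
      rfl

theorem bdd_W_coeff (τ : List (Bool × ℕ)) :
    Bdd fun n => ((a n * T τ (2 * n + 2) : ℝ) : ℂ) :=
  Bdd.of_tendsto ((Complex.continuous_ofReal.tendsto 0).comp (tendsto_W_coeff τ))

theorem W_true (k : ℕ) (τ : List (Bool × ℕ)) {t : ℝ} (ht : t ∈ Set.Ioo (0 : ℝ) 1) :
    W ((true, k) :: τ) t = K ((true, k) :: τ) t + st t * (F true k τ t / xt t) := by
  have s1 := summable_ps (bdd_hR ((true, k) :: τ)) (xt_sq_lt_one ht)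
  have s2 := summable_ps (bdd_fR true k τ) (xt_sq_lt_one ht)
  have hx := xtC_ne_zero ht
  rw [W, K, F, Bool.toNat_true, pow_one, mul_div_cancel_left₀ _ hx, ← mul_add]
  congr 1
  unfold PS
  rw [← s1.tsum_add s2]
  refine tsum_congr fun n => ?_
  simp only [T_odd_even, hR, fR, Bool.toNat_true]
  push_cast
  ring

/-- The integral `∫₀¹ W dx`: integration by parts with the boundary function `(x - 1) K`, chosen so
that the remaining forms have no pole at `x = 1`. -/
theorem hasIntIn_W (τ : List (Bool × ℕ)) :
    HasIntIn (VQi (wt τ + 1)) fun t => fB t * st t * W τ t := by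
  have hX : ∀ t ∈ Set.Ioo (0 : ℝ) 1, HasDerivAt (fun t => (xt t : ℂ) - 1) (fB t * st t) t := by
    intro t ht
    refine ((hasDerivAt_xtC ht).sub_const 1).congr_deriv ?_
    rw [fB_eq_G ht, fA_eq_G ht]
    ring
  have hs2 : ∀ t, (st t : ℂ) ^ 2 = 1 - (xt t : ℂ) ^ 2 := by
    intro t
    rw [eq_sub_iff_add_eq']
    exact_mod_cast xt_sq_add_st_sq t
  rcases τ with _ | ⟨⟨b, k⟩, τ⟩
  · refine ⟨fun t => (xt t : ℂ) - 1, 0, -1, fun t ht => ?_, ?_, ?_, ?_⟩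
    · beta_reduce
      rw [W_nil ht, mul_one]
      exact hX t ht
    · have h := tendsto_ofReal_right 0
      have := (((h.pow 2).const_sub 1).div ((h.pow 2).const_add 1) (by norm_num)).sub_const 1
      norm_num at this
      exact this.congr fun t => by rw [xtC]
    · have h1 := tendsto_zero_of_div tendsto_xt_div_one_sub
      simpa using h1.sub_const 1
    · rw [sub_zero]
      exact (VQi _).neg_mem (one_mem_VQi _)
  · cases b
    · obtain ⟨E, hE, hE'⟩ := exists_deriv_K_false k τ
      refine (hE'.mono (VQi_mono (Nat.le_succ _))).neg.of_boundary
        (B := fun t => ((xt t : ℂ) - 1) * K ((false, k) :: τ) t)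
        (fun t ht => ((hX t ht).mul (hE t ht)).congr_deriv ?_)
        (tendsto_sub_one_mul_K_zero _) (tendsto_sub_one_mul_K_one _ _)
      rw [W_false, fB_eq_G ht]
      ring
    · obtain ⟨E, hE, hE'⟩ := exists_deriv_K_true k τ
      have hF := (good_F_word true k τ).densAt_G []
      refine ((hE'.mono (VQi_mono (Nat.le_succ _))).sub
        (hF.hasIntIn_VQi le_rfl)).of_boundary
        (B := fun t => ((xt t : ℂ) - 1) * K ((true, k) :: τ) t + st t * F true k τ t)
        (fun t ht => (((hX t ht).mul (hE t ht).1).add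
          ((hasDerivAt_stC t).mul (hE t ht).2)).congr_deriv ?_) ?_ ?_
      · have hx := xtC_ne_zero ht
        have h := hs2 t
        rw [W_true k τ ht, fB_eq_G ht, fA_eq_G ht]
        field_simp
        linear_combination (fG t * E t - fG t * F true k τ t) * h
      · have h1 := tendsto_ofReal_right 0
        have h2 : Tendsto (fun t : ℝ => 2 / (1 + (t : ℂ) ^ 2)) (𝓝[>] 0) (𝓝 2) := by
          have := (tendsto_const_nhds (x := (2 : ℂ))).div ((h1.pow 2).const_add 1) (by norm_num)
          norm_num at this ⊢
          exact this
        have h3 := h2.mul (tendsto_mul_F true k τ)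
        rw [mul_zero] at h3
        have h4 := (tendsto_sub_one_mul_K_zero ((true, k) :: τ)).add h3
        rw [add_zero] at h4
        refine h4.congr fun t => ?_
        rw [stC]
        ring
      · obtain ⟨r, hr⟩ := tendsto_F_div true k τ
        simpa using (tendsto_sub_one_mul_K_one (true, k) τ).add
          (tendsto_st_one.mul (tendsto_zero_of_div hr))

/-! ### Sequences `c` for which `∑ a_n² c_n` has a known value -/

/-- The rational vector space of sequences `c` such that `π ∑ ω_n c_n` converges to an element of
`V`. -/
def seriesSpace (ω : ℕ → ℝ) (V : Submodule ℚ ℂ) : Submodule ℚ (ℕ → ℝ) where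
  carrier := {c | Summable (fun n => ω n * c n) ∧
    (Real.pi : ℂ) * ((∑' n, ω n * c n : ℝ) : ℂ) ∈ V}
  add_mem' := by
    rintro c c' ⟨h1, h2⟩ ⟨h1', h2'⟩
    refine ⟨(h1.add h1').congr fun n => by simp; ring, ?_⟩
    have : ∑' n, ω n * (c + c') n = ∑' n, ω n * c n + ∑' n, ω n * c' n := by
      rw [← h1.tsum_add h1']
      exact tsum_congr fun n => by simp; ring
    rw [this]
    push_cast
    rw [mul_add]
    push_cast at h2 h2'
    exact V.add_mem h2 h2'
  zero_mem' := by simp [summable_zero]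
  smul_mem' := by
    rintro r c ⟨h1, h2⟩
    refine ⟨(h1.mul_left (r : ℝ)).congr fun n => by simp [Rat.smul_def]; ring, ?_⟩
    have : ∑' n, ω n * (r • c) n = r * ∑' n, ω n * c n := by
      rw [← tsum_mul_left]
      exact tsum_congr fun n => by simp [Rat.smul_def]; ring
    rw [this]
    have h3 := V.smul_mem r h2
    rw [Rat.smul_def] at h3
    convert h3 using 1
    push_cast
    ring

/-- The sequences `c` such that `π ∑_{n ≥ 1} a_n² c_{n-1}` converges to an element of
`CMZV⁴_{≤ w} ⊗ ℚ[i]`. Indexing from `n = 1` ensures that none of the linear forms vanishes. -/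
def valueSpace (w : ℕ) : Submodule ℚ (ℕ → ℝ) := seriesSpace (fun n => a (n + 1) ^ 2) (VQi w)

theorem mem_valueSpace {w : ℕ} {c : ℕ → ℝ} : c ∈ valueSpace w ↔
    Summable (fun n => a (n + 1) ^ 2 * c n) ∧
      (Real.pi : ℂ) * ((∑' n, a (n + 1) ^ 2 * c n : ℝ) : ℂ) ∈ VQi w := Iff.rfl

theorem valueSpace_mono {w w' : ℕ} (h : w ≤ w') : valueSpace w ≤ valueSpace w' :=
  fun _ hc => ⟨hc.1, VQi_mono h hc.2⟩

theorem pi_mul_rat_mem {w : ℕ} (hw : 1 ≤ w) (r : ℚ) : (Real.pi : ℂ) * ((r : ℝ) : ℂ) ∈ VQi w := by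
  have h := (VQi w).smul_mem r (VQi_mono hw pi_mem_VQi)
  rw [Rat.smul_def, mul_comm] at h
  exact_mod_cast h

theorem succ_mem_valueSpace {w : ℕ} (hw : 1 ≤ w) {f : ℕ → ℝ}
    (h1 : Summable fun n => a n ^ 2 * f n)
    (h2 : (Real.pi : ℂ) * ((∑' n, a n ^ 2 * f n : ℝ) : ℂ) ∈ VQi w) (r : ℚ) (hr : f 0 = r) :
    (fun n => f (n + 1)) ∈ valueSpace w := by
  refine ⟨(summable_nat_add_iff 1).2 h1, ?_⟩
  have h3 := h1.tsum_eq_zero_add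
  rw [a_zero, hr, one_pow, one_mul] at h3
  have h4 : ∑' n, a (n + 1) ^ 2 * f (n + 1) = ∑' n, a n ^ 2 * f n - r := by linarith
  rw [h4, Complex.ofReal_sub, mul_sub]
  exact (VQi w).sub_mem h2 (pi_mul_rat_mem hw r)

theorem exists_T_eq_rat (τ : List (Bool × ℕ)) (N : ℕ) : ∃ r : ℚ, T τ N = r := by
  induction τ generalizing N with
  | nil => exact ⟨1, by simp [T]⟩
  | cons p τ ih =>
    choose g hg using ih
    refine ⟨∑ M ∈ range N, if M.bodd = p.1 then g M / (M : ℚ) ^ (p.2 + 1) else 0, ?_⟩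
    rw [T]
    push_cast
    refine sum_congr rfl fun M _ => ?_
    split_ifs
    · rw [hg]
      push_cast
      rfl
    · simp

/-- The summand of the basic evaluations, without the factor `a_n²`. -/
def gR (b : Bool) (k : ℕ) (τ : List (Bool × ℕ)) (n : ℕ) : ℝ :=
  T τ (2 * n + b.toNat) / ((2 * n + b.toNat : ℕ) : ℝ) ^ (k + 1)

theorem a_sq_mul_gR (b : Bool) (k : ℕ) (τ : List (Bool × ℕ)) (n : ℕ) :
    a n ^ 2 * gR b k τ n = a n * fR b k τ n := by
  rw [gR, fR]
  ring

theorem summable_gR (b : Bool) (k : ℕ) (τ : List (Bool × ℕ)) :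
    Summable fun n => a n ^ 2 * gR b k τ n := by
  simp only [a_sq_mul_gR]
  refine Summable.of_norm_bounded (summable_abs_fR b k τ) fun n => ?_
  rw [norm_mul, Real.norm_eq_abs, Real.norm_eq_abs, abs_of_pos (a_pos n)]
  exact mul_le_of_le_one_left (abs_nonneg _) (a_le_one n)

theorem pi_mul_tsum_gR_mem (b : Bool) (k : ℕ) (τ : List (Bool × ℕ)) :
    (Real.pi : ℂ) * ((∑' n, a n ^ 2 * gR b k τ n : ℝ) : ℂ)
      ∈ twist 1 (wt ((b, k) :: τ) + 1) := by
  simp only [a_sq_mul_gR]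
  have := pi_mul_tsum_fR_mem b k τ
  push_cast
  exact this

theorem gR_succ_mem (b : Bool) (k : ℕ) (τ : List (Bool × ℕ)) :
    (fun n => gR b k τ (n + 1)) ∈ valueSpace (wt τ + k + 2) := by
  obtain ⟨r, hr⟩ := exists_T_eq_rat τ b.toNat
  refine succ_mem_valueSpace (by omega) (summable_gR b k τ)
    (twist_le_VQi ?_ (pi_mul_tsum_gR_mem b k τ)) (r / ((b.toNat : ℕ) : ℚ) ^ (k + 1)) ?_
  · rw [wt_cons]
    omega
  · rw [gR, mul_zero, zero_add, hr]
    push_cast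
    rfl

theorem even_mem (k : ℕ) (τ : List (Bool × ℕ)) :
    (fun n : ℕ => T τ (2 * n + 2) / (2 * (n : ℝ) + 2) ^ (k + 1)) ∈ valueSpace (wt τ + k + 2) := by
  convert gR_succ_mem false k τ using 2 with n
  rw [gR, Bool.toNat_false, add_zero, show 2 * (n + 1) = 2 * n + 2 by ring]
  push_cast
  rfl

theorem odd_mem (k : ℕ) (τ : List (Bool × ℕ)) :
    (fun n : ℕ => T τ (2 * n + 3) / (2 * (n : ℝ) + 3) ^ (k + 1)) ∈ valueSpace (wt τ + k + 2) := by
  convert gR_succ_mem true k τ using 2 with n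
  rw [gR, Bool.toNat_true, show 2 * (n + 1) + 1 = 2 * n + 3 by ring]
  push_cast
  rfl

/-- The increments of `n ↦ T_τ(2n)`. -/
def dT (τ : List (Bool × ℕ)) (n : ℕ) : ℝ := T τ (2 * n + 4) - T τ (2 * n + 2)

theorem dT_nil : dT [] = 0 := by
  funext n
  simp [dT, T]

theorem dT_cons (b : Bool) (k : ℕ) (τ : List (Bool × ℕ)) (n : ℕ) :
    dT ((b, k) :: τ) n = gR b k τ (n + 1) := by
  rw [dT, gR, show 2 * n + 4 = 2 * (n + 1) + 2 by ring, show 2 * n + 2 = 2 * (n + 1) by ring]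
  cases b
  · rw [T_even_even, T_even_odd, Bool.toNat_false, add_zero]
    ring
  · rw [T_odd_even, T_odd_odd, Bool.toNat_true]
    ring

theorem dT_mem (τ : List (Bool × ℕ)) : dT τ ∈ valueSpace (wt τ + 1) := by
  rcases τ with _ | ⟨⟨b, k⟩, τ⟩
  · rw [dT_nil]
    exact zero_mem _
  · have h := gR_succ_mem b k τ
    rw [show dT ((b, k) :: τ) = fun n => gR b k τ (n + 1) from funext (dT_cons b k τ), wt_cons]
    convert h using 2
    ring

theorem summable_a_mul_dT (τ : List (Bool × ℕ)) :
    Summable fun n => |a (n + 1) * dT τ n| := by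
  rcases τ with _ | ⟨⟨b, k⟩, τ⟩
  · simp [dT_nil]
  · refine ((summable_nat_add_iff 1).2 (summable_abs_fR b k τ)).congr fun n => ?_
    rw [dT_cons]
    rfl

/-- The sequence `T_τ(2n) / (2n - 1) ^ k`, indexed from `n = 1`. -/
def mR (k : ℕ) (τ : List (Bool × ℕ)) (n : ℕ) : ℝ := T τ (2 * n + 2) / (2 * (n : ℝ) + 1) ^ k

theorem summable_a_mul_mR (k : ℕ) (τ : List (Bool × ℕ)) :
    Summable fun n => |a (n + 1) * mR (k + 1) τ n| := by
  refine Summable.of_nonneg_of_le (fun _ => abs_nonneg _) (fun n => ?_)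
    (((summable_nat_add_iff 1).2 (summable_abs_fR false 0 τ)).mul_left 2)
  rw [fR, mR, abs_mul, abs_mul, abs_div, abs_div, Bool.toNat_false, add_zero, zero_add, pow_one,
    show 2 * (n + 1) = 2 * n + 2 by ring, mul_left_comm]
  push_cast
  have hn : (0 : ℝ) ≤ n := Nat.cast_nonneg n
  have h1 : (2 * (n : ℝ) + 1) ≤ (2 * (n : ℝ) + 1) ^ (k + 1) :=
    le_self_pow₀ (by linarith) (by omega)
  rw [abs_of_pos (by positivity : 0 < (2 * (n : ℝ) + 1) ^ (k + 1)),
    abs_of_pos (by positivity : 0 < 2 * (n : ℝ) + 2)]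
  refine mul_le_mul_of_nonneg_left ?_ (abs_nonneg _)
  rw [mul_div_assoc', div_le_div_iff₀ (by positivity) (by positivity)]
  nlinarith [abs_nonneg (T τ (2 * n + 2))]

theorem summable_a_sq_mul_mR (k : ℕ) (τ : List (Bool × ℕ)) :
    Summable fun n => a (n + 1) ^ 2 * mR (k + 1) τ n := by
  refine Summable.of_norm_bounded (summable_a_mul_mR k τ) fun n => ?_
  rw [pow_two, mul_assoc, norm_mul, Real.norm_eq_abs, Real.norm_eq_abs, abs_of_pos (a_pos _)]
  exact mul_le_of_le_one_left (abs_nonneg _) (a_le_one _)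

theorem a_eq_succ (n : ℕ) : a n = a (n + 1) * ((2 * (n : ℝ) + 2) / (2 * n + 1)) := by
  have h := a_succ n
  field_simp
  linear_combination -h

/-- The coefficients `a_n T_τ(2n + 2) - a_{n-1} T_τ(2n)` of `(1 - x²) ∑ a_n T_τ(2n + 2) x ^ (2n)`.
-/
def wR (τ : List (Bool × ℕ)) : ℕ → ℝ
  | 0 => T τ 2
  | n + 1 => a (n + 1) * T τ (2 * n + 4) - a n * T τ (2 * n + 2)

theorem wR_succ (τ : List (Bool × ℕ)) (n : ℕ) :
    wR τ (n + 1) = a (n + 1) * (dT τ n - mR 1 τ n) := by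
  rw [wR, dT, mR, a_eq_succ n]
  field_simp
  ring

theorem summable_abs_wR (τ : List (Bool × ℕ)) : Summable fun n => |wR τ n| := by
  rw [← summable_nat_add_iff 1]
  refine Summable.of_nonneg_of_le (fun _ => abs_nonneg _) (fun n => ?_)
    ((summable_a_mul_dT τ).add (summable_a_mul_mR 0 τ))
  rw [wR_succ, mul_sub]
  exact abs_sub _ _

theorem ps_wR (τ : List (Bool × ℕ)) {y : ℝ} (hy : |y| < 1) :
    PS (fun n => wR τ n) y = (1 - y) * PS (fun n => (a n * T τ (2 * n + 2) : ℝ)) y := by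
  have s1 := summable_ps (bdd_W_coeff τ) hy
  have hs : Summable fun n => (wR τ n : ℂ) :=
    Complex.ofRealCLM.summable (summable_abs_wR τ).of_abs
  have s2 := summable_ps (Bdd.of_tendsto hs.tendsto_atTop_zero) hy
  have e1 := ps_eq_add s1
  have s3 : Summable fun n => ((a (n + 1) * T τ (2 * n + 4) : ℝ) : ℂ) * (y : ℂ) ^ n :=
    summable_ps (c := fun n => ((a (n + 1) * T τ (2 * n + 4) : ℝ) : ℂ)) (by
      obtain ⟨C, hC⟩ := bdd_W_coeff τ
      exact ⟨C, fun n => hC (n + 1)⟩) hy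
  have e3 : PS (fun n => (wR τ (n + 1) : ℂ)) y
      = PS (fun n => ((a (n + 1) * T τ (2 * (n + 1) + 2) : ℝ) : ℂ)) y
        - PS (fun n => ((a n * T τ (2 * n + 2) : ℝ) : ℂ)) y := by
    refine Eq.trans ?_ (Summable.tsum_sub s3 s1)
    refine tsum_congr fun n => ?_
    simp only [wR, show 2 * (n + 1) + 2 = 2 * n + 4 by ring]
    push_cast
    ring
  rw [ps_eq_add s2, e3, wR]
  rw [a_zero] at e1
  simp only [one_mul, mul_zero, zero_add] at e1
  linear_combination -e1

/-- The evaluation obtained from `∫ W dx`: multiplying the generating function by `1 - x²` turns the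
coefficients `a_n T_τ(2n + 2)` into their differences, in which denominators `2n - 1` appear. -/
theorem one_sub_mem (τ : List (Bool × ℕ)) :
    (fun n => dT τ n - mR 1 τ n) ∈ valueSpace (wt τ + 1) := by
  have hW : HasIntIn (VQi (wt τ + 1)) fun t => fB t * PS (fun n => wR τ n) (xt t ^ 2) := by
    refine (hasIntIn_W τ).congr fun t ht => ?_
    have h : (st t : ℂ) ^ 2 = 1 - ((xt t ^ 2 : ℝ) : ℂ) := by
      rw [eq_sub_iff_add_eq']
      exact_mod_cast xt_sq_add_st_sq t
    rw [ps_wR τ (xt_sq_lt_one ht), W, ← h]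
    ring
  have hs : Summable fun n => ‖(wR τ n : ℂ)‖ := by
    simpa only [Complex.norm_real, Real.norm_eq_abs] using summable_abs_wR τ
  have h1 := pi_mul_tsum_mem hs hW
  have hs2 : Summable fun n => a n ^ 2 * (wR τ n / a n) := by
    refine Summable.of_norm_bounded (summable_abs_wR τ) fun n => ?_
    have h0 := a_pos n
    rw [show a n ^ 2 * (wR τ n / a n) = a n * wR τ n by field_simp, norm_mul,
      Real.norm_eq_abs, Real.norm_eq_abs, abs_of_pos h0]
    exact mul_le_of_le_one_left (abs_nonneg _) (a_le_one n)
  obtain ⟨r, hr⟩ := exists_T_eq_rat τ 2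
  have h2 := succ_mem_valueSpace (Nat.le_add_left 1 (wt τ)) hs2 (by
    convert h1 using 2
    push_cast
    refine tsum_congr fun n => ?_
    have h0 : (a n : ℂ) ≠ 0 := by exact_mod_cast (a_pos n).ne'
    field_simp) r (by rw [wR, a_zero, div_one, hr])
  convert h2 using 2 with n
  have h0 := (a_pos (n + 1)).ne'
  rw [wR_succ]
  field_simp

theorem mR_one_mem (τ : List (Bool × ℕ)) : mR 1 τ ∈ valueSpace (wt τ + 1) := by
  have h := (valueSpace (wt τ + 1)).sub_mem (dT_mem τ) (one_sub_mem τ)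
  convert h using 1
  funext n
  simp

theorem a_sq_eq_succ (n : ℕ) : a n ^ 2
    = a (n + 1) ^ 2 * (1 + 2 / (2 * (n : ℝ) + 1) + 1 / (2 * (n : ℝ) + 1) ^ 2) := by
  rw [a_eq_succ n]
  field_simp
  ring

/-- A telescoping sum, since `a_{n-1}² = a_n² (1 + 2 / (2n - 1) + 1 / (2n - 1)²)`. Only the term at
the lower end survives, so that the value is rational. -/
theorem telescope_mem (τ : List (Bool × ℕ)) :
    (fun n => dT τ n - 2 * mR 1 τ n - mR 2 τ n) ∈ valueSpace 1 := by
  have e : ∀ n, a (n + 1) ^ 2 * (dT τ n - 2 * mR 1 τ n - mR 2 τ n)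
      = a (n + 1) ^ 2 * T τ (2 * (n + 1) + 2) - a n ^ 2 * T τ (2 * n + 2) := by
    intro n
    rw [a_sq_eq_succ n, dT, mR, mR]
    ring_nf
  have hd := (dT_mem τ).1
  have hs : Summable fun n => a (n + 1) ^ 2 * (dT τ n - 2 * mR 1 τ n - mR 2 τ n) := by
    refine ((hd.sub ((summable_a_sq_mul_mR 0 τ).mul_left 2)).sub
      (summable_a_sq_mul_mR 1 τ)).congr fun n => ?_
    ring
  refine ⟨hs, ?_⟩
  have h0 : Tendsto (fun n => a n ^ 2 * T τ (2 * n + 2)) atTop (𝓝 0) := by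
    have hn := (tendsto_W_coeff τ).norm
    rw [norm_zero] at hn
    refine squeeze_zero_norm (fun n => ?_) hn
    rw [pow_two, mul_assoc, norm_mul, Real.norm_eq_abs, abs_of_pos (a_pos n)]
    exact mul_le_of_le_one_left (norm_nonneg _) (a_le_one n)
  have h1 : Tendsto (fun N => ∑ n ∈ range N,
      a (n + 1) ^ 2 * (dT τ n - 2 * mR 1 τ n - mR 2 τ n)) atTop (𝓝 (0 - T τ 2)) := by
    have h2 := h0.sub_const (T τ 2)
    refine h2.congr fun N => ?_
    simp only [e]
    rw [sum_range_sub (fun n => a n ^ 2 * T τ (2 * n + 2)), a_zero]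
    simp
  obtain ⟨r, hr⟩ := exists_T_eq_rat τ 2
  rw [tendsto_nhds_unique hs.hasSum.tendsto_sum_nat h1, hr]
  have := pi_mul_rat_mem le_rfl (-r)
  convert this using 3
  simp

theorem mR_two_mem (τ : List (Bool × ℕ)) : mR 2 τ ∈ valueSpace (wt τ + 1) := by
  have h1 := valueSpace_mono (Nat.le_add_left 1 (wt τ)) (telescope_mem τ)
  have h2 := (valueSpace (wt τ + 1)).smul_mem (2 : ℚ) (mR_one_mem τ)
  have h := (valueSpace (wt τ + 1)).sub_mem ((valueSpace (wt τ + 1)).sub_mem (dT_mem τ) h2) h1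
  convert h using 1
  funext n
  simp [Rat.smul_def]

/-- The index shift `a_{n-1}² = a_n² (1 + 1 / (2n - 1))²` turns denominators `2n - 1` into
`2n + 1`. -/
theorem shift_mem (k : ℕ) (τ : List (Bool × ℕ)) :
    (fun n => mR (k + 1) τ n + 2 * mR (k + 2) τ n + mR (k + 3) τ n)
      ∈ valueSpace (wt τ + k + 2) := by
  have e : ∀ n, a (n + 1) ^ 2 * (mR (k + 1) τ n + 2 * mR (k + 2) τ n + mR (k + 3) τ n)
      = a n ^ 2 * mR (k + 1) τ n := by
    intro n
    rw [a_sq_eq_succ n, mR, mR, mR]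
    field_simp
    ring
  rw [mem_valueSpace]
  simp only [e]
  have h1 := summable_gR true k τ
  have h2 := twist_le_VQi (p := 1) (w' := wt τ + k + 2) (by rw [wt_cons]; omega)
    (pi_mul_tsum_gR_mem true k τ)
  rcases τ with _ | ⟨⟨b, j⟩, τ⟩
  · have e2 : ∀ n, mR (k + 1) [] n = gR true k [] n := by
      intro n
      simp [mR, gR, T]
    simp only [e2]
    exact ⟨h1, h2⟩
  · cases b
    · have e2 : ∀ n, mR (k + 1) ((false, j) :: τ) n = gR true k ((false, j) :: τ) n := by
        intro n
        rw [mR, gR, T_even_even, Bool.toNat_true]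
        push_cast
        rfl
      simp only [e2]
      exact ⟨h1, h2⟩
    · have e2 : ∀ n, a n ^ 2 * mR (k + 1) ((true, j) :: τ) n
          = a n ^ 2 * gR true k ((true, j) :: τ) n + a n ^ 2 * gR true (j + k + 1) τ n := by
        intro n
        rw [mR, gR, gR, T_odd_even, Bool.toNat_true]
        push_cast
        field_simp
        ring
      simp only [e2]
      have h3 := summable_gR true (j + k + 1) τ
      have h4 := twist_le_VQi (p := 1) (w' := wt ((true, j) :: τ) + k + 2)
        (by rw [wt_cons, wt_cons]; omega) (pi_mul_tsum_gR_mem true (j + k + 1) τ)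
      refine ⟨h1.add h3, ?_⟩
      rw [h1.tsum_add h3, Complex.ofReal_add, mul_add]
      exact (VQi _).add_mem h2 h4

/-- For denominators `(2n - 1) ^ (k + 1)` the weight is two less than for `2n` and `2n + 1` (one
less if `k = 0`). Exponents `1` and `2` come from the integral and the telescoping sum, larger ones
from the index shift. -/
theorem mR_mem (k : ℕ) (τ : List (Bool × ℕ)) : mR (k + 1) τ ∈ valueSpace (wt τ + max k 1) := by
  induction k using Nat.strong_induction_on with
  | _ k ih =>
    match k with
    | 0 => exact mR_one_mem τ
    | 1 => exact mR_two_mem τ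
    | k + 2 =>
      have h0 := valueSpace_mono (w' := wt τ + max (k + 2) 1) (by omega) (ih k (by omega))
      have h1 := valueSpace_mono (w' := wt τ + max (k + 2) 1) (by omega) (ih (k + 1) (by omega))
      have h2 := valueSpace_mono (w' := wt τ + max (k + 2) 1) (by omega) (shift_mem k τ)
      have h := (valueSpace (wt τ + max (k + 2) 1)).sub_mem
        ((valueSpace _).sub_mem h2 ((valueSpace _).smul_mem (2 : ℚ) h1)) h0
      convert h using 1
      funext n
      simp [Rat.smul_def]
      ring

/-! ### Partial fractions and nested sums with arbitrary linear forms -/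

/-- The linear form `l` at `n + 1`, as a real number. -/
def LinForm.shift (l : LinForm) (n : ℕ) : ℝ := (l.val (n + 1) : ℝ)

theorem shift_even (n : ℕ) : LinForm.even.shift n = 2 * n + 2 := by
  simp only [LinForm.shift, LinForm.val]
  push_cast
  ring

theorem shift_oddSucc (n : ℕ) : LinForm.oddSucc.shift n = 2 * n + 3 := by
  simp only [LinForm.shift, LinForm.val]
  push_cast
  ring

theorem shift_oddPred (n : ℕ) : LinForm.oddPred.shift n = 2 * n + 1 := by
  simp only [LinForm.shift, LinForm.val]
  push_cast
  ring

theorem shift_ge (l : LinForm) (n : ℕ) : (n : ℝ) + 1 ≤ l.shift n := by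
  have : (0 : ℝ) ≤ n := Nat.cast_nonneg n
  cases l
  · rw [shift_even]; linarith
  · rw [shift_oddSucc]; linarith
  · rw [shift_oddPred]; linarith

theorem shift_ne_zero (l : LinForm) (n : ℕ) : l.shift n ≠ 0 := by
  have h := shift_ge l n
  have : (0 : ℝ) ≤ n := Nat.cast_nonneg n
  linarith

theorem exists_shift_sub (l l' : LinForm) (h : l ≠ l') :
    ∃ δ : ℚ, δ ≠ 0 ∧ ∀ n, l.shift n - l'.shift n = δ := by
  cases l <;> cases l'
  · exact absurd rfl h
  · exact ⟨-1, by norm_num, fun n => by rw [shift_even, shift_oddSucc]; push_cast; ring⟩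
  · exact ⟨1, by norm_num, fun n => by rw [shift_even, shift_oddPred]; push_cast; ring⟩
  · exact ⟨1, by norm_num, fun n => by rw [shift_even, shift_oddSucc]; push_cast; ring⟩
  · exact absurd rfl h
  · exact ⟨2, by norm_num, fun n => by rw [shift_oddSucc, shift_oddPred]; push_cast; ring⟩
  · exact ⟨-1, by norm_num, fun n => by rw [shift_even, shift_oddPred]; push_cast; ring⟩
  · exact ⟨-2, by norm_num, fun n => by rw [shift_oddSucc, shift_oddPred]; push_cast; ring⟩
  · exact absurd rfl h

/-- Partial fractions: a sequence divided by powers of two different linear forms is a rational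
combination of the sequence divided by smaller powers of only one of them. -/
theorem partial_fraction_mem {V : Submodule ℚ (ℕ → ℝ)} {f : ℕ → ℝ} {l l' : LinForm} (hl : l ≠ l')
    {i j : ℕ} (hij : 0 < i + j)
    (h : ∀ m, 1 ≤ m → m ≤ i → (fun n => f n / l.shift n ^ m) ∈ V)
    (h' : ∀ m, 1 ≤ m → m ≤ j → (fun n => f n / l'.shift n ^ m) ∈ V) :
    (fun n => f n / (l.shift n ^ i * l'.shift n ^ j)) ∈ V := by
  induction hk : i + j using Nat.strong_induction_on generalizing i j with
  | _ k ih =>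
    rcases i with _ | i
    · simpa using h' j (by omega) le_rfl
    rcases j with _ | j
    · simpa using h (i + 1) (by omega) le_rfl
    obtain ⟨δ, hδ, hd⟩ := exists_shift_sub l l' hl
    have h1 := ih (i + (j + 1)) (by omega) (i := i) (j := j + 1) (by omega)
      (fun m h1 h2 => h m h1 (by omega)) h' rfl
    have h2 := ih (i + 1 + j) (by omega) (i := i + 1) (j := j) (by omega) h
      (fun m h1 h2 => h' m h1 (by omega)) rfl
    have h3 := V.smul_mem δ⁻¹ (V.sub_mem h1 h2)
    convert h3 using 1
    funext n
    have e1 := shift_ne_zero l n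
    have e2 := shift_ne_zero l' n
    have e3 : (δ : ℝ) ≠ 0 := by exact_mod_cast hδ
    simp only [Pi.smul_apply, Pi.sub_apply, Rat.smul_def, Rat.cast_inv]
    rw [← hd n] at e3 ⊢
    field_simp
    ring

/-- Division of a sequence by a power of a linear form. -/
def divMap (l : LinForm) (k : ℕ) : (ℕ → ℝ) →ₗ[ℚ] (ℕ → ℝ) where
  toFun c n := c n / l.shift n ^ k
  map_add' c c' := by
    funext n
    simp [add_div]
  map_smul' r c := by
    funext n
    simp [Rat.smul_def, mul_div_assoc]

/-- The strict partial sums of a sequence. -/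
def sumMap : (ℕ → ℝ) →ₗ[ℚ] (ℕ → ℝ) where
  toFun c n := ∑ m ∈ range n, c m
  map_add' c c' := by
    funext n
    simp [sum_add_distrib]
  map_smul' r c := by
    funext n
    simp [Rat.smul_def, mul_sum]

/-- The sequence `T_τ(2n) / l(n) ^ j`, indexed from `n = 1`. -/
def basic (τ : List (Bool × ℕ)) (l : LinForm) (j : ℕ) (n : ℕ) : ℝ :=
  T τ (2 * n + 2) / l.shift n ^ j

/-- The span of the sequences `T_τ(2n) / l(n) ^ j` of weight at most `w` with `j₀ ≤ j`, indexed
from `n = 1`. -/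
def innerSpace (j₀ w : ℕ) : Submodule ℚ (ℕ → ℝ) :=
  Submodule.span ℚ {c | ∃ τ l j, j₀ ≤ j ∧ wt τ + j ≤ w ∧ c = basic τ l j}

theorem basic_mem {j₀ w : ℕ} {τ : List (Bool × ℕ)} {l : LinForm} {j : ℕ} (h0 : j₀ ≤ j)
    (h : wt τ + j ≤ w) : basic τ l j ∈ innerSpace j₀ w :=
  Submodule.subset_span ⟨τ, l, j, h0, h, rfl⟩

theorem innerSpace_mono {j₀ j₁ w w' : ℕ} (hj : j₁ ≤ j₀) (h : w ≤ w') :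
    innerSpace j₀ w ≤ innerSpace j₁ w' := by
  refine Submodule.span_le.2 ?_
  rintro c ⟨τ, l, j, h0, h1, rfl⟩
  exact basic_mem (hj.trans h0) (h1.trans h)

theorem const_mem_innerSpace (w : ℕ) (r : ℚ) : (fun _ => (r : ℝ)) ∈ innerSpace 0 w := by
  have h := (innerSpace 0 w).smul_mem r (basic_mem (τ := []) (l := .even) (j := 0) le_rfl
    (by simp [wt_nil]))
  convert h using 1
  funext n
  simp [basic, T, Rat.smul_def]

theorem divMap_mem {j₀ w : ℕ} {c : ℕ → ℝ} (hc : c ∈ innerSpace j₀ w) (l : LinForm) {k : ℕ}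
    (hk : 1 ≤ k) : divMap l k c ∈ innerSpace 1 (w + k) := by
  suffices innerSpace j₀ w ≤ (innerSpace 1 (w + k)).comap (divMap l k) from this hc
  refine Submodule.span_le.2 ?_
  rintro c ⟨τ, l', j, -, h1, rfl⟩
  rw [SetLike.mem_coe, Submodule.mem_comap]
  by_cases hl : l = l'
  · subst hl
    convert basic_mem (τ := τ) (l := l) (j := j + k) (j₀ := 1) (w := w + k) (by omega)
      (by omega) using 1
    funext n
    simp only [divMap, LinearMap.coe_mk, AddHom.coe_mk, basic]
    rw [div_div, pow_add]
  · have h := partial_fraction_mem (V := innerSpace 1 (w + k)) (f := fun n => T τ (2 * n + 2)) hl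
      (i := k) (j := j) (by omega)
      (fun m h1 h2 => basic_mem (τ := τ) (l := l) (j := m) h1 (by omega))
      (fun m h1 h2 => basic_mem (τ := τ) (l := l') (j := m) h1 (by omega))
    convert h using 1
    funext n
    simp only [divMap, LinearMap.coe_mk, AddHom.coe_mk, basic]
    rw [div_div, mul_comm (l'.shift n ^ j)]

theorem T_add_one_mem (τ : List (Bool × ℕ)) :
    (fun n => T τ (2 * n + 1)) ∈ innerSpace 0 (wt τ) := by
  have h0 : ∀ τ, (fun n => T τ (2 * n + 2)) ∈ innerSpace 0 (wt τ) := fun τ => by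
    convert basic_mem (τ := τ) (l := .even) (j := 0) (j₀ := 0) (w := wt τ) le_rfl (by simp)
      using 1
    funext n
    simp [basic]
  induction τ with
  | nil => exact h0 []
  | cons p τ ih =>
    obtain ⟨b, k⟩ := p
    cases b
    · convert h0 ((false, k) :: τ) using 1
      funext n
      rw [T_even_even]
    · have h1 := divMap_mem ih .oddPred (k := k + 1) (by omega)
      have h2 := innerSpace_mono (w' := wt ((true, k) :: τ)) (Nat.zero_le 1)
        (by rw [wt_cons]; omega) h1
      convert (innerSpace 0 _).sub_mem (h0 ((true, k) :: τ)) h2 using 1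
      funext n
      simp only [divMap, LinearMap.coe_mk, AddHom.coe_mk, Pi.sub_apply, shift_oddPred]
      rw [T_odd_even]
      push_cast
      ring

theorem sum_gR (b : Bool) (k : ℕ) (τ : List (Bool × ℕ)) (n : ℕ) :
    ∑ m ∈ range n, gR b k τ m = T ((b, k) :: τ) (2 * n) := by
  induction n with
  | zero => simp [T_cons_zero]
  | succ n ih =>
    rw [sum_range_succ, ih, gR, show 2 * (n + 1) = 2 * n + 2 by ring]
    cases b
    · rw [T_even_even, T_even_odd, Bool.toNat_false, add_zero]
    · rw [T_odd_even, T_odd_odd, Bool.toNat_true]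

theorem sum_even (k : ℕ) (τ : List (Bool × ℕ)) :
    sumMap (basic τ .even (k + 1)) = fun n => T ((false, k) :: τ) (2 * n + 2) := by
  funext n
  have h := sum_gR false k τ (n + 1)
  rw [sum_range_succ', gR, Bool.toNat_false] at h
  simp only [sumMap, LinearMap.coe_mk, AddHom.coe_mk, basic, shift_even]
  rw [show 2 * n + 2 = 2 * (n + 1) by ring, ← h]
  simp only [gR, Bool.toNat_false, add_zero, mul_zero, Nat.cast_zero, ne_eq, Nat.add_eq_zero_iff,
    one_ne_zero, and_false, not_false_eq_true, zero_pow, div_zero]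
  refine sum_congr rfl fun m _ => ?_
  push_cast
  ring_nf

theorem sum_odd (k : ℕ) (τ : List (Bool × ℕ)) (n : ℕ) :
    ∑ m ∈ range n, T τ (2 * m + 1) / (2 * (m : ℝ) + 1) ^ (k + 1) = T ((true, k) :: τ) (2 * n) := by
  rw [← sum_gR]
  refine sum_congr rfl fun m _ => ?_
  rw [gR, Bool.toNat_true]
  push_cast
  rfl

theorem sum_odd_mem (k : ℕ) (τ : List (Bool × ℕ)) :
    (fun n => ∑ m ∈ range n, T τ (2 * m + 1) / (2 * (m : ℝ) + 1) ^ (k + 1))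
      ∈ innerSpace 0 (wt τ + k + 1) := by
  have h := T_add_one_mem ((true, k) :: τ)
  rw [wt_cons] at h
  have e : wt τ + k + 1 = k + 1 + wt τ := by omega
  rw [e]
  convert h using 1
  funext n
  rw [sum_odd, T_odd_odd]

/-- After the shift `n ↦ n + 1` the form `2n - 1` becomes `2m + 1`, and `T_τ(2m + 2)` differs from
`T_τ(2m + 1)` by a term with the same denominator. -/
theorem sum_basic_oddPred_mem (k : ℕ) (τ : List (Bool × ℕ)) :
    sumMap (basic τ .oddPred (k + 1)) ∈ innerSpace 0 (wt τ + k + 1) := by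
  have h1 := sum_odd_mem k τ
  rcases τ with _ | ⟨⟨b, j⟩, τ⟩
  · convert h1 using 1
    funext n
    simp [sumMap, basic, shift_oddPred, T]
  · cases b
    · convert h1 using 1
      funext n
      simp [sumMap, basic, shift_oddPred, T_even_even]
    · have h2 := sum_odd_mem (k + j + 1) τ
      have h3 : wt ((true, j) :: τ) + k + 1 = wt τ + (k + j + 1) + 1 := by
        rw [wt_cons]
        omega
      rw [h3] at h1 ⊢
      convert (innerSpace 0 _).add_mem h1 h2 using 1
      funext n
      simp only [sumMap, LinearMap.coe_mk, AddHom.coe_mk, basic, shift_oddPred, Pi.add_apply]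
      rw [← sum_add_distrib]
      refine sum_congr rfl fun m _ => ?_
      have : 2 * (m : ℝ) + 1 ≠ 0 := by positivity
      rw [T_odd_even]
      push_cast
      field_simp
      ring

theorem sum_odd_succ_mem (k : ℕ) (τ : List (Bool × ℕ)) :
    (sumMap fun m => T τ (2 * m + 3) / (2 * (m : ℝ) + 3) ^ (k + 1))
      ∈ innerSpace 0 (wt τ + k + 1) := by
  obtain ⟨r, hr⟩ := exists_T_eq_rat τ 1
  have h := basic_mem (τ := (true, k) :: τ) (l := .even) (j := 0) (w := wt τ + k + 1)
    (Nat.zero_le 0) (by rw [wt_cons]; omega)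
  convert (innerSpace 0 _).sub_mem h (const_mem_innerSpace _ r) using 1
  funext n
  have h2 := sum_odd k τ (n + 1)
  rw [sum_range_succ'] at h2
  simp only [sumMap, LinearMap.coe_mk, AddHom.coe_mk, Pi.sub_apply, basic, pow_zero, div_one]
  rw [show 2 * n + 2 = 2 * (n + 1) by ring, ← h2, ← hr]
  simp only [mul_zero, zero_add, Nat.cast_zero, one_pow, div_one, add_sub_cancel_right]
  refine sum_congr rfl fun m _ => ?_
  push_cast
  ring_nf

/-- `T_τ(2n) = T_τ(2n + 1)` up to a term of smaller depth, to which partial fractions apply. -/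
theorem basic_oddSucc_mem_of {V : Submodule ℚ (ℕ → ℝ)} (k j : ℕ) (τ : List (Bool × ℕ))
    (h : (fun n => T ((false, j) :: τ) (2 * n + 3) / (2 * (n : ℝ) + 3) ^ (k + 1)) ∈ V)
    (h1 : ∀ m, 1 ≤ m → m ≤ k + 1 → basic τ .oddSucc m ∈ V)
    (h2 : ∀ m, 1 ≤ m → m ≤ j + 1 → basic τ .even m ∈ V) :
    basic ((false, j) :: τ) .oddSucc (k + 1) ∈ V := by
  have h3 := partial_fraction_mem (f := fun n => T τ (2 * n + 2))
    (show LinForm.oddSucc ≠ LinForm.even by simp) (i := k + 1) (j := j + 1) (by omega) h1 h2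
  convert V.sub_mem h h3 using 1
  funext n
  simp only [basic, Pi.sub_apply, shift_oddSucc, shift_even]
  have e1 : 2 * (n : ℝ) + 3 ≠ 0 := by positivity
  have e2 : 2 * (n : ℝ) + 2 ≠ 0 := by positivity
  rw [show 2 * n + 3 = 2 * (n + 1) + 1 by ring, T_even_odd, show 2 * (n + 1) = 2 * n + 2 by ring]
  push_cast
  field_simp
  ring

theorem basic_true_oddSucc (k j : ℕ) (τ : List (Bool × ℕ)) :
    basic ((true, j) :: τ) .oddSucc (k + 1)
      = fun n => T ((true, j) :: τ) (2 * n + 3) / (2 * (n : ℝ) + 3) ^ (k + 1) := by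
  funext n
  rw [basic, shift_oddSucc, show 2 * n + 3 = 2 * (n + 1) + 1 by ring, T_odd_odd]
  ring_nf

theorem basic_nil_oddSucc (k : ℕ) : basic [] .oddSucc (k + 1)
    = fun n => T [] (2 * n + 3) / (2 * (n : ℝ) + 3) ^ (k + 1) := by
  funext n
  simp [basic, shift_oddSucc, T]

theorem sum_even_mem (k : ℕ) (τ : List (Bool × ℕ)) :
    sumMap (basic τ .even (k + 1)) ∈ innerSpace 0 (wt τ + k + 1) := by
  rw [sum_even]
  convert basic_mem (τ := (false, k) :: τ) (l := .even) (j := 0) (w := wt τ + k + 1)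
    (Nat.zero_le 0) (by rw [wt_cons]; omega) using 1
  funext n
  simp [basic]

theorem sum_basic_oddSucc_mem (k : ℕ) (τ : List (Bool × ℕ)) :
    sumMap (basic τ .oddSucc (k + 1)) ∈ innerSpace 0 (wt τ + k + 1) := by
  induction τ generalizing k with
  | nil =>
    rw [basic_nil_oddSucc]
    exact sum_odd_succ_mem k []
  | cons p τ ih =>
    obtain ⟨b, j⟩ := p
    cases b
    · refine basic_oddSucc_mem_of
        (V := (innerSpace 0 (wt ((false, j) :: τ) + k + 1)).comap sumMap) k j τ
        (sum_odd_succ_mem k ((false, j) :: τ)) (fun m h1 h2 => ?_) fun m h1 h2 => ?_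
      · obtain ⟨m, rfl⟩ := Nat.exists_eq_add_of_le' h1
        exact innerSpace_mono le_rfl (by rw [wt_cons]; omega) (ih m)
      · obtain ⟨m, rfl⟩ := Nat.exists_eq_add_of_le' h1
        exact innerSpace_mono le_rfl (by rw [wt_cons]; omega) (sum_even_mem m τ)
    · rw [basic_true_oddSucc]
      exact sum_odd_succ_mem k ((true, j) :: τ)

/-- Nested sums with arbitrary linear forms reduce to the sums `T`, without increasing the weight.
-/
theorem sumMap_mem {w : ℕ} {c : ℕ → ℝ} (hc : c ∈ innerSpace 1 w) :
    sumMap c ∈ innerSpace 0 w := by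
  suffices innerSpace 1 w ≤ (innerSpace 0 w).comap sumMap from this hc
  refine Submodule.span_le.2 ?_
  rintro c ⟨τ, l, j, h0, h1, rfl⟩
  rw [SetLike.mem_coe, Submodule.mem_comap]
  obtain ⟨k, rfl⟩ := Nat.exists_eq_add_of_le' h0
  refine innerSpace_mono le_rfl (by omega : wt τ + k + 1 ≤ w) ?_
  cases l
  · exact sum_even_mem k τ
  · exact sum_basic_oddSucc_mem k τ
  · exact sum_basic_oddPred_mem k τ

theorem basic_even_mem (k : ℕ) (τ : List (Bool × ℕ)) :
    basic τ .even (k + 1) ∈ valueSpace (wt τ + k + 2) := by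
  convert even_mem k τ using 1
  funext n
  rw [basic, shift_even]

theorem basic_oddPred_mem (k : ℕ) (τ : List (Bool × ℕ)) :
    basic τ .oddPred (k + 1) ∈ valueSpace (wt τ + max k 1) := by
  convert mR_mem k τ using 1
  funext n
  rw [basic, shift_oddPred, mR]

theorem basic_oddSucc_mem (k : ℕ) (τ : List (Bool × ℕ)) :
    basic τ .oddSucc (k + 1) ∈ valueSpace (wt τ + k + 2) := by
  induction τ generalizing k with
  | nil =>
    rw [basic_nil_oddSucc]
    exact odd_mem k []
  | cons p τ ih =>
    obtain ⟨b, j⟩ := p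
    cases b
    · refine basic_oddSucc_mem_of k j τ (odd_mem k ((false, j) :: τ)) (fun m h1 h2 => ?_)
        fun m h1 h2 => ?_
      · obtain ⟨m, rfl⟩ := Nat.exists_eq_add_of_le' h1
        exact valueSpace_mono (by rw [wt_cons]; omega) (ih m)
      · obtain ⟨m, rfl⟩ := Nat.exists_eq_add_of_le' h1
        exact valueSpace_mono (by rw [wt_cons]; omega) (basic_even_mem m τ)
    · rw [basic_true_oddSucc]
      exact odd_mem k ((true, j) :: τ)

theorem basic_mem_valueSpace {τ : List (Bool × ℕ)} {l : LinForm} {m w : ℕ} (hm : 1 ≤ m)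
    (h : wt τ + m + 1 ≤ w) : basic τ l m ∈ valueSpace w := by
  obtain ⟨m, rfl⟩ := Nat.exists_eq_add_of_le' hm
  cases l
  · exact valueSpace_mono (by omega) (basic_even_mem m τ)
  · exact valueSpace_mono (by omega) (basic_oddSucc_mem m τ)
  · exact valueSpace_mono (by omega) (basic_oddPred_mem m τ)

/-- The same with the drop of weight for `2n - 1`, provided that the exponent is large enough for
the drop not to meet the lower bound `wt τ + 1`. -/
theorem basic_mem_valueSpace_eta {τ : List (Bool × ℕ)} {l : LinForm} {m w : ℕ} (hm : 1 ≤ m)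
    (h : wt τ + m + 1 ≤ w + l.eta) (h' : wt τ + 1 ≤ w) : basic τ l m ∈ valueSpace w := by
  cases l
  · exact basic_mem_valueSpace hm h
  · exact basic_mem_valueSpace hm h
  · obtain ⟨m, rfl⟩ := Nat.exists_eq_add_of_le' hm
    simp only [LinForm.eta] at h
    exact valueSpace_mono (by omega) (basic_oddPred_mem m τ)

/-- The outermost summation. The exponent of the outermost form is at least `3`, so all terms in
which partial fractions lower it have a weight well below the bound. -/
theorem divMap_mem_valueSpace {w : ℕ} {c : ℕ → ℝ} (hc : c ∈ innerSpace 0 w) (l : LinForm) {k : ℕ}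
    (hk : 3 ≤ k) : divMap l k c ∈ valueSpace (w + k + 1 - l.eta) := by
  have hη : l.eta ≤ 2 := by cases l <;> simp [LinForm.eta]
  suffices innerSpace 0 w ≤ (valueSpace (w + k + 1 - l.eta)).comap (divMap l k) from this hc
  refine Submodule.span_le.2 ?_
  rintro c ⟨τ, l', j, -, h1, rfl⟩
  rw [SetLike.mem_coe, Submodule.mem_comap]
  by_cases hl : l = l'
  · subst hl
    convert basic_mem_valueSpace_eta (τ := τ) (l := l) (m := j + k) (w := w + k + 1 - l.eta)
      (by omega) (by omega) (by omega) using 1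
    funext n
    simp only [divMap, LinearMap.coe_mk, AddHom.coe_mk, basic]
    rw [div_div, pow_add]
  · have h := partial_fraction_mem (V := valueSpace (w + k + 1 - l.eta))
      (f := fun n => T τ (2 * n + 2)) hl (i := k) (j := j) (by omega)
      (fun m h1 h2 => basic_mem_valueSpace_eta (τ := τ) (l := l) h1 (by omega) (by omega))
      (fun m h1 h2 => basic_mem_valueSpace (τ := τ) (l := l') h1 (by omega))
    convert h using 1
    funext n
    simp only [divMap, LinearMap.coe_mk, AddHom.coe_mk, basic]
    rw [div_div, mul_comm (l'.shift n ^ j)]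

/-! ### Sums over index sets as nested sums -/

/-- The number of indices `m` with `r.Holds N m`. -/
def Sign.bound : Sign → ℕ → ℕ
  | .gt, N => N
  | .ge, N => N + 1

theorem holds_iff (r : Sign) (N m : ℕ) : r.Holds N m ↔ m < r.bound N := by
  cases r
  · exact Iff.rfl
  · exact Nat.lt_succ_iff.symm

theorem bound_le (r : Sign) (N : ℕ) : r.bound N ≤ N + 1 := by
  cases r
  · exact Nat.le_succ N
  · exact le_rfl

/-- The first entry of a tuple of indices; `0` for the empty tuple, by the convention
`n_{d+1} = 0`. -/
def firstIndex {d : ℕ} (m : Fin d → ℕ) : ℕ := if h : 0 < d then m ⟨0, h⟩ else 0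

/-- The tuples of indices that may follow the index `N` and the sign `r₀`. -/
def tailSet {d : ℕ} (r₀ : Sign) (r : Fin d → Sign) (N : ℕ) : Set (Fin d → ℕ) :=
  {m | r₀.Holds N (firstIndex m) ∧ m ∈ indexSet r}

theorem cons_mem_indexSet {d : ℕ} (r : Fin (d + 1) → Sign) (N : ℕ) (m : Fin d → ℕ) :
    (Fin.cons N m : Fin (d + 1) → ℕ) ∈ indexSet r ↔ m ∈ tailSet (r 0) (Fin.tail r) N := by
  have h0 : next (Fin.cons N m : Fin (d + 1) → ℕ) 0 = firstIndex m := by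
    rcases d with _ | d
    · simp [next, firstIndex]
    · simp only [next, firstIndex, Fin.val_zero, zero_add, Nat.lt_add_left_iff_pos,
        Nat.zero_lt_succ, dite_true]
      exact Fin.cons_succ (α := fun _ => ℕ) N m 0
  have hsucc : ∀ j : Fin d, next (Fin.cons N m : Fin (d + 1) → ℕ) j.succ = next m j := fun j => by
    simp only [next, Fin.val_succ, Nat.add_lt_add_iff_right]
    split_ifs with h
    · exact Fin.cons_succ (α := fun _ => ℕ) N m ⟨j + 1, h⟩
    · rfl
  simp only [indexSet, tailSet, Set.mem_ofPred_eq, Fin.forall_fin_succ, Fin.cons_zero,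
    Fin.cons_succ, h0, hsucc]
  rfl

theorem cons_mem_tailSet {d : ℕ} (r₀ : Sign) (r : Fin (d + 1) → Sign) (N M : ℕ) (m : Fin d → ℕ) :
    (Fin.cons M m : Fin (d + 1) → ℕ) ∈ tailSet r₀ r N
      ↔ M < r₀.bound N ∧ m ∈ tailSet (r 0) (Fin.tail r) M := by
  rw [← cons_mem_indexSet, ← holds_iff]
  rfl

theorem le_of_mem_tailSet {d : ℕ} {r₀ : Sign} {r : Fin d → Sign} {N : ℕ} {m : Fin d → ℕ}
    (hm : m ∈ tailSet r₀ r N) (j : Fin d) : m j ≤ N := by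
  induction d generalizing r₀ N with
  | zero => exact j.elim0
  | succ d ih =>
    obtain ⟨M, m, rfl⟩ : ∃ M m', m = Fin.cons M m' := ⟨m 0, Fin.tail m, (Fin.cons_self_tail m).symm⟩
    obtain ⟨h1, h2⟩ := (cons_mem_tailSet r₀ r N M m).1 hm
    have h3 : M ≤ N := Nat.lt_succ_iff.1 (h1.trans_le (bound_le r₀ N))
    refine Fin.cases ?_ (fun j => ?_) j
    · simpa using h3
    · simpa using (ih h2 j).trans h3

theorem finite_tailSet {d : ℕ} (r₀ : Sign) (r : Fin d → Sign) (N : ℕ) :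
    (tailSet r₀ r N).Finite :=
  (Set.finite_Iic fun _ : Fin d => N).subset fun _ hm => le_of_mem_tailSet hm

/-- The nested sum `∑ g₁(n₁) ⋯ g_d(n_d)` over `N ≻₀ n₁ ≻₁ ⋯ ≻_{d-1} n_d ≻_d 0`. -/
def nest : {d : ℕ} → Sign → (Fin d → Sign) → (Fin d → ℕ → ℝ) → ℕ → ℝ
  | 0, r₀, _, _, N => if 0 < r₀.bound N then 1 else 0
  | _ + 1, r₀, r, g, N =>
    ∑ m ∈ range (r₀.bound N), g 0 m * nest (r 0) (Fin.tail r) (Fin.tail g) m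

/-- A nonempty tuple as its first entry together with the remaining ones. -/
def consIndex (d : ℕ) : ℕ × (Fin d → ℕ) ≃ (Fin (d + 1) → ℕ) where
  toFun p := Fin.cons p.1 p.2
  invFun n := (n 0, Fin.tail n)
  left_inv _ := rfl
  right_inv n := Fin.cons_self_tail n

theorem consIndex_apply {d : ℕ} (p : ℕ × (Fin d → ℕ)) : consIndex d p = Fin.cons p.1 p.2 := rfl

theorem indicator_cons_tailSet {d : ℕ} (r₀ : Sign) (r : Fin (d + 1) → Sign)
    (g : Fin (d + 1) → ℕ → ℝ) (N M : ℕ) (m : Fin d → ℕ) :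
    (tailSet r₀ r N).indicator (fun m => ∏ j, g j (m j)) (Fin.cons M m)
      = (if M < r₀.bound N then g 0 M else 0)
        * (tailSet (r 0) (Fin.tail r) M).indicator (fun m => ∏ j, Fin.tail g j (m j)) m := by
  classical
  simp only [Set.indicator_apply, cons_mem_tailSet, Fin.prod_univ_succ, Fin.cons_zero,
    Fin.cons_succ, Fin.tail]
  by_cases h1 : M < r₀.bound N <;> simp [h1]

theorem hasSum_nest {d : ℕ} (r₀ : Sign) (r : Fin d → Sign) (g : Fin d → ℕ → ℝ) (N : ℕ) :
    HasSum ((tailSet r₀ r N).indicator fun m => ∏ j, g j (m j)) (nest r₀ r g N) := by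
  induction d generalizing r₀ N with
  | zero =>
    have h := hasSum_unique ((tailSet r₀ r N).indicator fun m => ∏ j, g j (m j))
    convert h using 1
    simp [nest, Set.indicator, tailSet, indexSet, firstIndex, holds_iff]
  | succ d ih =>
    set f := (tailSet r₀ r N).indicator fun m => ∏ j, g j (m j) with hf
    have hs0 : Summable f := summable_of_hasFiniteSupport
      ((finite_tailSet r₀ r N).subset Set.support_indicator_subset)
    have hs : Summable (f ∘ consIndex d) := (consIndex d).summable_iff.2 hs0
    have h1 := hs.hasSum.prod_fiberwise (g := fun M => (if M < r₀.bound N then g 0 M else 0)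
        * nest (r 0) (Fin.tail r) (Fin.tail g) M) fun M => by
      simp only [hf, Function.comp_apply, consIndex_apply, indicator_cons_tailSet]
      exact (ih (r 0) (Fin.tail r) (Fin.tail g) M).mul_left _
    have h2 : HasSum (fun M => (if M < r₀.bound N then g 0 M else 0)
        * nest (r 0) (Fin.tail r) (Fin.tail g) M) (nest r₀ r g N) := by
      have h3 := hasSum_sum_of_ne_finset_zero (s := range (r₀.bound N))
        (f := fun M => (if M < r₀.bound N then g 0 M else 0)
          * nest (r 0) (Fin.tail r) (Fin.tail g) M) (L := .unconditional ℕ) fun M hM => by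
            rw [if_neg (mt mem_range.2 hM), zero_mul]
      convert h3 using 1
      rw [nest]
      exact sum_congr rfl fun M hM => by rw [if_pos (mem_range.1 hM)]
    rw [← (consIndex d).hasSum_iff, h2.unique h1]
    exact hs.hasSum

theorem nest_abs_nonneg {d : ℕ} (r₀ : Sign) (r : Fin d → Sign) (g : Fin d → ℕ → ℝ) (N : ℕ) :
    0 ≤ nest r₀ r (fun j m => |g j m|) N :=
  (hasSum_nest r₀ r _ N).nonneg fun _ => Set.indicator_nonneg
    (fun _ _ => prod_nonneg fun _ _ => abs_nonneg _) _

/-- A weighted sum over `n₁ ≻₁ ⋯ ≻_d 0` is a single sum over `n₁` of nested sums. -/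
theorem hasSum_indexSet {d : ℕ} (r : Fin (d + 1) → Sign) (G : ℕ → ℝ) (g : Fin d → ℕ → ℝ)
    (hG : Summable fun n => |G n| * nest (r 0) (Fin.tail r) (fun j m => |g j m|) n) :
    HasSum (fun n : indexSet r => G (n.1 0) * ∏ j : Fin d, g j (n.1 j.succ))
      (∑' n, G n * nest (r 0) (Fin.tail r) g n) := by
  classical
  set F : (Fin (d + 1) → ℕ) → ℝ :=
    (indexSet r).indicator fun n => G (n 0) * ∏ j : Fin d, g j (n j.succ) with hF
  have hcons : ∀ p : ℕ × (Fin d → ℕ), F (consIndex d p)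
      = G p.1 * (tailSet (r 0) (Fin.tail r) p.1).indicator (fun m => ∏ j, g j (m j)) p.2 := by
    intro p
    simp only [hF, consIndex_apply, Set.indicator_apply, cons_mem_indexSet, Fin.cons_zero,
      Fin.cons_succ]
    split_ifs <;> simp
  have habs : ∀ p : ℕ × (Fin d → ℕ), |F (consIndex d p)|
      = |G p.1| * (tailSet (r 0) (Fin.tail r) p.1).indicator (fun m => ∏ j, |g j (m j)|) p.2 := by
    intro p
    rw [hcons, abs_mul, Set.indicator_apply, Set.indicator_apply]
    split_ifs
    · rw [abs_prod]
    · rw [abs_zero]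
  have hfib : ∀ n, HasSum (fun m => |F (consIndex d (n, m))|)
      (|G n| * nest (r 0) (Fin.tail r) (fun j m => |g j m|) n) := fun n => by
    simp only [habs]
    exact (hasSum_nest _ _ (fun j m => |g j m|) n).mul_left _
  have hs : Summable fun p => F (consIndex d p) := by
    refine Summable.of_abs ?_
    rw [summable_prod_of_nonneg fun p => abs_nonneg _]
    refine ⟨fun n => (hfib n).summable, hG.congr fun n => (hfib n).tsum_eq.symm⟩
  have h1 := hs.hasSum.prod_fiberwise (g := fun n => G n * nest (r 0) (Fin.tail r) g n) fun n => by
    simp only [hcons]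
    exact (hasSum_nest _ _ _ n).mul_left _
  have h2 : HasSum F (∑' n, G n * nest (r 0) (Fin.tail r) g n) := by
    rw [← (consIndex d).hasSum_iff, h1.tsum_eq]
    exact hs.hasSum
  exact hasSum_subtype_iff_indicator.2 h2

/-! ### Bounds for nested sums -/

/-- The sequence `1 / l(n) ^ s`. For `s ≥ 1` its value where `l` vanishes, that is for `2n` at `n =
0`, is `0`. -/
def recip (l : LinForm) (s n : ℕ) : ℝ := 1 / (l.val n : ℝ) ^ s

theorem recip_succ (l : LinForm) (s n : ℕ) : recip l s (n + 1) = 1 / l.shift n ^ s := rfl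

theorem abs_recip_zero_le (l : LinForm) {s : ℕ} (hs : 1 ≤ s) : |recip l s 0| ≤ 1 := by
  have : s ≠ 0 := by omega
  cases l <;> simp [recip, LinForm.val, this]

theorem abs_recip_le (l : LinForm) {s : ℕ} (hs : 1 ≤ s) {n : ℕ} (hn : 1 ≤ n) :
    |recip l s n| ≤ 1 / n := by
  obtain ⟨n, rfl⟩ := Nat.exists_eq_add_of_le' hn
  have h1 := shift_ge l n
  have h2 : (0 : ℝ) ≤ n := Nat.cast_nonneg n
  have h3 : 0 < l.shift n := by linarith
  rw [recip_succ, abs_of_pos (by positivity)]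
  push_cast
  refine one_div_le_one_div_of_le (by positivity) (h1.trans ?_)
  exact le_self_pow₀ (by linarith) (by omega)

/-- Nested sums of absolute values are `O(1 + n ^ (1/4))`; the summand `1` accounts for the index
`0`, where `q` vanishes. -/
theorem nest_abs_recip_le {d : ℕ} (r₀ : Sign) (r : Fin d → Sign) (l : Fin d → LinForm)
    (s : Fin d → ℕ) (hs : ∀ j, 1 ≤ s j) (N : ℕ) :
    nest r₀ r (fun j m => |recip (l j) (s j) m|) N ≤ 8 ^ d * (1 + q N) := by
  induction d generalizing r₀ N with
  | zero =>
    have := q_nonneg N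
    rw [nest, pow_zero, one_mul]
    split_ifs <;> linarith
  | succ d ih =>
    set ν := nest (r 0) (Fin.tail r) (Fin.tail fun j m => |recip (l j) (s j) m|) with hν
    have h0 : ∀ m, 0 ≤ ν m := fun m => nest_abs_nonneg _ _ _ m
    have h1 : ∀ m, ν m ≤ 8 ^ d * (1 + q m) := fun m =>
      ih (r 0) (Fin.tail r) (Fin.tail l) (Fin.tail s) (fun j => hs j.succ) m
    have h2 : ∀ m, |recip (l 0) (s 0) m| * ν m
        ≤ 8 ^ d * ((if m = 0 then 1 else 0) + 2 * (q m / m)) := by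
      intro m
      rcases Nat.eq_zero_or_pos m with rfl | hm
      · have h3 := h1 0
        rw [q_zero, add_zero] at h3
        simp only [if_true, Nat.cast_zero, div_zero, mul_zero, add_zero]
        calc _ ≤ 1 * ν 0 := by gcongr; exacts [h0 0, abs_recip_zero_le _ (hs 0)]
          _ ≤ _ := by rw [one_mul]; exact h3
      · rw [if_neg hm.ne', zero_add]
        have h4 := one_le_q hm
        have h5 : (0 : ℝ) < m := by exact_mod_cast hm
        calc |recip (l 0) (s 0) m| * ν m ≤ 1 / m * (8 ^ d * (1 + q m)) :=
            mul_le_mul (abs_recip_le _ (hs 0) hm) (h1 m) (h0 m) (by positivity)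
          _ ≤ 1 / m * (8 ^ d * (q m + q m)) := by gcongr
          _ = _ := by ring
    calc nest r₀ r (fun j m => |recip (l j) (s j) m|) N
        = ∑ m ∈ range (r₀.bound N), |recip (l 0) (s 0) m| * ν m := rfl
      _ ≤ ∑ m ∈ range (N + 1), |recip (l 0) (s 0) m| * ν m :=
          sum_le_sum_of_subset_of_nonneg (range_subset_range.2 (bound_le r₀ N))
            fun m _ _ => mul_nonneg (abs_nonneg _) (h0 m)
      _ ≤ ∑ m ∈ range (N + 1), 8 ^ d * ((if m = 0 then 1 else 0) + 2 * (q m / m)) :=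
          sum_le_sum fun m _ => h2 m
      _ = 8 ^ d * (1 + 2 * ∑ m ∈ range (N + 1), q m / m) := by
          rw [← mul_sum, sum_add_distrib, ← mul_sum, sum_ite_eq' (range (N + 1)) 0,
            if_pos (mem_range.2 (Nat.succ_pos N))]
      _ ≤ 8 ^ d * (1 + 2 * (4 * q N)) := by gcongr; exact sum_q_div_le N
      _ ≤ 8 ^ d * (8 * (1 + q N)) := by gcongr; linarith
      _ = 8 ^ (d + 1) * (1 + q N) := by ring

theorem summable_mul_nest {d : ℕ} (r₀ : Sign) (r : Fin d → Sign) (l₀ : LinForm)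
    (l : Fin d → LinForm) {s₀ : ℕ} (hs₀ : 1 ≤ s₀) (s : Fin d → ℕ) (hs : ∀ j, 1 ≤ s j) :
    Summable fun n => |a n ^ 2 * recip l₀ s₀ n| *
      nest r₀ r (fun j m => |recip (l j) (s j) m|) n := by
  rw [← summable_nat_add_iff 1]
  refine Summable.of_nonneg_of_le (fun n => mul_nonneg (abs_nonneg _) (nest_abs_nonneg _ _ _ _))
    (fun n => ?_) (((summable_nat_add_iff 1).2 summable_q_div_sq).mul_left (8 ^ d * 2))
  have h1 := nest_abs_recip_le r₀ r l s hs (n + 1)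
  have h2 := abs_recip_le l₀ hs₀ (Nat.le_add_left 1 n)
  have h3 : a (n + 1) ^ 2 ≤ 1 / ((n + 1 : ℕ) : ℝ) := by
    have h4 := a_sq_le (n + 1)
    rw [le_div_iff₀ (by positivity)]
    refine le_trans ?_ h4
    gcongr
    push_cast
    have : (0 : ℝ) ≤ n := Nat.cast_nonneg n
    linarith
  have h5 := one_le_q (Nat.le_add_left 1 n)
  have h6 : (0 : ℝ) < ((n + 1 : ℕ) : ℝ) := by positivity
  rw [abs_mul, abs_of_nonneg (sq_nonneg _)]
  calc _ ≤ 1 / ((n + 1 : ℕ) : ℝ) * (1 / ((n + 1 : ℕ) : ℝ)) * (8 ^ d * (1 + q (n + 1))) := by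
        refine mul_le_mul ?_ h1 (nest_abs_nonneg _ _ _ _) (by positivity)
        exact mul_le_mul h3 h2 (abs_nonneg _) (by positivity)
    _ ≤ 1 / ((n + 1 : ℕ) : ℝ) * (1 / ((n + 1 : ℕ) : ℝ)) * (8 ^ d * (q (n + 1) + q (n + 1))) := by
        gcongr
    _ = _ := by
        field_simp
        ring

/-- The Apéry-type series as a single sum over `n₁`. -/
theorem hasSum_term {d : ℕ} (r : Fin (d + 1) → Sign) (l : Fin (d + 1) → LinForm)
    (s : Fin (d + 1) → ℕ) (hs : ∀ j, 1 ≤ s j) :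
    HasSum (fun n : indexSet r => term d.succ_pos l s n)
      (∑' n, a n ^ 2 * (recip (l 0) (s 0) n *
        nest (r 0) (Fin.tail r) (fun j => recip (l j.succ) (s j.succ)) n)) := by
  have h := hasSum_indexSet r (fun n => a n ^ 2 * recip (l 0) (s 0) n)
    (fun j => recip (l j.succ) (s j.succ))
    (summable_mul_nest _ _ _ (fun j => l j.succ) (hs 0) (fun j => s j.succ) fun j => hs j.succ)
  simp only [mul_assoc] at h
  convert h using 2 with n
  rw [term, Fin.prod_univ_succ]
  simp only [recip, one_div, prod_inv_distrib]
  rw [div_eq_mul_inv, mul_inv]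
  rfl

/-! ### Arithmetic of nested sums -/

theorem exists_nest_eq_rat {d : ℕ} (r₀ : Sign) (r : Fin d → Sign) (l : Fin d → LinForm)
    (s : Fin d → ℕ) (N : ℕ) :
    ∃ c : ℚ, nest r₀ r (fun j => recip (l j) (s j)) N = c := by
  induction d generalizing r₀ N with
  | zero =>
    rw [nest]
    split_ifs
    exacts [⟨1, by simp⟩, ⟨0, by simp⟩]
  | succ d ih =>
    choose c hc using fun m => ih (r 0) (Fin.tail r) (Fin.tail l) (Fin.tail s) m
    refine ⟨∑ m ∈ range (r₀.bound N), 1 / ((l 0).val m : ℚ) ^ s 0 * c m, ?_⟩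
    rw [nest]
    push_cast
    refine sum_congr rfl fun m _ => ?_
    rw [← hc]
    rfl

/-- Each summation splits into its rational term at index `0` and a sum over positive indices; the
sign `≥` adds the diagonal term. -/
theorem nest_succ_mem {d : ℕ} (r₀ : Sign) (r : Fin d → Sign) (l : Fin d → LinForm)
    (s : Fin d → ℕ) (hs : ∀ j, 1 ≤ s j) :
    (fun n => nest r₀ r (fun j => recip (l j) (s j)) (n + 1)) ∈ innerSpace 0 (∑ j, s j) := by
  induction d generalizing r₀ with
  | zero =>
    have h := const_mem_innerSpace (∑ j, s j) 1
    convert h using 1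
    funext n
    cases r₀ <;> simp [nest, Sign.bound]
  | succ d ih =>
    have h := ih (r 0) (Fin.tail r) (Fin.tail l) (Fin.tail s) fun j => hs j.succ
    obtain ⟨c, hc⟩ := exists_nest_eq_rat (r 0) (Fin.tail r) (Fin.tail l) (Fin.tail s) 0
    have h1 := divMap_mem h (l 0) (hs 0)
    have e : (∑ j, Fin.tail s j) + s 0 = ∑ j, s j := by
      rw [Fin.sum_univ_succ, add_comm]
      rfl
    rw [e] at h1
    have h2 := (innerSpace 0 (∑ j, s j)).add_mem
      (const_mem_innerSpace _ (1 / ((l 0).val 0 : ℚ) ^ s 0 * c)) (sumMap_mem h1)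
    have key : ∀ m, divMap (l 0) (s 0) (fun n => nest (r 0) (Fin.tail r)
        (fun j => recip (Fin.tail l j) (Fin.tail s j)) (n + 1)) m
          = recip (l 0) (s 0) (m + 1) * nest (r 0) (Fin.tail r)
        (fun j => recip (Fin.tail l j) (Fin.tail s j)) (m + 1) := by
      intro m
      rw [recip_succ, one_div, mul_comm, ← div_eq_mul_inv]
      rfl
    have h3 : (fun n => nest .gt r (fun j => recip (l j) (s j)) (n + 1))
        ∈ innerSpace 0 (∑ j, s j) := by
      convert h2 using 1
      funext n
      rw [nest, Sign.bound, sum_range_succ', add_comm, Pi.add_apply]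
      simp only [sumMap, LinearMap.coe_mk, AddHom.coe_mk, key]
      push_cast
      rw [← hc]
      rfl
    cases r₀
    · exact h3
    · convert (innerSpace 0 (∑ j, s j)).add_mem h3 (innerSpace_mono (Nat.zero_le 1) le_rfl h1)
        using 1
      funext n
      rw [Pi.add_apply, key, nest, nest, Sign.bound, Sign.bound, sum_range_succ]
      rfl

theorem pi_mul_tsum_mem_of_succ {w : ℕ} (hw : 1 ≤ w) {f : ℕ → ℝ} {r : ℚ} (hr : f 0 = r)
    (h : (fun n => f (n + 1)) ∈ valueSpace w) :
    (Real.pi : ℂ) * ((∑' n, a n ^ 2 * f n : ℝ) : ℂ) ∈ VQi w := by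
  obtain ⟨h1, h2⟩ := mem_valueSpace.1 h
  have h3 : Summable fun n => a n ^ 2 * f n := (summable_nat_add_iff 1).1 h1
  rw [h3.tsum_eq_zero_add, Complex.ofReal_add, mul_add, a_zero, one_pow, one_mul, hr]
  exact (VQi w).add_mem (pi_mul_rat_mem hw r) h2

/-- The term at `n₁ = 0` contributes a rational multiple of `π`, which has weight `1`. -/
theorem pi_mul_tsum_mem_VQi {d : ℕ} (r₀ : Sign) (r : Fin d → Sign) (l₀ : LinForm)
    (l : Fin d → LinForm) {s₀ : ℕ} (hs₀ : 3 ≤ s₀) (s : Fin d → ℕ) (hs : ∀ j, 1 ≤ s j) :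
    (Real.pi : ℂ) * ((∑' n, a n ^ 2 * (recip l₀ s₀ n *
      nest r₀ r (fun j => recip (l j) (s j)) n) : ℝ) : ℂ)
        ∈ VQi ((∑ j, s j) + s₀ + 1 - l₀.eta) := by
  have hη : l₀.eta ≤ 2 := by cases l₀ <;> simp [LinForm.eta]
  have h := divMap_mem_valueSpace (nest_succ_mem r₀ r l s hs) l₀ hs₀
  obtain ⟨c, hc⟩ := exists_nest_eq_rat r₀ r l s 0
  refine pi_mul_tsum_mem_of_succ (by omega) (r := 1 / (l₀.val 0 : ℚ) ^ s₀ * c) ?_ ?_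
  · rw [hc, recip]
    simp only [Rat.cast_mul, Rat.cast_div, Rat.cast_one, Rat.cast_pow, Rat.cast_intCast]
  · convert h using 1
    funext n
    rw [recip_succ, one_div, mul_comm, ← div_eq_mul_inv]
    rfl

/-! ### Series without the linear form `2n - 1` -/

/-- Whether the values of a linear form are odd. -/
def LinForm.isOdd : LinForm → Bool
  | .even => false
  | .oddSucc => true
  | .oddPred => true

/-- The span of the sequences `T_τ(2n) / (2n) ^ (k + 1)` (for `b = false`) or
`T_τ(2n + 1) / (2n + 1) ^ (k + 1)` (for `b = true`) of weight `w`. -/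
def gSpace (b : Bool) (w : ℕ) : Submodule ℚ (ℕ → ℝ) :=
  Submodule.span ℚ {c | ∃ k τ, wt ((b, k) :: τ) = w ∧ c = gR b k τ}

theorem gR_mem (b : Bool) {k w : ℕ} {τ : List (Bool × ℕ)} (h : wt ((b, k) :: τ) = w) :
    gR b k τ ∈ gSpace b w :=
  Submodule.subset_span ⟨k, τ, h, rfl⟩

/-- One more summation, with the sign belonging to the linear form, and division by a power of the
linear form. -/
def stepMap (l : LinForm) (s : ℕ) : (ℕ → ℝ) →ₗ[ℚ] (ℕ → ℝ) where
  toFun f n := recip l s n * ∑ m ∈ range (l.sign.bound n), f m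
  map_add' f f' := by
    funext n
    simp [sum_add_distrib, mul_add]
  map_smul' r f := by
    funext n
    simp [Rat.smul_def, ← mul_sum, mul_left_comm]

/-- The sign attached to the linear form is the one for which the sum over `m` is a value of `T` at
`l(n)` itself, up to a term of smaller depth and the same weight and parity. -/
theorem stepMap_gR_mem (l : LinForm) (hl : l = .even ∨ l = .oddSucc) {s : ℕ} (hs : 1 ≤ s)
    (b : Bool) (k : ℕ) (τ : List (Bool × ℕ)) :
    stepMap l s (gR b k τ) ∈ gSpace l.isOdd (wt ((b, k) :: τ) + s) := by
  obtain ⟨s, rfl⟩ := Nat.exists_eq_add_of_le' hs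
  rcases hl with rfl | rfl
  · rw [show LinForm.even.isOdd = false from rfl]
    convert gR_mem false (k := s) (τ := (b, k) :: τ) (w := wt ((b, k) :: τ) + (s + 1))
      (by rw [wt_cons, add_comm]) using 1
    funext n
    simp only [stepMap, LinearMap.coe_mk, AddHom.coe_mk, LinForm.sign, Sign.bound, sum_gR]
    simp only [recip, LinForm.val, gR, Bool.toNat_false, add_zero]
    push_cast
    ring
  · rw [show LinForm.oddSucc.isOdd = true from rfl]
    have h1 := gR_mem true (k := s) (τ := (b, k) :: τ) (w := wt ((b, k) :: τ) + (s + 1))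
      (by rw [wt_cons, add_comm])
    cases b
    · convert h1 using 1
      funext n
      simp only [stepMap, LinearMap.coe_mk, AddHom.coe_mk, LinForm.sign, Sign.bound, sum_gR]
      simp only [recip, LinForm.val, gR, Bool.toNat_true]
      rw [show 2 * (n + 1) = 2 * n + 2 by ring, T_even_even]
      push_cast
      ring
    · have h2 := gR_mem true (k := s + k + 1) (τ := τ) (w := wt ((true, k) :: τ) + (s + 1))
        (by rw [wt_cons, wt_cons]; omega)
      convert (gSpace _ _).add_mem h1 h2 using 1
      funext n
      simp only [stepMap, LinearMap.coe_mk, AddHom.coe_mk, LinForm.sign, Sign.bound, sum_gR,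
        Pi.add_apply]
      simp only [recip, LinForm.val, gR, Bool.toNat_true]
      rw [show 2 * (n + 1) = 2 * n + 2 by ring, T_odd_even]
      push_cast
      have : 2 * (n : ℝ) + 1 ≠ 0 := by positivity
      field_simp
      ring

theorem recip_mul_nest_mem {d : ℕ} (l : Fin (d + 1) → LinForm)
    (hl : ∀ j, l j = .even ∨ l j = .oddSucc) (s : Fin (d + 1) → ℕ) (hs : ∀ j, 1 ≤ s j) :
    (fun n => recip (l 0) (s 0) n * nest (l 0).sign (fun j : Fin d => (l j.succ).sign)
      (fun j => recip (l j.succ) (s j.succ)) n) ∈ gSpace (l 0).isOdd (∑ j, s j) := by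
  induction d with
  | zero =>
    obtain ⟨k, hk⟩ := Nat.exists_eq_add_of_le' (hs 0)
    have h := gR_mem (l 0).isOdd (k := k) (τ := []) (w := ∑ j, s j) (by
      rw [wt_cons, wt_nil, Fin.sum_univ_one, hk])
    convert h using 1
    funext n
    rcases hl 0 with h0 | h0
    · rw [h0, hk]
      rcases n with _ | n
      · simp [nest, Sign.bound, LinForm.sign, recip, gR, LinForm.isOdd, LinForm.val]
      · simp [nest, Sign.bound, LinForm.sign, recip, gR, LinForm.isOdd, LinForm.val, T]
    · rw [h0, hk]
      simp [nest, Sign.bound, LinForm.sign, recip, gR, LinForm.isOdd, LinForm.val, T]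
  | succ d ih =>
    have h := ih (fun j => l j.succ) (fun j => hl j.succ) (fun j => s j.succ) fun j => hs j.succ
    suffices hle : gSpace (l (Fin.succ 0)).isOdd (∑ j : Fin (d + 1), s j.succ)
        ≤ (gSpace (l 0).isOdd (∑ j, s j)).comap (stepMap (l 0) (s 0)) from hle h
    refine Submodule.span_le.2 ?_
    rintro c ⟨k, τ, hw, rfl⟩
    have h1 := stepMap_gR_mem (l 0) (hl 0) (hs 0) (l (Fin.succ 0)).isOdd k τ
    rwa [hw, add_comm (∑ j : Fin (d + 1), s j.succ), ← Fin.sum_univ_succ] at h1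

theorem pi_mul_tsum_mem_twist {d : ℕ} (l : Fin (d + 1) → LinForm)
    (hl : ∀ j, l j = .even ∨ l j = .oddSucc) (s : Fin (d + 1) → ℕ) (hs : ∀ j, 1 ≤ s j) :
    (Real.pi : ℂ) * ((∑' n, a n ^ 2 * (recip (l 0) (s 0) n *
      nest (l 0).sign (fun j : Fin d => (l j.succ).sign)
        (fun j => recip (l j.succ) (s j.succ)) n) : ℝ) : ℂ)
        ∈ twist 1 ((∑ j, s j) + 1) := by
  have h : gSpace (l 0).isOdd (∑ j, s j)
      ≤ seriesSpace (fun n => a n ^ 2) (twist 1 ((∑ j, s j) + 1)) := by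
    refine Submodule.span_le.2 ?_
    rintro c ⟨k, τ, hw, rfl⟩
    rw [← hw]
    exact ⟨summable_gR _ k τ, pi_mul_tsum_gR_mem _ k τ⟩
  exact (h (recip_mul_nest_mem l hl s hs)).2

/-- The bound `|s| + 1 - η(l₁)` alone suffices, so the second argument of the maximum is arbitrary.
-/
theorem exists_eq_div_pi {d : ℕ} (r : Fin (d + 1) → Sign) (l : Fin (d + 1) → LinForm)
    (s : Fin (d + 1) → ℕ) (hs : ∀ j, 1 ≤ s j) (hs0 : 3 ≤ s 0) (k : ℕ) :
    Summable (fun n : indexSet r => term d.succ_pos l s n) ∧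
      ∃ c ∈ extendQi (CMZVLe 4 (max ((∑ j, s j) + 1 - (l 0).eta) k)),
        ((∑' n : indexSet r, term d.succ_pos l s n : ℝ) : ℂ) = 1 / (Real.pi : ℂ) * c := by
  have h := hasSum_term r l s hs
  have hπ : (Real.pi : ℂ) ≠ 0 := by exact_mod_cast Real.pi_ne_zero
  refine ⟨h.summable, _, mem_VQi.1 (VQi_mono ?_ (pi_mul_tsum_mem_VQi (r 0) (Fin.tail r) (l 0)
    (fun j => l j.succ) hs0 (fun j => s j.succ) fun j => hs j.succ)), ?_⟩
  · rw [Fin.sum_univ_succ, add_comm (s 0)]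
    exact le_max_left _ _
  · rw [h.tsum_eq, ← mul_assoc, one_div, inv_mul_cancel₀ hπ, one_mul]

end AperyBinomial

end

theorem mainTheorem2 {d : ℕ} (hd : 0 < d) (s : Fin d → ℕ) (hs : ∀ j, 1 ≤ s j)
    (hs1 : 3 ≤ s ⟨0, hd⟩) (l : Fin d → AperyBinomial.LinForm) :
    -- (a)
    ((∀ j, l j = .even ∨ l j = .oddSucc) →
      Summable (fun n : AperyBinomial.indexSet (fun j => (l j).sign) =>
        AperyBinomial.term hd l s n) ∧
      ∃ c ∈ AperyBinomial.CMZV 4 ((∑ j, s j) + 1),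
        ((∑' n : AperyBinomial.indexSet (fun j => (l j).sign),
          AperyBinomial.term hd l s n : ℝ) : ℂ) = Complex.I / (Real.pi : ℂ) * c) ∧
    -- (b)
    (Summable (fun n : AperyBinomial.indexSet (fun j => (l j).sign) =>
        AperyBinomial.term hd l s n) ∧
      ∃ c ∈ AperyBinomial.extendQi (AperyBinomial.CMZVLe 4
          (max ((∑ j, s j) + 1 - (l ⟨0, hd⟩).eta) (AperyBinomial.iotaSecond l))),
        ((∑' n : AperyBinomial.indexSet (fun j => (l j).sign),
          AperyBinomial.term hd l s n : ℝ) : ℂ) = 1 / (Real.pi : ℂ) * c) ∧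
    -- (c)
    (∀ r : Fin d → AperyBinomial.Sign,
      (∀ n ∈ AperyBinomial.indexSet r, ∀ j, (l j).val (n j) ≠ 0) →
      Summable (fun n : AperyBinomial.indexSet r => AperyBinomial.term hd l s n) ∧
      ∃ c ∈ AperyBinomial.extendQi (AperyBinomial.CMZVLe 4
          (max ((∑ j, s j) + 1 - (l ⟨0, hd⟩).eta) (AperyBinomial.iotaSecond l))),
        ((∑' n : AperyBinomial.indexSet r,
          AperyBinomial.term hd l s n : ℝ) : ℂ) = 1 / (Real.pi : ℂ) * c) := by
  obtain ⟨d, rfl⟩ := Nat.exists_eq_add_of_le' hd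
  refine ⟨fun hl => ?_, AperyBinomial.exists_eq_div_pi _ l s hs hs1 _,
    fun r _ => AperyBinomial.exists_eq_div_pi r l s hs hs1 _⟩
  have h := AperyBinomial.hasSum_term (fun j => (l j).sign) l s hs
  have hπ : (Real.pi : ℂ) ≠ 0 := by exact_mod_cast Real.pi_ne_zero
  obtain ⟨c, hc, hcS⟩ := AperyBinomial.mem_twist.1
    (AperyBinomial.pi_mul_tsum_mem_twist l hl s hs)
  refine ⟨h.summable, c, hc, ?_⟩
  rw [h.tsum_eq, div_mul_eq_mul_div, eq_div_iff hπ, mul_comm, ← pow_one Complex.I, hcS]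
  rfl
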